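/- Let $Q\in\mathbb C[x,y]$ with $Q(0,0)\neq 0$, let $\mathcal V=\{Q=0\}\subset\mathbb C^2$ and assume that the curve $\mathcal V$ is smooth (at every point of $\mathcal V$ some polynomial vanishing on $\mathcal V$ has nonzero gradient). Put $\mathcal V'=\mathcal V\cap(\mathbb C\setminus\{0\})^2$. For real $r,s>0$ let $\hat r=\frac r{r+s}$, $\hat s=\frac s{r+s}$, and let $h(x,y)=-\hat r\log|x|-\hat s\log|y|$, extended by $h=+\infty$ to the points with $x=0$ or $y=0$. Let $\mathcal V^{\ge c}=\{p\in\mathcal V: h(p)\ge c\}$, and let $X^{\ge c}$ be the union of those connected components of $\mathcal V^{\ge c}$ that contain points with arbitrarily small $|x|$. A *Puiseux series solution* is a nonzero series $y(x)=\sum_{j\ge j_0}c_jx^{j/k}$ with $j_0\in\mathbb Z$, $c_{j_0}\ne0$ and $k\ge1$ as small as possible, such that $g(t)=\sum_{j\ge j_0}c_jt^j$ converges and $Q(t^k,g(t))=0$ for all sufficiently small $t\ne0$. Its *direction* is $-j_0/k$, and its graph over $0<|x|\le\varepsilon$ (with all $k$ sheets) is $\{(t^k,g(t)):0<|t|^k\le\varepsilon\}$.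 More generally, its graph over a neighbourhood $W$ of $0$ in the plane of the uniformizer $t=x^{1/k}$ is $\{(t^k,g(t)):t\in W\setminus\{0\}\}$, together with the point $(0,c_0)$ over $x=0$ when the series has no negative powers (here $c_0$ is the coefficient of $x^0$). Let $\mathrm{bad}$ be the set of positive directions of Puiseux series solutions. **Theorem.** If $r/s\notin\mathrm{bad}$, then there are $\varepsilon_0>0$ and $c^*\in\mathbb R$ such that for all $0<\varepsilon\le\varepsilon_0$ and all $c\ge c^*$ the following hold. 1. For each Puiseux series solution, $g(t)$ converges for $0<|t|^k\le\varepsilon$, and the graph over $0<|x|\le\varepsilon$ is a connected component of $\mathcal V'\cap\{|x|\le\varepsilon\}$. 2. Each such component $C$ becomes a closed topological disk after adjoining, as centre, its limit point as $x\to0$ in $\mathbb C\times(\mathbb C\cup\{\infty\})$, namely $(0,c_0)$ if the series has no negative powers and $(0,\infty)$ otherwise. The boundary circle of this disk is $C\cap\{|x|=\varepsilon\}$ and, suitably oriented, it winds $k$ times around the $y$-axis $\{x=0\}$. 3. The connected components of $X^{\ge c}$ are exactly the graphs, over some neighbourhood of $0$ in the plane of the uniformizer, of the Puiseux series solutions of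 direction less than $r/s$: each component is such a graph, and each such series has such a graph that is a component. 4. If a component $B$ of $X^{\ge c}$ is the graph over some neighbourhood of $0$ of a Puiseux series solution, and $C$ is the component of $\mathcal V'\cap\{|x|\le\varepsilon\}$ with the same series, then $C$ and $B\cap\mathcal V'$ are homotopic in $\mathcal V'$: the inclusion $C\hookrightarrow\mathcal V'$ is homotopic in $\mathcal V'$ to a homeomorphism of $C$ onto $B\cap\mathcal V'$. -/

import Mathlib

open scoped Polynomial Polynomial.Bivariate Topology

noncomputable section

/-- The zero set `𝒱` of a bivariate polynomial; `ℂ[X][Y]` is the ring of polynomials in `y`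
whose coefficients are polynomials in `x`. -/
def zeroSet (Q : ℂ[X][Y]) : Set (ℂ × ℂ) :=
  {p | Q.evalEval p.1 p.2 = 0}

/-- `𝒱' = 𝒱 ∩ (ℂ^*)²`, the part of `𝒱` off the coordinate axes. -/
def zeroSetOffAxes (Q : ℂ[X][Y]) : Set (ℂ × ℂ) :=
  {p | p ∈ zeroSet Q ∧ p.1 ≠ 0 ∧ p.2 ≠ 0}

/-- The plane algebraic curve `𝒱` is smooth (Jacobian criterion): at each of its points some
polynomial vanishing on `𝒱` has nonzero differential. When `Q` has no repeated factor this
says exactly that the gradient of `Q` vanishes nowhere on `𝒱`. -/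
def IsSmoothCurve (Q : ℂ[X][Y]) : Prop :=
  ∀ p ∈ zeroSet Q, ∃ f : ℂ[X][Y],
    (∀ q ∈ zeroSet Q, f.evalEval q.1 q.2 = 0) ∧
    fderiv ℂ (fun q : ℂ × ℂ => f.evalEval q.1 q.2) p ≠ 0

/-- A nonzero formal series `∑_{j ≥ j₀} c_j x^{j/k}` in which `k` is as small as possible.
It is stored as the Laurent series `∑ c_j t^j` in the uniformizer `t = x^{1/k}`. -/
structure PuiseuxSeries where
  /-- the common denominator `k` of the exponents -/
  k : ℕ
  k_pos : 0 < k
  /-- the coefficients `c_j` -/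
  coeffs : LaurentSeries ℂ
  coeffs_ne_zero : coeffs ≠ 0
  /-- minimality of `k`: the exponents `j` that occur have no common factor with `k` -/
  minimal : ∀ d : ℕ, d ∣ k → (∀ j : ℤ, coeffs.coeff j ≠ 0 → (d : ℤ) ∣ j) → d = 1

namespace PuiseuxSeries

/-- The series converges at the parameter value `t`. -/
def ConvergesAt (P : PuiseuxSeries) (t : ℂ) : Prop :=
  Summable fun j : ℤ => P.coeffs.coeff j * t ^ j

/-- The sum `g(t) = ∑ c_j t^j`; as `t` runs over the `k`-th roots of `x`, these are the
values of the multivalued function `y(x)`. -/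
def value (P : PuiseuxSeries) (t : ℂ) : ℂ :=
  ∑' j : ℤ, P.coeffs.coeff j * t ^ j

/-- The direction `-j₀ / k`. -/
def direction (P : PuiseuxSeries) : ℝ :=
  -(P.coeffs.order : ℝ) / (P.k : ℝ)

/-- `P` converges and solves `Q(x, y(x)) = 0` on some punctured neighbourhood of `0`. -/
def IsSolution (P : PuiseuxSeries) (Q : ℂ[X][Y]) : Prop :=
  ∀ᶠ t in 𝓝[≠] (0 : ℂ), P.ConvergesAt t ∧ (t ^ P.k, P.value t) ∈ zeroSet Q

/-- The part of the graph of `y(x)` parametrized by the nonzero `t` in `W`. -/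
def graph (P : PuiseuxSeries) (W : Set ℂ) : Set (ℂ × ℂ) :=
  (fun t : ℂ => (t ^ P.k, P.value t)) '' (W \ {0})

/-- The graph over `0 < |x| ≤ ε`, with all its `k` sheets. -/
def diskGraph (P : PuiseuxSeries) (ε : ℝ) : Set (ℂ × ℂ) :=
  P.graph {t : ℂ | ‖t‖ ^ P.k ≤ ε}

/-- The limit of `(x, y(x))` as `x → 0`, in `ℂ × (ℂ ∪ {∞})`: the point `(0, c₀)` if no negative
powers occur, and `(0, ∞)` otherwise. -/
def endpoint (P : PuiseuxSeries) : ℂ × OnePoint ℂ :=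
  (0, if 0 ≤ P.coeffs.order then ((P.coeffs.coeff 0 : ℂ) : OnePoint ℂ) else OnePoint.infty)

/-- `B` is the graph of `y(x)` over some neighbourhood of `0` (a neighbourhood `W` in the plane
of the uniformizer `t = x^{1/k}`). The point over `x = 0` is included if it is finite. -/
def IsGraphNearZero (P : PuiseuxSeries) (B : Set (ℂ × ℂ)) : Prop :=
  ∃ W ∈ 𝓝 (0 : ℂ), (∀ t ∈ W, P.ConvergesAt t) ∧
    B = P.graph W ∪ {p : ℂ × ℂ | (p.1, (p.2 : OnePoint ℂ)) = P.endpoint}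

end PuiseuxSeries

/-- The set of positive directions of the Puiseux series solutions. -/
def badDirections (Q : ℂ[X][Y]) : Set ℝ :=
  {β | 0 < β ∧ ∃ P : PuiseuxSeries, P.IsSolution Q ∧ P.direction = β}

open Classical in
/-- The height `h(x,y) = - r̂ log |x| - ŝ log |y|`, where `(r̂, ŝ) = (r, s) / (r + s)`, extended
by `+∞` to the coordinate axes. -/
def height (r s : ℝ) (p : ℂ × ℂ) : EReal :=
  if p.1 = 0 ∨ p.2 = 0 then ⊤
  else ((-(r / (r + s)) * Real.log ‖p.1‖ - (s / (r + s)) * Real.log ‖p.2‖ : ℝ) : EReal)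

/-- `𝒱^{≥ c}`, the points of `𝒱` of height at least `c`. -/
def superlevel (Q : ℂ[X][Y]) (r s c : ℝ) : Set (ℂ × ℂ) :=
  {p | p ∈ zeroSet Q ∧ (c : EReal) ≤ height r s p}

/-- `C` is a connected component of the subspace `S`. -/
def IsComponent (S C : Set (ℂ × ℂ)) : Prop :=
  ∃ p ∈ S, C = connectedComponentIn S p

/-- `X^{≥ c}`, the union of those components of `𝒱^{≥ c}` that contain arbitrarily small values
of `x`. -/
def xSuperlevel (Q : ℂ[X][Y]) (r s c : ℝ) : Set (ℂ × ℂ) :=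
  ⋃₀ {C | IsComponent (superlevel Q r s c) C ∧ ∀ δ > 0, ∃ p ∈ C, ‖p.1‖ < δ}

/-- The loop `γ : [0,1] → ℂ^*` has winding number `n` around `0`. -/
def HasWindingNumber (γ : ℝ → ℂ) (n : ℤ) : Prop :=
  ∃ L : ℝ → ℂ, ContinuousOn L (Set.Icc 0 1) ∧
    (∀ u ∈ Set.Icc (0 : ℝ) 1, Complex.exp (L u) = γ u) ∧
    L 1 - L 0 = 2 * Real.pi * Complex.I * n

/-- The point `e^{2πiu}` of the boundary circle of the closed unit disk. -/
def circlePoint (u : ℝ) : Metric.closedBall (0 : ℂ) 1 :=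
  ⟨Circle.exp (2 * Real.pi * u), by
    rw [mem_closedBall_zero_iff]; exact (Circle.norm_coe _).le⟩

/-- Adjoining `pt` to `C` (viewed in `ℂ × (ℂ ∪ {∞})`) gives a closed topological disk with `pt` as
its centre, so that `C` is a closed disk punctured at `pt`. The boundary circle of the disk is the
part of `C` with `|x| = ε`, and it winds `k` times around the `y`-axis `{x = 0}`. -/
def IsDiskWindingAroundYAxis (C : Set (ℂ × ℂ)) (pt : ℂ × OnePoint ℂ) (ε : ℝ) (k : ℕ) : Prop :=
  pt ∉ (fun p : ℂ × ℂ => (p.1, (p.2 : OnePoint ℂ))) '' C ∧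
  ∃ e : Metric.closedBall (0 : ℂ) 1 ≃ₜ
      (insert pt ((fun p : ℂ × ℂ => (p.1, (p.2 : OnePoint ℂ))) '' C) : Set (ℂ × OnePoint ℂ)),
    (∀ z : Metric.closedBall (0 : ℂ) 1, (z : ℂ) = 0 ↔ (e z : ℂ × OnePoint ℂ) = pt) ∧
    (∀ z : Metric.closedBall (0 : ℂ) 1,
      ‖(z : ℂ)‖ = 1 ↔ ‖(e z : ℂ × OnePoint ℂ).1‖ = ε) ∧
    HasWindingNumber (fun u => (e (circlePoint u) : ℂ × OnePoint ℂ).1) k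

/-- The subsets `A` and `B` of `M` are homotopic in `M`: the inclusion of `A` can be deformed
inside `M` to a homeomorphism of `A` onto `B`. -/
def HomotopicIn (M A B : Set (ℂ × ℂ)) : Prop :=
  ∃ (e : A ≃ₜ B) (H : C(unitInterval × A, M)),
    (∀ a : A, (H (0, a) : ℂ × ℂ) = a) ∧ ∀ a : A, (H (1, a) : ℂ × ℂ) = e a

end

/-! Over a small punctured disk `0 < |x| < R` the curve is a finite covering. The radical of `Q`
over `ℂ(x)`, cleared of denominators, has the same zeros as `Q` off finitely many vertical lines;
there its zeros in `y` are simple and bounded over compact sets, so the projection to `x` is a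
covering (`IsModel.isCoveringMap_proj`). Along `x = exp w` the covering unrolls over a half plane
into branches `η`. The values `η (w + 2πin)` lie in a finite fibre, so the periods of `η` are
`2πikℤ` with `k > 0`, and `η` descends to a holomorphic function of `t = exp (w / k)`. Zeros grow at
most polynomially as `x → 0`, so `t = 0` is at worst a pole: the Laurent series there is a Puiseux
solution. Conversely each solution continues to a branch over the whole punctured disk and converges
there (`IsModel.exists_solution_of_branch`, `IsModel.exists_branch_of_solution`). Solutions whose
graphs meet differ by `t ↦ ζt` with `ζ ^ k = 1`.

With its endpoint in `ℂ × (ℂ ∪ {∞})` added, the graph over `|x| ≤ ε` is an injective continuous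
image of a closed disk, hence compact. Finitely many such sets cover the curve over `0 < |x| ≤ ε`,
and two graphs are equal or disjoint. This gives the components and the disks.

Write `y = t ^ j₀ * u(t)` and `A = r̂k + ŝj₀`. The height along the graph is `-A log |t| - ŝ log
|u|`; in the coordinate `φ = t (u / u(0)) ^ (ŝ / A)` it is exactly `-A log |φ| + K`
(`IsModel.exists_heightCoordinate`). The rate `A` is nonzero because `r / s` is not bad, and it is
positive exactly for directions below `r / s`. For large `c` the set `h ≥ c` near `t = 0` is
therefore a round disk in `φ` if `A > 0`, and empty apart from the centre if `A < 0`. These disks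
lie strictly inside `|x| < ε`, so their graphs are cut off from the rest of the curve. They could
still touch at points over `x = 0`; smoothness excludes this, since two solutions with the same
finite endpoint have graphs that meet elsewhere too and so coincide
(`IsModel.exists_param_eq_of_endpoint_eq`).

The homotopy is a straight segment in the `t`-plane from the disk to the round neighbourhood; it
avoids `0` because `φ` is close to the identity. -/

noncomputable section

/-! ### Reduction to simple zeros -/

/-- Clearing denominators of a polynomial over the fraction field. -/
lemma exists_map_eq_C_mul (K : Type*) [Field K] [Algebra ℂ[X] K] [IsFractionRing ℂ[X] K]
    (p : Polynomial K) : ∃ b : ℂ[X], b ≠ 0 ∧ ∃ p' : ℂ[X][Y],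
      p'.map (algebraMap ℂ[X] K) = Polynomial.C (algebraMap ℂ[X] K b) * p := by
  obtain ⟨b, hb, h⟩ := IsLocalization.integerNormalization_spec (nonZeroDivisors ℂ[X]) p
  refine ⟨b, nonZeroDivisors.ne_zero hb, _, h.trans ?_⟩
  rw [← Polynomial.smul_eq_C_mul, algebraMap_smul]

/-- The radical of `Q` over the field of rational functions, with denominators cleared: `q` and `Q`
divide powers of each other up to factors in `ℂ[X]`, and so does the discriminant of `q`. -/
lemma exists_radical_identities (K : Type*) [Field K] [Algebra ℂ[X] K] [IsFractionRing ℂ[X] K]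
    (Q : ℂ[X][Y]) (hQ : Q ≠ 0) :
    ∃ (q m l u v : ℂ[X][Y]) (a b c d : ℂ[X]) (N : ℕ), q ≠ 0 ∧ a ≠ 0 ∧ b ≠ 0 ∧ d ≠ 0 ∧
      q * m = Polynomial.C a * Q ∧ Q * l * Polynomial.C c = Polynomial.C b * q ^ N ∧
      u * q + v * q.derivative = Polynomial.C d := by
  classical
  have hι : Function.Injective (algebraMap ℂ[X] K) := IsFractionRing.injective ℂ[X] K
  have : CharZero K := charZero_of_injective_algebraMap (R := ℂ[X]) hι
  have hm := Polynomial.map_injective _ hι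
  have hQK : Q.map (algebraMap ℂ[X] K) ≠ 0 := fun h => hQ (hm (by simpa using h))
  have hρ0 : UniqueFactorizationMonoid.radical (Q.map (algebraMap ℂ[X] K)) ≠ 0 :=
    UniqueFactorizationMonoid.radical_ne_zero
  -- In characteristic zero squarefree polynomials over a field are separable, which yields a Bézout
  -- identity for `ρ` and its derivative.
  have hsep : (UniqueFactorizationMonoid.radical (Q.map (algebraMap ℂ[X] K))).Separable :=
    PerfectField.separable_iff_squarefree.2 UniqueFactorizationMonoid.squarefree_radical
  obtain ⟨N, l, hl⟩ := UniqueFactorizationMonoid.exists_dvd_radical_self_pow hQK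
  obtain ⟨m, hmQ⟩ := UniqueFactorizationMonoid.radical_dvd_self
    (a := Q.map (algebraMap ℂ[X] K))
  generalize UniqueFactorizationMonoid.radical (Q.map (algebraMap ℂ[X] K)) = ρ at *
  obtain ⟨b, hb, q, hq⟩ := exists_map_eq_C_mul K ρ
  obtain ⟨u, v, huv⟩ := hsep
  obtain ⟨em, hem, m', hm'⟩ := exists_map_eq_C_mul K m
  obtain ⟨el, hel, l', hl'⟩ := exists_map_eq_C_mul K l
  obtain ⟨eu, heu, u', hu'⟩ := exists_map_eq_C_mul K u
  obtain ⟨ev, hev, v', hv'⟩ := exists_map_eq_C_mul K v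
  have hq0 : q ≠ 0 := by
    rintro rfl
    rw [Polynomial.map_zero] at hq
    exact mul_ne_zero (Polynomial.C_ne_zero.2 ((map_ne_zero_iff _ hι).2 hb)) hρ0 hq.symm
  have hq' : q.derivative.map (algebraMap ℂ[X] K) =
      Polynomial.C (algebraMap ℂ[X] K b) * Polynomial.derivative ρ := by
    rw [← Polynomial.derivative_map, hq, Polynomial.derivative_C_mul]
  refine ⟨q, m', l', Polynomial.C ev * u', Polynomial.C eu * v', b * em, el, b ^ N,
    eu * ev * b, N, hq0, mul_ne_zero hb hem, hel, mul_ne_zero (mul_ne_zero heu hev) hb,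
    hm ?_, hm ?_, hm ?_⟩
  · rw [Polynomial.map_mul, Polynomial.map_mul, Polynomial.map_C, hq, hm', hmQ,
      RingHom.map_mul, Polynomial.C_mul]
    ring
  · rw [Polynomial.map_mul, Polynomial.map_mul, Polynomial.map_mul, Polynomial.map_C,
      Polynomial.map_C, Polynomial.map_pow, hq, hl', RingHom.map_pow, Polynomial.C_pow,
      mul_pow, hl]
    ring
  · rw [Polynomial.map_add, Polynomial.map_mul, Polynomial.map_mul, Polynomial.map_mul,
      Polynomial.map_mul, Polynomial.map_C, Polynomial.map_C, Polynomial.map_C, hq, hu', hv', hq',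
      RingHom.map_mul, Polynomial.C_mul, RingHom.map_mul, Polynomial.C_mul]
    generalize Polynomial.C (algebraMap ℂ[X] K eu) = x at *
    generalize Polynomial.C (algebraMap ℂ[X] K ev) = y at *
    generalize Polynomial.C (algebraMap ℂ[X] K b) = z at *
    linear_combination x * y * z * huv

/-- Away from finitely many vertical lines the zero set of a bivariate polynomial is the zero set
of a polynomial all of whose zeros in the vertical direction are simple. -/
lemma exists_separable_model (Q : ℂ[X][Y]) (hQ : Q ≠ 0) :
    ∃ (q : ℂ[X][Y]) (D : ℂ[X]), D ≠ 0 ∧ ∀ x, D.eval x ≠ 0 →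
      (∀ y, Q.evalEval x y = 0 ↔ q.evalEval x y = 0) ∧
      (∀ y, q.evalEval x y = 0 → q.derivative.evalEval x y ≠ 0) ∧ q.leadingCoeff.eval x ≠ 0 := by
  obtain ⟨q, m, l, u, v, a, b, c, d, N, hq, ha, hb, hd, e1, e2, e3⟩ :=
    exists_radical_identities (FractionRing ℂ[X]) Q hQ
  -- Where `a` and `b` do not vanish, `Q` and `q` have the same zeros; `d` excludes common zeros of
  -- `q` and its derivative.
  refine ⟨q, a * b * d * q.leadingCoeff, mul_ne_zero (mul_ne_zero (mul_ne_zero ha hb) hd)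
    (Polynomial.leadingCoeff_ne_zero.2 hq), fun x hx => ?_⟩
  simp only [Polynomial.eval_mul, ne_eq, mul_eq_zero, not_or] at hx
  obtain ⟨⟨⟨ha, hb⟩, hd⟩, hlc⟩ := hx
  refine ⟨fun y => ⟨fun h => ?_, fun h => ?_⟩, fun y h h' => ?_, hlc⟩
  · have := congrArg (fun p => Polynomial.evalEval x y p) e2
    simp only [Polynomial.evalEval_mul, h, zero_mul, Polynomial.evalEval_C,
      Polynomial.evalEval_pow] at this
    have h3 := (mul_eq_zero.1 this.symm).resolve_left hb
    exact by_contra fun h4 => pow_ne_zero N h4 h3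
  · have := congrArg (fun p => Polynomial.evalEval x y p) e1
    simp only [Polynomial.evalEval_mul, h, zero_mul, Polynomial.evalEval_C] at this
    exact (mul_eq_zero.1 this.symm).resolve_left ha
  · have := congrArg (fun p => Polynomial.evalEval x y p) e3
    simp only [Polynomial.evalEval_mul, Polynomial.evalEval_add, h, h', mul_zero, add_zero,
      Polynomial.evalEval_C] at this
    exact hd this.symm

/-- `q` is a model of `Q` over the punctured disk of radius `R`: it has the same zeros, they are
simple in the vertical direction, and none of them escapes to infinity over a nonzero `x`.
Moreover `Q` has no zeros on the `x`-axis over the disk. -/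
structure IsModel (Q q : ℂ[X][Y]) (R : ℝ) : Prop where
  pos : 0 < R
  zero_iff : ∀ x, x ≠ 0 → ‖x‖ < R → ∀ y, Q.evalEval x y = 0 ↔ q.evalEval x y = 0
  simple : ∀ x, x ≠ 0 → ‖x‖ < R → ∀ y, q.evalEval x y = 0 → q.derivative.evalEval x y ≠ 0
  lead : ∀ x, x ≠ 0 → ‖x‖ < R → q.leadingCoeff.eval x ≠ 0
  axis : ∀ x, ‖x‖ < R → Q.evalEval x 0 ≠ 0

/-- The zeros of `D` other than `0` are finite in number, so a small disk contains none of them;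
`Q(0,0) ≠ 0` persists along the `x`-axis near `0` by continuity. -/
lemma exists_isModel (Q : ℂ[X][Y]) (hQ0 : Q.evalEval 0 0 ≠ 0) : ∃ q R, IsModel Q q R := by
  have hQ : Q ≠ 0 := by rintro rfl; simp at hQ0
  obtain ⟨q, D, hD, h⟩ := exists_separable_model Q hQ
  have h1 : ∀ᶠ x in 𝓝[≠] (0 : ℂ), D.eval x ≠ 0 := by
    have : (D.rootSet ℂ).Finite := D.rootSet_finite ℂ
    have h3 : ∀ᶠ x in 𝓝[≠] (0 : ℂ), x ∉ (D.rootSet ℂ) := by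
      have := (this.subset (Set.sdiff_subset (t := {(0:ℂ)}))).isClosed.isOpen_compl.mem_nhds
        (x := (0:ℂ)) (by simp)
      filter_upwards [mem_nhdsWithin_of_mem_nhds this, self_mem_nhdsWithin] with x hx hx0 hxD
      exact hx ⟨hxD, hx0⟩
    filter_upwards [h3] with x hx h0
    exact hx ((Polynomial.mem_rootSet).2 ⟨hD, by simpa using h0⟩)
  have h2 : ∀ᶠ x in 𝓝 (0 : ℂ), Q.evalEval x 0 ≠ 0 := by
    have : Continuous fun x : ℂ => Q.evalEval x 0 := by
      unfold Polynomial.evalEval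
      simpa using (Q.eval 0).continuous
    exact this.continuousAt.eventually_ne hQ0
  rw [eventually_nhdsWithin_iff] at h1
  obtain ⟨R, hR, hb⟩ := Metric.eventually_nhds_iff_ball.1 (h1.and h2)
  refine ⟨q, R, hR, fun x hx hxR => (h x ((hb x (by simpa using hxR)).1 hx)).1,
    fun x hx hxR => (h x ((hb x (by simpa using hxR)).1 hx)).2.1,
    fun x hx hxR => (h x ((hb x (by simpa using hxR)).1 hx)).2.2,
    fun x hxR => (hb x (by simpa using hxR)).2⟩

end

/-! ### The covering of the punctured disk and its branches -/

noncomputable section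

lemma evalEval_eq_sum (Q : ℂ[X][Y]) (x y : ℂ) :
    Q.evalEval x y = ∑ i ∈ Finset.range (Q.natDegree + 1), (Q.coeff i).eval x * y ^ i := by
  rw [Polynomial.evalEval, Polynomial.eval_eq_sum_range (p := Q),
    Polynomial.eval_finsetSum]
  simp

lemma contDiff_evalEval (Q : ℂ[X][Y]) : ContDiff ℂ 1 fun p : ℂ × ℂ => Q.evalEval p.1 p.2 := by
  simp only [evalEval_eq_sum]
  refine ContDiff.sum fun i _ => ContDiff.mul ?_ (contDiff_snd.pow i)
  exact (Q.coeff i).contDiff_aeval (𝕜 := ℂ) 1 |>.comp contDiff_fst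

lemma continuous_evalEval (Q : ℂ[X][Y]) : Continuous fun p : ℂ × ℂ => Q.evalEval p.1 p.2 :=
  (contDiff_evalEval Q).continuous

lemma isClosed_zeroSet (Q : ℂ[X][Y]) : IsClosed (zeroSet Q) :=
  isClosed_singleton.preimage (continuous_evalEval Q)

lemma fderiv_evalEval_vertical (Q : ℂ[X][Y]) (p : ℂ × ℂ) :
    fderiv ℂ (fun p : ℂ × ℂ => Q.evalEval p.1 p.2) p (0, 1) = Q.derivative.evalEval p.1 p.2 := by
  have h1 := (((contDiff_evalEval Q).differentiable one_ne_zero) p).hasFDerivAt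
  have h2 : HasDerivAt (fun y : ℂ => (p.1, y)) (0, 1) p.2 :=
    (hasDerivAt_const p.2 p.1).prodMk (hasDerivAt_id p.2)
  have h3 := HasFDerivAt.comp_hasDerivAt (f := fun y : ℂ => (p.1, y)) p.2 h1 h2
  have h4 := (Q.map (Polynomial.evalRingHom p.1)).hasDerivAt p.2
  rw [Polynomial.derivative_map, Polynomial.map_evalRingHom_eval] at h4
  refine h3.unique (h4.congr_of_eventuallyEq (Filter.Eventually.of_forall fun y => ?_))
  simp [Polynomial.map_evalRingHom_eval]

lemma exists_continuousLinearEquiv_eq (L : (ℂ × ℂ) →L[ℂ] (ℂ × ℂ))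
    (hL : Function.Injective L.toLinearMap) :
    ∃ e : (ℂ × ℂ) ≃L[ℂ] (ℂ × ℂ), (e : (ℂ × ℂ) →L[ℂ] (ℂ × ℂ)) = L :=
  ⟨ContinuousLinearEquiv.ofBijective L (LinearMap.ker_eq_bot.2 hL)
    (LinearMap.range_eq_top.2 (LinearMap.injective_iff_surjective.1 hL)),
    ContinuousLinearEquiv.coe_ofBijective ..⟩

/-- If `∂F/∂y ≠ 0` then `(x, F)` is a local coordinate system. -/
lemma exists_equiv_hasStrictFDerivAt_fst {F : ℂ × ℂ → ℂ} {p : ℂ × ℂ} (hF : ContDiff ℂ 1 F)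
    (h : fderiv ℂ F p (0, 1) ≠ 0) : ∃ e : (ℂ × ℂ) ≃L[ℂ] (ℂ × ℂ),
      HasStrictFDerivAt (fun p => (p.1, F p)) (e : (ℂ × ℂ) →L[ℂ] (ℂ × ℂ)) p := by
  have hd := (hasStrictFDerivAt_fst (𝕜 := ℂ) (p := p)).prodMk
    (hF.contDiffAt.hasStrictFDerivAt (x := p) one_ne_zero)
  set L := (ContinuousLinearMap.fst ℂ ℂ ℂ).prod (fderiv ℂ F p)
  have hinj : Function.Injective L.toLinearMap := by
    rw [injective_iff_map_eq_zero]
    rintro ⟨a, b⟩ hab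
    have h1 : a = 0 := congrArg Prod.fst hab
    have h2 : fderiv ℂ F p (a, b) = 0 := congrArg Prod.snd hab
    subst h1
    have h3 : ((0 : ℂ), b) = b • ((0 : ℂ), (1 : ℂ)) := by simp
    rw [h3, map_smul, smul_eq_mul, mul_eq_zero] at h2
    simp [h2.resolve_right h]
  obtain ⟨e, he⟩ := exists_continuousLinearEquiv_eq L hinj
  exact ⟨e, he ▸ hd⟩

lemma exists_equiv_hasStrictFDerivAt_snd {F : ℂ × ℂ → ℂ} {p : ℂ × ℂ} (hF : ContDiff ℂ 1 F)
    (h : fderiv ℂ F p (1, 0) ≠ 0) : ∃ e : (ℂ × ℂ) ≃L[ℂ] (ℂ × ℂ),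
      HasStrictFDerivAt (fun p => (p.2, F p)) (e : (ℂ × ℂ) →L[ℂ] (ℂ × ℂ)) p := by
  have hd := (hasStrictFDerivAt_snd (𝕜 := ℂ) (p := p)).prodMk
    (hF.contDiffAt.hasStrictFDerivAt (x := p) one_ne_zero)
  set L := (ContinuousLinearMap.snd ℂ ℂ ℂ).prod (fderiv ℂ F p)
  have hinj : Function.Injective L.toLinearMap := by
    rw [injective_iff_map_eq_zero]
    rintro ⟨a, b⟩ hab
    have h1 : b = 0 := congrArg Prod.fst hab
    have h2 : fderiv ℂ F p (a, b) = 0 := congrArg Prod.snd hab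
    subst h1
    have h3 : (a, (0 : ℂ)) = a • ((1 : ℂ), (0 : ℂ)) := by simp
    rw [h3, map_smul, smul_eq_mul, mul_eq_zero] at h2
    simp [h2.resolve_right h]
  obtain ⟨e, he⟩ := exists_continuousLinearEquiv_eq L hinj
  exact ⟨e, he ▸ hd⟩

/-- A bound on the zeros of a bivariate polynomial over a given `x`. -/
lemma norm_le_of_evalEval_eq_zero (q : ℂ[X][Y]) {x y : ℂ} (hlc : q.leadingCoeff.eval x ≠ 0)
    (h : q.evalEval x y = 0) :
    ‖y‖ ≤ 1 + (∑ i ∈ Finset.range q.natDegree, ‖(q.coeff i).eval x‖) / ‖q.leadingCoeff.eval x‖ := by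
  have hpos : 0 < ‖q.leadingCoeff.eval x‖ := norm_pos_iff.2 hlc
  have hS : 0 ≤ ∑ i ∈ Finset.range q.natDegree, ‖(q.coeff i).eval x‖ :=
    Finset.sum_nonneg fun _ _ => norm_nonneg _
  rcases le_or_gt ‖y‖ 1 with hy | hy
  · have := div_nonneg hS hpos.le
    linarith
  rw [evalEval_eq_sum, Finset.sum_range_succ, add_comm, add_eq_zero_iff_eq_neg] at h
  obtain ⟨n, hn⟩ : ∃ n, q.natDegree = n := ⟨_, rfl⟩
  have hlc' : q.coeff n = q.leadingCoeff := by rw [← hn]; rfl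
  rw [hn, hlc'] at h
  rw [hn] at hS ⊢
  -- In degree zero the polynomial is a nonzero constant over `x` and has no zeros; otherwise `|y| >
  -- 1` bounds all lower powers by `|y| ^ n`.
  rcases n with _ | n
  · simp [hlc] at h
  have h1 : ‖q.leadingCoeff.eval x‖ * ‖y‖ ^ (n + 1) ≤
      (∑ i ∈ Finset.range (n + 1), ‖(q.coeff i).eval x‖) * ‖y‖ ^ n := by
    rw [← norm_pow, ← norm_mul, h, norm_neg, Finset.sum_mul]
    refine (norm_sum_le _ _).trans (Finset.sum_le_sum fun i hi => ?_)
    rw [norm_mul, norm_pow]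
    gcongr
    · exact hy.le
    · have := Finset.mem_range.1 hi
      omega
  have h2 : ‖q.leadingCoeff.eval x‖ * ‖y‖ ≤
      ∑ i ∈ Finset.range (n + 1), ‖(q.coeff i).eval x‖ := by
    refine le_of_mul_le_mul_right ?_ (pow_pos (zero_lt_one.trans hy) n)
    rw [mul_assoc, ← pow_succ']
    exact h1
  have h3 := (le_div_iff₀' hpos).2 h2
  linarith

/-- The part of the zero set of `q` over the punctured disk of radius `R`. -/
abbrev TotalSpace (q : ℂ[X][Y]) (R : ℝ) : Type :=
  {p : ℂ × ℂ // (p.1 ≠ 0 ∧ ‖p.1‖ < R) ∧ q.evalEval p.1 p.2 = 0}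

/-- The projection of the zero set to the punctured disk. -/
def TotalSpace.proj (q : ℂ[X][Y]) (R : ℝ) (p : TotalSpace q R) : {x : ℂ // x ≠ 0 ∧ ‖x‖ < R} :=
  ⟨p.1.1, p.2.1⟩

lemma TotalSpace.continuous_proj (q : ℂ[X][Y]) (R : ℝ) : Continuous (proj q R) :=
  (continuous_fst.comp continuous_subtype_val).subtype_mk _

lemma isOpen_puncturedDisk (R : ℝ) : IsOpen {x : ℂ | x ≠ 0 ∧ ‖x‖ < R} :=
  isOpen_ne.inter (isOpen_lt continuous_norm continuous_const)

variable {Q q : ℂ[X][Y]} {R : ℝ}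

/-- The local inverse of `(x, q)`, evaluated at `(x, 0)`, is a local section through any given
point. -/
lemma IsModel.isOpenMap_proj (h : IsModel Q q R) : IsOpenMap (TotalSpace.proj q R) := by
  refine IsOpenMap.of_nhds_le fun e => ?_
  rintro s hs
  obtain ⟨⟨⟨x₀, y₀⟩, hx, hy⟩, rfl⟩ : ∃ e', e' = e := ⟨e, rfl⟩
  obtain ⟨V, hV, hVs⟩ := mem_nhds_subtype _ _ _ |>.1 (Filter.mem_map.1 hs)
  have hder := h.simple x₀ hx.1 hx.2 y₀ hy
  obtain ⟨L, hL⟩ := exists_equiv_hasStrictFDerivAt_fst (p := (x₀, y₀)) (contDiff_evalEval q)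
    (by rwa [fderiv_evalEval_vertical])
  have hc : Filter.Tendsto (fun x : {x : ℂ // x ≠ 0 ∧ ‖x‖ < R} => ((x : ℂ), (0 : ℂ)))
      (𝓝 ⟨x₀, hx⟩) (𝓝 (x₀, q.evalEval x₀ y₀)) := by
    rw [hy]
    exact (Continuous.prodMk continuous_subtype_val continuous_const).continuousAt
  have h1 := hc.eventually hL.eventually_right_inverse
  have h2 := (hL.localInverse_tendsto.comp hc).eventually hV
  filter_upwards [h1, h2] with x hx1 hx2
  have e1 := congrArg Prod.fst hx1
  have e2 := congrArg Prod.snd hx1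
  simp only at e1 e2
  have := hVs (a := ⟨hL.localInverse _ _ _ ((x : ℂ), (0 : ℂ)), by rw [e1]; exact x.2, e2⟩) hx2
  rw [Set.mem_preimage] at this
  convert this
  exact Subtype.ext e1.symm

/-- Near a point `(x, q)` is injective, and `q = 0` on the total space, so `x` alone separates
points there. -/
lemma IsModel.isLocalHomeomorph_proj (h : IsModel Q q R) :
    IsLocalHomeomorph (TotalSpace.proj q R) := by
  rw [isLocalHomeomorph_iff_isOpenEmbedding_restrict]
  rintro ⟨⟨x₀, y₀⟩, hx, hy⟩
  have hder := h.simple x₀ hx.1 hx.2 y₀ hy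
  obtain ⟨L, hL⟩ := exists_equiv_hasStrictFDerivAt_fst (p := (x₀, y₀)) (contDiff_evalEval q)
    (by rwa [fderiv_evalEval_vertical])
  set Ψ := hL.toOpenPartialHomeomorph
  have hmem : ((x₀, y₀) : ℂ × ℂ) ∈ Ψ.source := hL.mem_toOpenPartialHomeomorph_source
  have hopen : IsOpen ((Subtype.val : TotalSpace q R → ℂ × ℂ) ⁻¹' Ψ.source) :=
    Ψ.open_source.preimage continuous_subtype_val
  refine ⟨_, hopen.mem_nhds hmem, ?_⟩
  refine Topology.IsOpenEmbedding.of_continuous_injective_isOpenMap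
    ((TotalSpace.continuous_proj q R).comp continuous_subtype_val) ?_
    (h.isOpenMap_proj.comp hopen.isOpenMap_subtype_val)
  rintro ⟨⟨p, hp1, hp2⟩, hp⟩ ⟨⟨p', hp1', hp2'⟩, hp'⟩ heq
  have e1 : p.1 = p'.1 := congrArg Subtype.val heq
  have : p = p' := Ψ.injOn hp hp' (Prod.ext e1 (hp2.trans hp2'.symm))
  subst this
  rfl

lemma IsModel.finite_fiber (h : IsModel Q q R) (x : ℂ) (hx : x ≠ 0) (hxR : ‖x‖ < R) :
    {y | q.evalEval x y = 0}.Finite := by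
  have h0 : q.map (Polynomial.evalRingHom x) ≠ 0 := by
    intro h0
    have := congrArg (fun p => p.coeff q.natDegree) h0
    simp only [Polynomial.coeff_map, Polynomial.coe_evalRingHom, Polynomial.coeff_zero] at this
    exact h.lead x hx hxR this
  refine (Polynomial.rootSet_finite (q.map (Polynomial.evalRingHom x)) ℂ).subset fun y hy => ?_
  rw [Polynomial.mem_rootSet]
  refine ⟨h0, ?_⟩
  rw [Polynomial.coe_aeval_eq_eval, Polynomial.map_evalRingHom_eval]
  exact hy

/-- The projection is proper: the leading coefficient has no zeros over the punctured disk, so the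
root bound is continuous in `x` and hence bounded over compact sets. -/
lemma IsModel.isClosedMap_proj (h : IsModel Q q R) : IsClosedMap (TotalSpace.proj q R) := by
  have : LocallyCompactSpace {x : ℂ // x ≠ 0 ∧ ‖x‖ < R} :=
    (isOpen_puncturedDisk R).locallyCompactSpace
  refine (isProperMap_iff_isCompact_preimage.2
    ⟨TotalSpace.continuous_proj q R, fun K hK => ?_⟩).isClosedMap
  have hK' : IsCompact (Subtype.val '' K) := hK.image continuous_subtype_val
  have hB : ContinuousOn (fun x : ℂ => 1 + (∑ i ∈ Finset.range q.natDegree,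
      ‖(q.coeff i).eval x‖) / ‖q.leadingCoeff.eval x‖) (Subtype.val '' K) := by
    refine continuousOn_const.add (ContinuousOn.div ?_ ?_ ?_)
    · exact (continuous_finsetSum _ fun i _ => (q.coeff i).continuous.norm).continuousOn
    · exact q.leadingCoeff.continuous.norm.continuousOn
    · rintro _ ⟨x, -, rfl⟩
      exact norm_ne_zero_iff.2 (h.lead x x.2.1 x.2.2)
  obtain ⟨B, hB⟩ := hK'.bddAbove_image hB
  rw [Subtype.isCompact_iff]
  have hcl : IsCompact ((Subtype.val '' K) ×ˢ Metric.closedBall (0 : ℂ) B ∩ zeroSet q) :=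
    (hK'.prod (isCompact_closedBall _ _)).inter_right (isClosed_zeroSet q)
  convert hcl using 1
  ext ⟨x, y⟩
  constructor
  · rintro ⟨⟨p, hp, hp0⟩, hpK, rfl⟩
    refine ⟨⟨⟨_, hpK, rfl⟩, ?_⟩, hp0⟩
    rw [mem_closedBall_zero_iff]
    exact (norm_le_of_evalEval_eq_zero q (h.lead _ hp.1 hp.2) hp0).trans
      (hB ⟨_, ⟨_, hpK, rfl⟩, rfl⟩)
  · rintro ⟨⟨⟨x', hx', rfl⟩, -⟩, h0⟩
    exact ⟨⟨(x', y), x'.2, h0⟩, hx', rfl⟩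

/-- A closed local homeomorphism with finite fibres is a covering. -/
lemma IsModel.isCoveringMap_proj (h : IsModel Q q R) : IsCoveringMap (TotalSpace.proj q R) := by
  rw [isCoveringMap_iff_isCoveringMapOn_univ]
  refine h.isClosedMap_proj.isCoveringMapOn_of_isLocalHomeomorphOn (fun x _ => ?_)
    h.isLocalHomeomorph_proj.isLocalHomeomorphOn
  refine Set.Finite.of_finite_image ((h.finite_fiber x x.2.1 x.2.2).subset ?_)
    (f := fun p : TotalSpace q R => p.1.2) ?_
  · rintro _ ⟨⟨p, hp, hp0⟩, rfl, rfl⟩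
    exact hp0
  · rintro ⟨p, hp, hp0⟩ rfl ⟨p', hp', hp0'⟩ h1 h2
    exact Subtype.ext (Prod.ext (congrArg Subtype.val h1).symm h2)

/-- The left half plane that `exp` maps onto the punctured disk of radius `R`. -/
def expPreimage (R : ℝ) : Set ℂ := {w | Real.exp w.re < R}

/-- `η` is a continuous choice over `S` of a zero `y` of `Q` over `x = exp w`. -/
def IsBranch (Q : ℂ[X][Y]) (S : Set ℂ) (η : ℂ → ℂ) : Prop :=
  ContinuousOn η S ∧ ∀ w ∈ S, Q.evalEval (Complex.exp w) (η w) = 0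

lemma convex_expPreimage (R : ℝ) : Convex ℝ (expPreimage R) := by
  intro a ha b hb s t hs ht hst
  have h := convexOn_exp.2 (Set.mem_univ a.re) (Set.mem_univ b.re) hs ht hst
  simp only [expPreimage, Set.mem_ofPred_eq, smul_eq_mul, Complex.add_re, Complex.smul_re] at *
  refine h.trans_lt ?_
  rcases hs.eq_or_lt with rfl | hs'
  · simp_all
  · have h1 := mul_lt_mul_of_pos_left ha hs'
    have h2 := mul_le_mul_of_nonneg_left hb.le ht
    have h3 : s * R + t * R = R := by rw [← add_mul, hst, one_mul]
    linarith

lemma isOpen_expPreimage (R : ℝ) : IsOpen (expPreimage R) :=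
  isOpen_lt (Real.continuous_exp.comp Complex.continuous_re) continuous_const

lemma norm_exp_lt {w : ℂ} (hw : w ∈ expPreimage R) : ‖Complex.exp w‖ < R := by
  rw [Complex.norm_exp]; exact hw

/-- The half plane is convex, hence simply connected, so `exp` lifts through the covering with any
prescribed starting point. -/
lemma IsModel.exists_isBranch (h : IsModel Q q R) {w₀ y₀ : ℂ} (hw₀ : w₀ ∈ expPreimage R)
    (hy₀ : Q.evalEval (Complex.exp w₀) y₀ = 0) :
    ∃ η, IsBranch Q (expPreimage R) η ∧ η w₀ = y₀ := by
  classical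
  have : ContractibleSpace (expPreimage R) :=
    (convex_expPreimage R).contractibleSpace ⟨w₀, hw₀⟩
  have : LocallyPathConnectedSpace (expPreimage R) :=
    (isOpen_expPreimage R).locallyPathConnectedSpace
  let f : C(expPreimage R, {x : ℂ // x ≠ 0 ∧ ‖x‖ < R}) :=
    ⟨fun w => ⟨Complex.exp w, Complex.exp_ne_zero _, norm_exp_lt w.2⟩,
      (Complex.continuous_exp.comp continuous_subtype_val).subtype_mk _⟩
  obtain ⟨F, ⟨hF0, hF⟩, -⟩ := h.isCoveringMap_proj.existsUnique_continuousMap_lifts f ⟨w₀, hw₀⟩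
    ⟨(Complex.exp w₀, y₀), ⟨Complex.exp_ne_zero _, norm_exp_lt hw₀⟩,
      (h.zero_iff _ (Complex.exp_ne_zero _) (norm_exp_lt hw₀) _).1 hy₀⟩ rfl
  refine ⟨fun w => if hw : w ∈ expPreimage R then (F ⟨w, hw⟩).1.2 else 0, ⟨?_, ?_⟩, ?_⟩
  · rw [continuousOn_iff_continuous_domRestrict]
    refine (continuous_snd.comp (continuous_subtype_val.comp F.continuous)).congr fun w => ?_
    simp [w.2]
  · intro w hw
    simp only [hw, dif_pos]
    have e : (F ⟨w, hw⟩).1.1 = Complex.exp w := congrArg Subtype.val (congrFun hF ⟨w, hw⟩)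
    rw [h.zero_iff _ (Complex.exp_ne_zero _) (norm_exp_lt hw), ← e]
    exact (F ⟨w, hw⟩).2.2
  · simp [hw₀, hF0]

lemma IsModel.eqOn_of_isBranch (h : IsModel Q q R) {S : Set ℂ} (hS : IsPreconnected S)
    (hSR : S ⊆ expPreimage R) {η₁ η₂ : ℂ → ℂ} (h₁ : IsBranch Q S η₁) (h₂ : IsBranch Q S η₂)
    {w₀ : ℂ} (hw₀ : w₀ ∈ S) (heq : η₁ w₀ = η₂ w₀) : Set.EqOn η₁ η₂ S := by
  have : PreconnectedSpace S := Subtype.preconnectedSpace hS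
  let g (η : ℂ → ℂ) (hη : IsBranch Q S η) (w : S) : TotalSpace q R :=
    ⟨(Complex.exp w, η w), ⟨Complex.exp_ne_zero _, norm_exp_lt (hSR w.2)⟩,
      (h.zero_iff _ (Complex.exp_ne_zero _) (norm_exp_lt (hSR w.2)) _).1 (hη.2 w w.2)⟩
  have hg (η hη) : Continuous (g η hη) :=
    (Continuous.prodMk (Complex.continuous_exp.comp continuous_subtype_val)
      (continuousOn_iff_continuous_domRestrict.1 hη.1)).subtype_mk _
  have := h.isCoveringMap_proj.eq_of_comp_eq (hg η₁ h₁) (hg η₂ h₂) rfl ⟨w₀, hw₀⟩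
    (Subtype.ext (Prod.ext rfl heq))
  intro w hw
  exact congrArg (fun p : TotalSpace q R => p.1.2) (congrFun this ⟨w, hw⟩)

/-- Locally `η` is the second component of the inverse of `(x, q)` at `(exp w, 0)`, which is complex
differentiable. -/
lemma IsModel.differentiableOn_of_isBranch (h : IsModel Q q R) {S : Set ℂ} (hS : IsOpen S)
    (hSR : S ⊆ expPreimage R) {η : ℂ → ℂ} (hη : IsBranch Q S η) : DifferentiableOn ℂ η S := by
  intro w hw
  have hz : ∀ w ∈ S, q.evalEval (Complex.exp w) (η w) = 0 := fun w hw =>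
    (h.zero_iff _ (Complex.exp_ne_zero _) (norm_exp_lt (hSR hw)) _).1 (hη.2 w hw)
  obtain ⟨L, hL⟩ := exists_equiv_hasStrictFDerivAt_fst (p := (Complex.exp w, η w))
    (contDiff_evalEval q) (by
      rw [fderiv_evalEval_vertical]
      exact h.simple _ (Complex.exp_ne_zero _) (norm_exp_lt (hSR hw)) _ (hz w hw))
  have hcont : Filter.Tendsto (fun w => (Complex.exp w, η w)) (𝓝 w) (𝓝 (Complex.exp w, η w)) :=
    (Complex.continuous_exp.continuousAt).prodMk_nhds (hη.1.continuousAt (hS.mem_nhds hw))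
  have hev := hcont.eventually hL.eventually_left_inverse
  have hd : DifferentiableAt ℂ (fun w' => hL.localInverse _ _ _ (Complex.exp w', (0 : ℂ))) w := by
    have h1 := hL.to_localInverse.hasFDerivAt.differentiableAt
    simp only [hz w hw] at h1
    exact DifferentiableAt.comp (f := fun w' : ℂ => (Complex.exp w', (0 : ℂ))) w h1
      (Complex.differentiableAt_exp.prodMk (differentiableAt_const _))
  refine (hd.snd.congr_of_eventuallyEq ?_).differentiableWithinAt
  filter_upwards [hev, hS.mem_nhds hw] with w' h1 h2
  rw [hz w' h2] at h1
  rw [h1]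

end

/-! ### Power series, Laurent series and the unit part of a Puiseux series -/

noncomputable section

/-- Summability at `t₁` makes the terms tend to zero, so the radius of convergence is at least
`|t₁|`. -/
lemma hasFPowerSeriesOnBall_tsum {a : ℕ → ℂ} {t₁ : ℂ} (ht₁ : t₁ ≠ 0)
    (h : Summable fun n => a n * t₁ ^ n) :
    HasFPowerSeriesOnBall (fun t => ∑' n, a n * t ^ n) (FormalMultilinearSeries.ofScalars ℂ a) 0
      ‖t₁‖₊ := by
  have h1 : (‖t₁‖₊ : ENNReal) ≤ (FormalMultilinearSeries.ofScalars ℂ a).radius := by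
    refine FormalMultilinearSeries.le_radius_of_tendsto _ (l := 0) ?_
    have := h.tendsto_atTop_zero.norm
    simpa [FormalMultilinearSeries.ofScalars_norm] using this
  have hpos : (0 : ENNReal) < ‖t₁‖₊ := by simpa using ht₁
  have h2 := (FormalMultilinearSeries.hasFPowerSeriesOnBall _ (hpos.trans_le h1)).mono hpos h1
  refine h2.congr fun t _ => ?_
  exact tsum_congr fun n => FormalMultilinearSeries.ofScalars_apply_eq ..

lemma differentiableOn_tsum {a : ℕ → ℂ} {t₁ : ℂ} (h : Summable fun n => a n * t₁ ^ n) :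
    DifferentiableOn ℂ (fun t => ∑' n, a n * t ^ n) (Metric.ball 0 ‖t₁‖) := by
  rcases eq_or_ne t₁ 0 with rfl | ht₁
  · simp [differentiableOn_empty]
  · have := (hasFPowerSeriesOnBall_tsum ht₁ h).differentiableOn
    rwa [Metric.eball_coe, coe_nnnorm] at this

lemma exists_hasSum_of_differentiableOn {G : ℂ → ℂ} {r : ℝ}
    (hG : DifferentiableOn ℂ G (Metric.ball 0 r)) :
    ∃ a : ℕ → ℂ, ∀ t ∈ Metric.ball (0 : ℂ) r, HasSum (fun n => a n * t ^ n) (G t) := by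
  refine ⟨fun n => (n.factorial : ℂ)⁻¹ * iteratedDeriv n G 0, fun t ht => ?_⟩
  have := Complex.hasSum_taylorSeries_on_ball hG ht
  refine this.congr_fun fun n => ?_
  simp only [sub_zero, smul_eq_mul]
  ring

/-- The sums agree off `0`, hence near `0` by continuity, and power series expansions are unique. -/
lemma powerSeries_coeff_unique {a b : ℕ → ℂ} {s : ℂ → ℂ} {r : ℝ} (hr : 0 < r)
    (ha : ∀ t ≠ 0, ‖t‖ < r → HasSum (fun n => a n * t ^ n) (s t))
    (hb : ∀ t ≠ 0, ‖t‖ < r → HasSum (fun n => b n * t ^ n) (s t)) : a = b := by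
  obtain ⟨t₁, h0, ht₁⟩ : ∃ t₁ : ℂ, t₁ ≠ 0 ∧ ‖t₁‖ < r :=
    ⟨(r / 2 : ℝ), by simpa using hr.ne', by
      rw [Complex.norm_real, Real.norm_of_nonneg (by positivity)]; linarith⟩
  have h1 := hasFPowerSeriesOnBall_tsum h0 (ha t₁ h0 ht₁).summable
  have h2 := hasFPowerSeriesOnBall_tsum h0 (hb t₁ h0 ht₁).summable
  have h3 : (fun t => ∑' n, a n * t ^ n) =ᶠ[𝓝[≠] 0] fun t => ∑' n, b n * t ^ n := by
    filter_upwards [self_mem_nhdsWithin, mem_nhdsWithin_of_mem_nhds (Metric.ball_mem_nhds 0 hr)]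
      with t ht htr
    rw [mem_ball_zero_iff] at htr
    rw [(ha t ht htr).tsum_eq, (hb t ht htr).tsum_eq]
  have h4 := (h1.hasFPowerSeriesAt.continuousAt.eventuallyEq_nhds_iff_eventuallyEq_nhdsNE
    h2.hasFPowerSeriesAt.continuousAt).1 h3
  exact FormalMultilinearSeries.ofScalars_series_injective ℂ ℂ
    (h1.hasFPowerSeriesAt.eq_formalMultilinearSeries
      (h2.hasFPowerSeriesAt.congr h4.symm))

lemma hasSum_laurent_iff {c : ℤ → ℂ} {N : ℤ} (hc : ∀ j < N, c j = 0) {t : ℂ} (ht : t ≠ 0) {s : ℂ} :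
    HasSum (fun j : ℤ => c j * t ^ j) (t ^ N * s) ↔
      HasSum (fun n : ℕ => c (N + n) * t ^ n) s := by
  have hi : Function.Injective fun n : ℕ => N + (n : ℤ) := fun a b h => by simpa using h
  rw [← hi.hasSum_iff]
  · have : (fun j : ℤ => c j * t ^ j) ∘ (fun n : ℕ => N + (n : ℤ)) =
        fun n : ℕ => t ^ N * (c (N + n) * t ^ n) := by
      ext n
      simp only [Function.comp_apply, zpow_add₀ ht, zpow_natCast]
      ring
    rw [this, hasSum_mul_left_iff (zpow_ne_zero N ht)]
  · intro j hj
    rw [hc j, zero_mul]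
    by_contra hNj
    exact hj ⟨(j - N).toNat, by simp; omega⟩

/-- Division by `t ^ N` reduces the claim to power series. -/
lemma laurent_coeff_unique {c d : ℤ → ℂ} {N : ℤ} (hc : ∀ j < N, c j = 0) (hd : ∀ j < N, d j = 0)
    {s : ℂ → ℂ} {r : ℝ} (hr : 0 < r)
    (hcs : ∀ t ≠ 0, ‖t‖ < r → HasSum (fun j : ℤ => c j * t ^ j) (s t))
    (hds : ∀ t ≠ 0, ‖t‖ < r → HasSum (fun j : ℤ => d j * t ^ j) (s t)) : c = d := by
  have key : (fun n : ℕ => c (N + n)) = fun n : ℕ => d (N + n) := by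
    refine powerSeries_coeff_unique (s := fun t => (t ^ N)⁻¹ * s t) hr (fun t h0 ht => ?_)
      (fun t h0 ht => ?_)
    · rw [← hasSum_laurent_iff hc h0, mul_inv_cancel_left₀ (zpow_ne_zero N h0)]
      exact hcs t h0 ht
    · rw [← hasSum_laurent_iff hd h0, mul_inv_cancel_left₀ (zpow_ne_zero N h0)]
      exact hds t h0 ht
  ext j
  rcases lt_or_ge j N with hj | hj
  · rw [hc j hj, hd j hj]
  · have := congrFun key (j - N).toNat
    simpa [Int.toNat_of_nonneg (sub_nonneg.2 hj)] using this

namespace PuiseuxSeries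

variable (P : PuiseuxSeries)

/-- The holomorphic function `u` with `y = t ^ j₀ * u(t)`. -/
def unitPart (t : ℂ) : ℂ := ∑' n : ℕ, P.coeffs.coeff (P.coeffs.order + n) * t ^ n

lemma coeff_eq_zero_of_lt {j : ℤ} (hj : j < P.coeffs.order) : P.coeffs.coeff j = 0 :=
  HahnSeries.coeff_eq_zero_of_lt_order hj

lemma unitPart_zero : P.unitPart 0 = P.coeffs.coeff P.coeffs.order := by
  rw [unitPart, tsum_eq_single 0]
  · simp
  · intro n hn
    simp [hn]

lemma unitPart_zero_ne_zero : P.unitPart 0 ≠ 0 := by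
  rw [unitPart_zero]
  rw [← HahnSeries.leadingCoeff_eq]
  exact HahnSeries.leadingCoeff_ne_zero.2 P.coeffs_ne_zero

/-- By convention `0 ^ j = 0` for every nonzero integer `j`, negative ones included, so convergence
at `0` carries no information. -/
lemma convergesAt_zero : P.ConvergesAt 0 := by
  refine summable_of_ne_finset_zero (s := {0}) fun j hj => ?_
  rw [zero_zpow j (by simpa using hj), mul_zero]

variable {P}

lemma ConvergesAt.summable {t : ℂ} (h : P.ConvergesAt t) (ht : t ≠ 0) :
    Summable fun n : ℕ => P.coeffs.coeff (P.coeffs.order + n) * t ^ n := by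
  obtain ⟨s, hs⟩ := h
  rw [← mul_inv_cancel_left₀ (zpow_ne_zero P.coeffs.order ht) s] at hs
  exact ⟨_, (hasSum_laurent_iff (fun j => P.coeff_eq_zero_of_lt) ht).1 hs⟩

lemma ConvergesAt.of_summable {t : ℂ} (ht : t ≠ 0)
    (h : Summable fun n : ℕ => P.coeffs.coeff (P.coeffs.order + n) * t ^ n) :
    P.ConvergesAt t ∧ P.value t = t ^ P.coeffs.order * P.unitPart t := by
  have := (hasSum_laurent_iff (fun j => P.coeff_eq_zero_of_lt) ht).2 h.hasSum
  exact ⟨this.summable, this.tsum_eq⟩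

lemma ConvergesAt.value_eq {t : ℂ} (h : P.ConvergesAt t) (ht : t ≠ 0) :
    P.value t = t ^ P.coeffs.order * P.unitPart t :=
  (ConvergesAt.of_summable ht (h.summable ht)).2

lemma ConvergesAt.differentiableOn_unitPart {t₁ : ℂ} (h : P.ConvergesAt t₁) :
    DifferentiableOn ℂ P.unitPart (Metric.ball 0 ‖t₁‖) := by
  rcases eq_or_ne t₁ 0 with rfl | h0
  · simp [differentiableOn_empty]
  · exact differentiableOn_tsum (h.summable h0)

/-- A convergent Puiseux series converges as far as its sum extends holomorphically. -/
lemma convergesAt_of_differentiableOn {G : ℂ → ℂ} {r r₁ : ℝ} (hr₁ : 0 < r₁)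
    (hG : DifferentiableOn ℂ G (Metric.ball 0 r))
    (h : ∀ t ≠ 0, ‖t‖ < r₁ → P.ConvergesAt t ∧ P.value t = t ^ P.coeffs.order * G t)
    {t : ℂ} (ht : t ≠ 0) (htr : ‖t‖ < r) :
    P.ConvergesAt t ∧ P.value t = t ^ P.coeffs.order * G t := by
  obtain ⟨b, hb⟩ := exists_hasSum_of_differentiableOn hG
  have hr : 0 < r := (norm_nonneg t).trans_lt htr
  have key : (fun n : ℕ => P.coeffs.coeff (P.coeffs.order + n)) = b := by
    refine powerSeries_coeff_unique (s := G) (lt_min hr hr₁) (fun t h0 ht => ?_)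
      (fun t h0 ht => hb t (by simpa using ht.trans_le (min_le_left _ _)))
    obtain ⟨h1, h2⟩ := h t h0 (ht.trans_le (min_le_right _ _))
    have h3 := h1.hasSum
    rw [← value, h2] at h3
    exact (hasSum_laurent_iff (fun j => P.coeff_eq_zero_of_lt) h0).1 h3
  have h3 := hb t (by simpa using htr)
  rw [← key] at h3
  have := (hasSum_laurent_iff (fun j => P.coeff_eq_zero_of_lt) ht).2 h3
  exact ⟨this.summable, this.tsum_eq⟩

end PuiseuxSeries

end

/-! ### Periods, and the branch of a Puiseux solution -/

noncomputable section

/-- The period of the exponential function. -/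
def expPeriod : ℂ := 2 * Real.pi * Complex.I

lemma expPeriod_ne_zero : expPeriod ≠ 0 := Complex.two_pi_I_ne_zero

lemma exp_add_int_mul_expPeriod (w : ℂ) (m : ℤ) :
    Complex.exp (w + m * expPeriod) = Complex.exp w :=
  Complex.exp_eq_exp_iff_exists_int.2 ⟨m, rfl⟩

lemma add_mul_expPeriod_mem_iff {R : ℝ} {w : ℂ} {m : ℤ} :
    w + m * expPeriod ∈ expPreimage R ↔ w ∈ expPreimage R := by
  have : (w + m * expPeriod).re = w.re := by
    simp [expPeriod]
  simp only [expPreimage, Set.mem_ofPred_eq, this]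

/-- The integers `m` such that `η` is invariant under translation by `2πim`. -/
def periods (R : ℝ) (η : ℂ → ℂ) : AddSubgroup ℤ where
  carrier := {m | ∀ w ∈ expPreimage R, η (w + m * expPeriod) = η w}
  zero_mem' := by intro w _; simp
  add_mem' := by
    intro a b ha hb w hw
    have := ha _ (add_mul_expPeriod_mem_iff (m := b).2 hw)
    rw [hb w hw] at this
    rw [← this]
    push_cast
    ring_nf
  neg_mem' := by
    intro a ha w hw
    have := ha _ (add_mul_expPeriod_mem_iff (m := -a).2 hw)
    rw [← this]
    push_cast
    ring_nf

variable {Q q : ℂ[X][Y]} {R : ℝ} {η : ℂ → ℂ}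

lemma IsBranch.translate (hη : IsBranch Q (expPreimage R) η) (m : ℤ) :
    IsBranch Q (expPreimage R) (fun w => η (w + m * expPeriod)) := by
  refine ⟨hη.1.comp (by fun_prop) fun w hw => add_mul_expPeriod_mem_iff.2 hw, fun w hw => ?_⟩
  have := hη.2 _ (add_mul_expPeriod_mem_iff (m := m).2 hw)
  rwa [exp_add_int_mul_expPeriod] at this

lemma IsBranch.mono {S T : Set ℂ} (hη : IsBranch Q S η) (h : T ⊆ S) : IsBranch Q T η :=
  ⟨hη.1.mono h, fun w hw => hη.2 w (h hw)⟩

lemma isPreconnected_expPreimage (R : ℝ) : IsPreconnected (expPreimage R) :=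
  (convex_expPreimage R).isPreconnected

/-- A translate of a branch is again a branch, so agreement at one point forces agreement
everywhere. -/
lemma IsModel.mem_periods (h : IsModel Q q R) (hη : IsBranch Q (expPreimage R) η) {m : ℤ} {w : ℂ}
    (hw : w ∈ expPreimage R) (hm : η (w + m * expPeriod) = η w) : m ∈ periods R η :=
  fun _ hw' => h.eqOn_of_isBranch (isPreconnected_expPreimage R) subset_rfl (hη.translate m) hη hw
    hm hw'

/-- The function of `t = exp (w / k)` induced by a function of `w` with period `2πik`. -/
def descend (k : ℕ) (η : ℂ → ℂ) (t : ℂ) : ℂ := η (k * Complex.log t)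

lemma exp_mul_log_div {k : ℕ} (hk : 0 < k) {t : ℂ} (ht : t ≠ 0) :
    Complex.exp (k * Complex.log t / k) = t := by
  rw [mul_div_cancel_left₀ _ (Nat.cast_ne_zero.2 hk.ne'), Complex.exp_log ht]

lemma exp_div_pow {k : ℕ} (hk : 0 < k) (w : ℂ) : Complex.exp (w / k) ^ k = Complex.exp w := by
  rw [← Complex.exp_nat_mul, mul_div_cancel₀ _ (Nat.cast_ne_zero.2 hk.ne')]

lemma mem_expPreimage_iff {w : ℂ} : w ∈ expPreimage R ↔ ‖Complex.exp w‖ < R := by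
  rw [Complex.norm_exp]; rfl

lemma mem_expPreimage_iff_pow {k : ℕ} (hk : 0 < k) {w : ℂ} :
    w ∈ expPreimage R ↔ ‖Complex.exp (w / k)‖ ^ k < R := by
  rw [← norm_pow, exp_div_pow hk, mem_expPreimage_iff]

lemma mul_log_mem_expPreimage {k : ℕ} (hk : 0 < k) {t : ℂ} (ht : t ≠ 0) (htR : ‖t‖ ^ k < R) :
    k * Complex.log t ∈ expPreimage R := by
  rwa [mem_expPreimage_iff_pow hk, exp_mul_log_div hk ht]

/-- The principal logarithm of `exp (w / k)` differs from `w / k` by a multiple of `2πi`; multiplied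
by `k` this becomes a period of `η`. -/
lemma descend_exp {k : ℕ} (hk : 0 < k) (hp : (k : ℤ) ∈ periods R η) {w : ℂ}
    (hw : w ∈ expPreimage R) : descend k η (Complex.exp (w / k)) = η w := by
  have hk' : (k : ℂ) ≠ 0 := Nat.cast_ne_zero.2 hk.ne'
  obtain ⟨n, hn⟩ := Complex.exp_eq_exp_iff_exists_int.1
    (Complex.exp_log (Complex.exp_ne_zero (w / k)))
  have h1 := (periods R η).zsmul_mem hp n w hw
  rw [descend, hn, ← h1]
  congr 1
  simp only [smul_eq_mul, Int.cast_mul, Int.cast_natCast, expPeriod]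
  field_simp

/-- The cut of the logarithm is harmless: near `t` the argument may be replaced by `k (log t + log
(t' / t))`, which is differentiable at `t' = t`, and periodicity makes the value the same. -/
lemma differentiableAt_descend {k : ℕ} (hk : 0 < k) (hp : (k : ℤ) ∈ periods R η)
    (hη : DifferentiableOn ℂ η (expPreimage R)) {t : ℂ} (ht : t ≠ 0) (htR : ‖t‖ ^ k < R) :
    DifferentiableAt ℂ (descend k η) t := by
  have h1 : ∀ᶠ t' in 𝓝 t, t' ≠ 0 ∧ ‖t'‖ ^ k < R :=
    (eventually_ne_nhds ht).and (((continuous_norm.pow k).continuousAt).eventually_lt_const htR)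
  have hdiv : DifferentiableAt ℂ (fun t' : ℂ => k * (Complex.log t + Complex.log (t' / t))) t := by
    refine ((differentiableAt_const _).add (DifferentiableAt.clog ?_ ?_)).const_mul _
    · fun_prop
    · simp [ht]
  have hval : k * (Complex.log t + Complex.log (t / t)) = k * Complex.log t := by
    simp [ht]
  have hd : DifferentiableAt ℂ η (k * (Complex.log t + Complex.log (t / t))) := by
    rw [hval]
    exact (hη _ (mul_log_mem_expPreimage hk ht htR)).differentiableAt
      ((isOpen_expPreimage R).mem_nhds (mul_log_mem_expPreimage hk ht htR))
  refine (DifferentiableAt.comp t hd hdiv).congr_of_eventuallyEq ?_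
  filter_upwards [h1] with t' ht'
  have h2 : Complex.exp (k * (Complex.log t + Complex.log (t' / t)) / k) = t' := by
    rw [mul_div_cancel_left₀ _ (Nat.cast_ne_zero.2 hk.ne'), Complex.exp_add, Complex.exp_log ht,
      Complex.exp_log (div_ne_zero ht'.1 ht), mul_div_cancel₀ _ ht]
  have h3 := descend_exp (w := k * (Complex.log t + Complex.log (t' / t))) hk hp
    (by rw [mem_expPreimage_iff_pow hk, h2]; exact ht'.2)
  rw [h2] at h3
  exact h3

lemma pow_lt_iff_lt_rpow {k : ℕ} (hk : 0 < k) {x : ℝ} (hx : 0 ≤ x) (hR : 0 ≤ R) :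
    x ^ k < R ↔ x < R ^ ((k : ℝ)⁻¹) := by
  rw [Real.lt_rpow_inv_iff_of_pos hx hR (by exact_mod_cast hk), Real.rpow_natCast]

lemma expPreimage_nonempty (hR : 0 < R) : ∃ w, w ∈ expPreimage R := by
  refine ⟨(Real.log (R / 2) : ℝ), ?_⟩
  simp only [expPreimage, Set.mem_ofPred_eq, Complex.ofReal_re]
  rw [Real.exp_log (by positivity)]
  linarith

namespace PuiseuxSeries

variable {P : PuiseuxSeries}

lemma differentiableOn_unitPart_of_forall {r : ℝ} (h : ∀ t : ℂ, ‖t‖ < r → P.ConvergesAt t) :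
    DifferentiableOn ℂ P.unitPart (Metric.ball 0 r) := by
  intro t ht
  rw [mem_ball_zero_iff] at ht
  obtain ⟨s, hs, hsr⟩ := exists_between ht
  have hs0 : 0 ≤ s := (norm_nonneg t).trans hs.le
  have h1 := (h (s : ℂ) (by rwa [Complex.norm_of_nonneg hs0])).differentiableOn_unitPart
  rw [Complex.norm_of_nonneg hs0] at h1
  exact ((h1 t (by simpa using hs)).differentiableAt
    (Metric.isOpen_ball.mem_nhds (by simpa using hs))).differentiableWithinAt

/-- If the sum of a Puiseux series is invariant under `t ↦ exp (2πim/k) t` then its exponents are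
annihilated by `m` modulo `k`. -/
lemma dvd_mul_of_value_invariant {r : ℝ} (hr : 0 < r) (h : ∀ t : ℂ, ‖t‖ < r → P.ConvergesAt t)
    {m : ℤ} (hm : ∀ t : ℂ, t ≠ 0 → ‖t‖ < r →
      P.value (Complex.exp (m * expPeriod / P.k) * t) = P.value t) {j : ℤ}
    (hj : P.coeffs.coeff j ≠ 0) : (P.k : ℤ) ∣ m * j := by
  set ω := Complex.exp (m * expPeriod / P.k) with hω
  have hk : (P.k : ℂ) ≠ 0 := Nat.cast_ne_zero.2 P.k_pos.ne'
  have hnorm : ‖ω‖ = 1 := by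
    rw [hω, show m * expPeriod / P.k = ((m * (2 * Real.pi) / P.k : ℝ) : ℂ) * Complex.I by
      simp only [expPeriod]; push_cast; ring, Complex.norm_exp_ofReal_mul_I]
  -- The substitution `t ↦ ωt` multiplies `c_j` by `ω ^ j` and leaves the sum unchanged, so
  -- uniqueness of coefficients gives `ω ^ j = 1` whenever `c_j ≠ 0`.
  have key : (fun j => P.coeffs.coeff j) = fun j => P.coeffs.coeff j * ω ^ j := by
    refine laurent_coeff_unique (N := P.coeffs.order) (s := P.value)
      (fun j => P.coeff_eq_zero_of_lt) (fun j hj => by rw [P.coeff_eq_zero_of_lt hj, zero_mul]) hr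
      (fun t _ ht => (h t ht).hasSum) (fun t h0 ht => ?_)
    have h1 := (h (ω * t) (by rwa [norm_mul, hnorm, one_mul])).hasSum
    rw [← value, hm t h0 ht] at h1
    refine h1.congr_fun fun j => ?_
    rw [mul_zpow]; ring
  have h1 : ω ^ j = 1 := by
    have := congrFun key j
    exact mul_left_cancel₀ hj (by simpa using this.symm)
  rw [hω, ← Complex.exp_int_mul, Complex.exp_eq_one_iff] at h1
  obtain ⟨n, hn⟩ := h1
  refine ⟨n, ?_⟩
  have h2 : (m * j : ℂ) * expPeriod = (P.k * n : ℂ) * expPeriod := by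
    rw [← expPeriod] at hn
    field_simp at hn
    linear_combination hn
  exact_mod_cast mul_right_cancel₀ expPeriod_ne_zero h2

end PuiseuxSeries

/-- Every Puiseux series solution is induced by a branch over the whole punctured disk. -/
theorem IsModel.exists_branch_of_solution (h : IsModel Q q R) {P : PuiseuxSeries}
    (hP : P.IsSolution Q) : ∃ η, IsBranch Q (expPreimage R) η ∧
      (∀ t : ℂ, t ≠ 0 → ‖t‖ ^ P.k < R → P.ConvergesAt t) ∧
      (∀ w ∈ expPreimage R, P.value (Complex.exp (w / P.k)) = η w) ∧
      ∀ m : ℤ, m ∈ periods R η ↔ (P.k : ℤ) ∣ m := by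
  have hk := P.k_pos
  have hk' : (P.k : ℂ) ≠ 0 := Nat.cast_ne_zero.2 hk.ne'
  obtain ⟨r, hr, hrP⟩ : ∃ r > 0, ∀ t : ℂ, t ≠ 0 → ‖t‖ < r →
      P.ConvergesAt t ∧ (t ^ P.k, P.value t) ∈ zeroSet Q := by
    obtain ⟨r, hr, hb⟩ := Metric.eventually_nhds_iff_ball.1 (eventually_nhdsWithin_iff.1 hP)
    exact ⟨r, hr, fun t ht htr => hb t (by simpa using htr) ht⟩
  have hconv : ∀ t : ℂ, ‖t‖ < r → P.ConvergesAt t := fun t ht => by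
    rcases eq_or_ne t 0 with rfl | h0
    exacts [P.convergesAt_zero, (hrP t h0 ht).1]
  have hunit := PuiseuxSeries.differentiableOn_unitPart_of_forall hconv
  -- Over `|x| < ρ` the series converges and the covering is available. The branch is compared with
  -- the series there and then continued to `|x| < R`.
  set ρ := min R (r ^ P.k) with hρ
  have hρ0 : 0 < ρ := lt_min h.pos (by positivity)
  have hρR : expPreimage ρ ⊆ expPreimage R := fun w hw =>
    mem_expPreimage_iff.2 ((mem_expPreimage_iff.1 hw).trans_le (min_le_left _ _))
  have hρr : ∀ w ∈ expPreimage ρ, ‖Complex.exp (w / P.k)‖ < r := fun w hw => by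
    rw [mem_expPreimage_iff_pow hk] at hw
    exact lt_of_pow_lt_pow_left₀ _ hr.le (hw.trans_le (min_le_right _ _))
  have hval : ∀ w ∈ expPreimage ρ, P.value (Complex.exp (w / P.k)) =
      Complex.exp (w / P.k) ^ P.coeffs.order * P.unitPart (Complex.exp (w / P.k)) := fun w hw =>
    (hrP _ (Complex.exp_ne_zero _) (hρr w hw)).1.value_eq (Complex.exp_ne_zero _)
  have hbr : IsBranch Q (expPreimage ρ) (fun w => P.value (Complex.exp (w / P.k))) := by
    refine ⟨?_, fun w hw => ?_⟩
    · refine ContinuousOn.congr ?_ hval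
      refine ContinuousOn.mul ?_ (hunit.continuousOn.comp (by fun_prop) fun w hw => by
        simpa using hρr w hw)
      exact ContinuousOn.zpow₀ (by fun_prop) _ fun w _ => Or.inl (Complex.exp_ne_zero _)
    · have := (hrP _ (Complex.exp_ne_zero _) (hρr w hw)).2
      rwa [exp_div_pow hk] at this
  obtain ⟨w₀, hw₀⟩ := expPreimage_nonempty hρ0
  obtain ⟨η, hη, hη0⟩ := h.exists_isBranch (hρR hw₀) (hbr.2 w₀ hw₀)
  have heq : Set.EqOn η (fun w => P.value (Complex.exp (w / P.k))) (expPreimage ρ) :=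
    h.eqOn_of_isBranch (isPreconnected_expPreimage ρ) hρR (hη.mono hρR) hbr hw₀ hη0
  have hper : (P.k : ℤ) ∈ periods R η := by
    refine h.mem_periods hη (hρR hw₀) ?_
    rw [heq hw₀, heq (add_mul_expPeriod_mem_iff.2 hw₀)]
    simp only [Int.cast_natCast, add_div, mul_div_cancel_left₀ _ hk']
    have := exp_add_int_mul_expPeriod (w₀ / P.k) 1
    rw [Int.cast_one, one_mul] at this
    rw [this]
  have hdiff := h.differentiableOn_of_isBranch (isOpen_expPreimage R) subset_rfl hη
  have hdesc : ∀ t : ℂ, t ≠ 0 → ‖t‖ ^ P.k < ρ → descend P.k η t = P.value t := by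
    intro t h0 ht
    rw [descend, heq (mul_log_mem_expPreimage hk h0 ht)]
    simp only [exp_mul_log_div hk h0]
  have hsmall : ∀ t : ℂ, ‖t‖ ^ P.k < ρ → ‖t‖ < r := fun t ht =>
    lt_of_pow_lt_pow_left₀ _ hr.le (ht.trans_le (min_le_right _ _))
  classical
  -- `G` extends the unit part holomorphically to all of `|t| ^ k < R`, which forces the series to
  -- converge that far.
  set G : ℂ → ℂ := fun t => if t = 0 then P.unitPart 0 else
    (t ^ P.coeffs.order)⁻¹ * descend P.k η t with hG
  have hGsmall : ∀ t : ℂ, ‖t‖ ^ P.k < ρ → G t = P.unitPart t := by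
    intro t ht
    by_cases h0 : t = 0
    · simp [hG, h0]
    · simp only [hG, h0, if_false]
      rw [hdesc t h0 ht, (hconv t (hsmall t ht)).value_eq h0,
        inv_mul_cancel_left₀ (zpow_ne_zero _ h0)]
  have hGdiff : DifferentiableOn ℂ G (Metric.ball 0 (R ^ ((P.k : ℝ)⁻¹))) := by
    intro t ht
    rw [mem_ball_zero_iff, ← pow_lt_iff_lt_rpow hk (norm_nonneg t) h.pos.le] at ht
    refine DifferentiableAt.differentiableWithinAt ?_
    by_cases h0 : t = 0
    · subst h0
      have h1 : DifferentiableAt ℂ P.unitPart 0 :=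
        (hunit 0 (by simpa using hr)).differentiableAt (Metric.ball_mem_nhds _ hr)
      refine h1.congr_of_eventuallyEq ?_
      have : ∀ᶠ t : ℂ in 𝓝 0, ‖t‖ ^ P.k < ρ :=
        ((continuous_norm.pow P.k).continuousAt).eventually_lt_const (by
          simpa [hk.ne'] using hρ0)
      filter_upwards [this] with t ht using hGsmall t ht
    · have h1 := differentiableAt_descend hk hper hdiff h0 ht
      have h2 : DifferentiableAt ℂ (fun t => (t ^ P.coeffs.order)⁻¹ * descend P.k η t) t :=
        ((differentiableAt_zpow.2 (Or.inl h0)).inv (zpow_ne_zero _ h0)).mul h1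
      refine h2.congr_of_eventuallyEq ?_
      filter_upwards [eventually_ne_nhds h0] with t' ht'
      simp [hG, ht']
  have hfull : ∀ t : ℂ, t ≠ 0 → ‖t‖ ^ P.k < R →
      P.ConvergesAt t ∧ P.value t = descend P.k η t := by
    intro t h0 ht
    have h1 := PuiseuxSeries.convergesAt_of_differentiableOn (P := P) (G := G)
      (r := R ^ ((P.k : ℝ)⁻¹)) (r₁ := ρ ^ ((P.k : ℝ)⁻¹)) (by positivity) hGdiff
      (fun t h0 ht => ?_) h0 ((pow_lt_iff_lt_rpow hk (norm_nonneg t) h.pos.le).1 ht)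
    · refine ⟨h1.1, h1.2.trans ?_⟩
      simp only [hG, h0, if_false]
      rw [mul_inv_cancel_left₀ (zpow_ne_zero _ h0)]
    · rw [← pow_lt_iff_lt_rpow hk (norm_nonneg t) hρ0.le] at ht
      refine ⟨hconv t (hsmall t ht), ?_⟩
      rw [hGsmall t ht, (hconv t (hsmall t ht)).value_eq h0]
  have hfull' : ∀ w ∈ expPreimage R, P.value (Complex.exp (w / P.k)) = η w := fun w hw => by
    rw [(hfull _ (Complex.exp_ne_zero _) ((mem_expPreimage_iff_pow hk).1 hw)).2,
      descend_exp hk hper hw]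
  refine ⟨η, hη, fun t h0 ht => (hfull t h0 ht).1, hfull', fun m => ⟨fun hm => ?_, ?_⟩⟩
  · have hdvd : ∀ j : ℤ, P.coeffs.coeff j ≠ 0 → (P.k : ℤ) ∣ m * j := by
      refine fun j hj => PuiseuxSeries.dvd_mul_of_value_invariant
        (r := ρ ^ ((P.k : ℝ)⁻¹)) (by positivity) (fun t ht => ?_) (fun t h0 ht => ?_) hj
      · rw [← pow_lt_iff_lt_rpow hk (norm_nonneg t) hρ0.le] at ht
        exact hconv t (hsmall t ht)
      · rw [← pow_lt_iff_lt_rpow hk (norm_nonneg t) hρ0.le] at ht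
        have hmem := mul_log_mem_expPreimage hk h0 (ht.trans_le (min_le_left _ _))
        have h1 := hm _ hmem
        rw [← hfull' _ hmem, ← hfull' _ (add_mul_expPeriod_mem_iff.2 hmem), add_div,
          Complex.exp_add, exp_mul_log_div hk h0] at h1
        rwa [mul_comm]
    -- Since `k ∣ m * j` for every exponent `j`, the number `k / gcd(k, m)` divides them all;
    -- minimality of `k` makes it `1`, so `k ∣ m`.
    have hg := P.minimal (P.k / Nat.gcd P.k m.natAbs)
      (Nat.div_dvd_of_dvd (Nat.gcd_dvd_left _ _)) fun j hj => by
        rw [Int.natCast_dvd]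
        have h1 := hdvd j hj
        rw [Int.natCast_dvd, Int.natAbs_mul] at h1
        exact (Nat.Coprime.dvd_of_dvd_mul_left
          (Nat.coprime_div_gcd_div_gcd (Nat.gcd_pos_of_pos_left _ hk))
          (by
            have hgp := Nat.gcd_pos_of_pos_left m.natAbs hk
            refine Nat.dvd_of_mul_dvd_mul_left hgp ?_
            rw [Nat.mul_div_cancel' (Nat.gcd_dvd_left _ _), ← mul_assoc,
              Nat.mul_div_cancel' (Nat.gcd_dvd_right _ _)]
            exact h1))
    have h2 : Nat.gcd P.k m.natAbs = P.k := by
      have := Nat.div_mul_cancel (Nat.gcd_dvd_left P.k m.natAbs)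
      rw [hg, one_mul] at this
      exact this
    rw [Int.natCast_dvd, ← h2]
    exact Nat.gcd_dvd_right _ _
  · rintro ⟨n, rfl⟩
    rw [mul_comm, ← smul_eq_mul]
    exact (periods R η).zsmul_mem hper n

end

/-! ### The Puiseux solution of a branch -/

noncomputable section

variable {Q q : ℂ[X][Y]} {R : ℝ} {η : ℂ → ℂ}

/-- The zeros of `Q` over `x` grow at most polynomially as `x → 0`. -/
lemma IsModel.exists_pow_mul_bound (h : IsModel Q q R) : ∃ (M : ℕ) (C : ℝ) (r : ℝ), 0 < r ∧
    ∀ x : ℂ, x ≠ 0 → ‖x‖ < r → ∀ y, Q.evalEval x y = 0 → ‖x ^ M * y‖ ≤ C := by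
  have hlc : q.leadingCoeff ≠ 0 := by
    intro h0
    obtain ⟨w, hw⟩ := expPreimage_nonempty h.pos
    have := h.lead _ (Complex.exp_ne_zero w) (norm_exp_lt hw)
    simp [h0] at this
  obtain ⟨v, hv, hv0⟩ := Polynomial.exists_eq_pow_rootMultiplicity_mul_and_not_dvd
    q.leadingCoeff hlc 0
  rw [Polynomial.dvd_iff_isRoot] at hv0
  have hv0 : v.eval 0 ≠ 0 := hv0
  generalize q.leadingCoeff.rootMultiplicity 0 = M at hv
  rw [Polynomial.C_0, sub_zero] at hv
  -- The leading coefficient is `x ^ M * v` with `v(0) ≠ 0`. Multiplying the root bound by `|x| ^ M`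
  -- cancels its singularity and leaves a function continuous at `0`.
  set B : ℂ → ℝ := fun x => ‖x‖ ^ M + (∑ i ∈ Finset.range q.natDegree, ‖(q.coeff i).eval x‖) /
    ‖v.eval x‖ with hB
  have hBc : ContinuousAt B 0 := by
    refine ((continuous_norm.pow M).continuousAt).add (ContinuousAt.div ?_ ?_ ?_)
    · exact (continuous_finsetSum _ fun i _ => (q.coeff i).continuous.norm).continuousAt
    · exact v.continuous.norm.continuousAt
    · exact norm_ne_zero_iff.2 hv0
  obtain ⟨r, hr, hb⟩ := Metric.eventually_nhds_iff_ball.1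
    (hBc.eventually_lt_const (lt_add_one (B 0)))
  refine ⟨M, B 0 + 1, min r R, lt_min hr h.pos, fun x hx hxr y hy => ?_⟩
  have hxR := hxr.trans_le (min_le_right _ _)
  refine le_trans ?_ (hb x (by simpa using hxr.trans_le (min_le_left _ _))).le
  have hl := h.lead x hx hxR
  have h1 := norm_le_of_evalEval_eq_zero q hl ((h.zero_iff x hx hxR y).1 hy)
  rw [hv, Polynomial.eval_mul, Polynomial.eval_pow, Polynomial.eval_X, norm_mul, norm_pow] at h1
  have hvx : v.eval x ≠ 0 := fun h0 => by
    apply hl; rw [hv, Polynomial.eval_mul, h0, mul_zero]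
  have hxp : 0 < ‖x‖ ^ M := pow_pos (norm_pos_iff.2 hx) M
  have hvp : 0 < ‖v.eval x‖ := norm_pos_iff.2 hvx
  rw [norm_mul, norm_pow]
  calc ‖x‖ ^ M * ‖y‖ ≤ ‖x‖ ^ M * (1 + (∑ i ∈ Finset.range q.natDegree,
        ‖(q.coeff i).eval x‖) / (‖x‖ ^ M * ‖v.eval x‖)) := by gcongr
    _ = B x := by rw [hB]; field_simp

/-- Infinitely many translates take values in one finite fibre, so two of them agree at `w` and
their difference is a nonzero period. -/
lemma IsModel.exists_generator_periods (h : IsModel Q q R) (hη : IsBranch Q (expPreimage R) η) :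
    ∃ k : ℕ, 0 < k ∧ ∀ m : ℤ, m ∈ periods R η ↔ (k : ℤ) ∣ m := by
  obtain ⟨a, ha⟩ := Int.subgroup_cyclic (periods R η)
  have hmem : ∀ m : ℤ, m ∈ periods R η ↔ (a.natAbs : ℤ) ∣ m := fun m => by
    rw [ha, AddSubgroup.mem_closure_singleton, Int.natAbs_dvd]
    constructor
    · rintro ⟨n, rfl⟩; exact ⟨n, by simp [mul_comm]⟩
    · rintro ⟨n, rfl⟩; exact ⟨n, by simp [mul_comm]⟩
  refine ⟨a.natAbs, Nat.pos_of_ne_zero fun h0 => ?_, hmem⟩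
  obtain ⟨w, hw⟩ := expPreimage_nonempty h.pos
  have hfin := h.finite_fiber _ (Complex.exp_ne_zero w) (norm_exp_lt hw)
  have := hfin.to_subtype
  let f : ℤ → {y | q.evalEval (Complex.exp w) y = 0} := fun n => ⟨η (w + n * expPeriod),
    (h.zero_iff _ (Complex.exp_ne_zero w) (norm_exp_lt hw) _).1 ((hη.translate n).2 w hw)⟩
  obtain ⟨m, n, hmn, he⟩ := Finite.exists_ne_map_eq_of_infinite f
  have he' : η (w + m * expPeriod) = η (w + n * expPeriod) := congrArg Subtype.val he
  have h1 := h.mem_periods hη (add_mul_expPeriod_mem_iff (m := n).2 hw) (m := m - n) (by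
    rw [← he']; push_cast; ring_nf)
  rw [hmem, h0, Int.natCast_zero, zero_dvd_iff] at h1
  omega

lemma exp_int_mul_expPeriod (m : ℤ) : Complex.exp (m * expPeriod) = 1 := by
  simpa using exp_add_int_mul_expPeriod 0 m

/-- Every branch over the punctured disk is given by a Puiseux series solution. -/
theorem IsModel.exists_solution_of_branch (h : IsModel Q q R)
    (hη : IsBranch Q (expPreimage R) η) : ∃ P : PuiseuxSeries, P.IsSolution Q ∧
      ∀ w ∈ expPreimage R, P.value (Complex.exp (w / P.k)) = η w := by
  classical
  obtain ⟨k, hk, hper⟩ := h.exists_generator_periods hη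
  have hpk : (k : ℤ) ∈ periods R η := (hper k).2 dvd_rfl
  have hdiff := h.differentiableOn_of_isBranch (isOpen_expPreimage R) subset_rfl hη
  obtain ⟨M, C, r₀, hr₀, hbound⟩ := h.exists_pow_mul_bound
  have hmem : ∀ t : ℂ, t ≠ 0 → ‖t‖ ^ k < R → Q.evalEval (t ^ k) (descend k η t) = 0 := by
    intro t h0 ht
    have := hη.2 _ (mul_log_mem_expPreimage hk h0 ht)
    rwa [← exp_div_pow hk, exp_mul_log_div hk h0] at this
  set r := R ^ ((k : ℝ)⁻¹) with hr
  have hrpos : 0 < r := Real.rpow_pos_of_pos h.pos _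
  have hball : ∀ t : ℂ, t ∈ Metric.ball 0 r ↔ ‖t‖ ^ k < R := fun t => by
    rw [mem_ball_zero_iff, ← pow_lt_iff_lt_rpow hk (norm_nonneg t) h.pos.le]
  -- The factor `t ^ (kM) = x ^ M` makes the function bounded near `0`, so the singularity is
  -- removable.
  set F : ℂ → ℂ := fun t => t ^ (k * M) * descend k η t with hF
  have hFdiff : ∀ t : ℂ, t ≠ 0 → t ∈ Metric.ball 0 r → DifferentiableAt ℂ F t := fun t h0 ht =>
    (differentiableAt_pow _).mul (differentiableAt_descend hk hpk hdiff h0 ((hball t).1 ht))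
  set c := Filter.limUnder (𝓝[≠] 0) F
  set G := Function.update F 0 c with hG
  have hGne : ∀ t : ℂ, t ≠ 0 → G t = F t := fun t ht => Function.update_of_ne ht _ _
  have hG0 : DifferentiableAt ℂ G 0 := by
    set s := Metric.ball (0 : ℂ) (min r (r₀ ^ ((k : ℝ)⁻¹)))
    have hs : s ∈ 𝓝 (0 : ℂ) := Metric.ball_mem_nhds _ (lt_min hrpos (Real.rpow_pos_of_pos hr₀ _))
    refine (Complex.differentiableOn_update_limUnder_of_bddAbove hs ?_ ?_).differentiableAt hs
    · rintro t ⟨ht, h0⟩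
      exact (hFdiff t h0 (Metric.ball_subset_ball (min_le_left _ _) ht)).differentiableWithinAt
    · refine ⟨C, ?_⟩
      rintro _ ⟨t, ⟨ht, h0⟩, rfl⟩
      have h1 := Metric.ball_subset_ball (min_le_left _ _) ht
      have h2 := Metric.ball_subset_ball (min_le_right _ _) ht
      rw [mem_ball_zero_iff, ← pow_lt_iff_lt_rpow hk (norm_nonneg t) hr₀.le] at h2
      have h3 := hbound (t ^ k) (pow_ne_zero _ h0) (by rwa [norm_pow]) _
        (hmem t h0 ((hball t).1 h1))
      rwa [← pow_mul] at h3
  have hGdiff : DifferentiableOn ℂ G (Metric.ball 0 r) := by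
    intro t ht
    refine DifferentiableAt.differentiableWithinAt ?_
    by_cases h0 : t = 0
    · rwa [h0]
    · refine (hFdiff t h0 ht).congr_of_eventuallyEq ?_
      filter_upwards [eventually_ne_nhds h0] with t' ht' using hGne t' ht'
  obtain ⟨a, ha⟩ := exists_hasSum_of_differentiableOn hGdiff
  set N : ℤ := -((k * M : ℕ) : ℤ) with hN
  -- The Taylor coefficients of `G` shifted by `N = -kM`. The case distinction is needed because
  -- `toNat` would send all `j < N` to the index `0`.
  set f : ℤ → ℂ := fun j => if j < N then 0 else a (j - N).toNat with hf
  have hfN : ∀ j < N, f j = 0 := fun j hj => by simp [hf, hj]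
  have hbdd : BddBelow (Function.support f) :=
    ⟨N, fun j hj => le_of_not_gt fun hlt => hj (hfN j hlt)⟩
  have hsum : ∀ t : ℂ, t ≠ 0 → ‖t‖ ^ k < R →
      HasSum (fun j : ℤ => f j * t ^ j) (descend k η t) := by
    intro t h0 ht
    have h1 := ha t ((hball t).2 ht)
    rw [hGne t h0] at h1
    have h2 : descend k η t = t ^ N * F t := by
      rw [hN, hF, zpow_neg, zpow_natCast, inv_mul_cancel_left₀ (pow_ne_zero _ h0)]
    rw [h2, hasSum_laurent_iff hfN h0]
    refine h1.congr_fun fun n => ?_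
    simp [hf]
  have hexp : ∀ w ∈ expPreimage R, HasSum (fun j : ℤ => f j * Complex.exp (w / k) ^ j) (η w) := by
    intro w hw
    rw [← descend_exp hk hpk hw]
    exact hsum _ (Complex.exp_ne_zero _) ((mem_expPreimage_iff_pow hk).1 hw)
  obtain ⟨w₀, hw₀⟩ := expPreimage_nonempty h.pos
  -- A zero series would put zeros of `Q` on the `x`-axis over the disk.
  have hne : HahnSeries.ofSuppBddBelow f hbdd ≠ 0 := by
    rw [Ne, HahnSeries.ofSuppBddBelow_eq_zero]
    intro hf0
    have h1 := hexp w₀ hw₀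
    simp only [hf0, Pi.zero_apply, zero_mul] at h1
    have h2 := hη.2 w₀ hw₀
    rw [← hasSum_zero.unique h1] at h2
    exact h.axis _ (norm_exp_lt hw₀) h2
  refine ⟨⟨k, hk, HahnSeries.ofSuppBddBelow f hbdd, hne, ?_⟩, ?_, ?_⟩
  · rintro d ⟨e, rfl⟩ hd
    rw [HahnSeries.coeff_ofSuppBddBelow] at hd
    have hd0 : (d : ℂ) ≠ 0 := Nat.cast_ne_zero.2 (Nat.pos_of_mul_pos_right hk).ne'
    have he0 : (e : ℂ) ≠ 0 := Nat.cast_ne_zero.2 (Nat.pos_of_mul_pos_left hk).ne'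
    -- If `d` divides `k = d * e` and every exponent, translation by `2πie` fixes each term. So `e`
    -- is a period, `d * e ∣ e`, and `d = 1`.
    have h1 : (e : ℤ) ∈ periods R η := by
      refine h.mem_periods hη hw₀ ((hexp _ (add_mul_expPeriod_mem_iff.2 hw₀)).unique ?_)
      refine (hexp w₀ hw₀).congr_fun fun j => ?_
      by_cases hj : f j = 0
      · simp [hj]
      · obtain ⟨n, rfl⟩ := hd j hj
        rw [add_div, Complex.exp_add, mul_zpow,
          ← Complex.exp_int_mul (((e : ℤ) : ℂ) * expPeriod / ((d * e : ℕ) : ℂ))]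
        have : (((d : ℤ) * n : ℤ) : ℂ) * (((e : ℤ) : ℂ) * expPeriod / ((d * e : ℕ) : ℂ)) =
            (n : ℂ) * expPeriod := by
          push_cast
          field_simp
        rw [this, exp_int_mul_expPeriod, mul_one]
    rw [hper, Int.natCast_dvd_natCast] at h1
    have h2 := Nat.le_of_dvd (Nat.pos_of_mul_pos_left hk) h1
    have h3 := Nat.pos_of_mul_pos_left hk
    have h4 := Nat.pos_of_mul_pos_right hk
    nlinarith
  · have : ∀ᶠ t : ℂ in 𝓝[≠] 0, t ≠ 0 ∧ ‖t‖ ^ k < R := by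
      refine Filter.Eventually.and self_mem_nhdsWithin (mem_nhdsWithin_of_mem_nhds ?_)
      exact ((continuous_norm.pow k).continuousAt).eventually_lt_const (by
        simpa [hk.ne'] using h.pos)
    filter_upwards [this] with t ht
    have h1 := hsum t ht.1 ht.2
    rw [← HahnSeries.coeff_ofSuppBddBelow (f := f) (hf := hbdd)] at h1
    refine ⟨h1.summable, ?_⟩
    change Q.evalEval (t ^ k) _ = 0
    rw [PuiseuxSeries.value, h1.tsum_eq]
    exact hmem t ht.1 ht.2
  · intro w hw
    have h1 := hexp w hw
    rw [← HahnSeries.coeff_ofSuppBddBelow (f := f) (hf := hbdd)] at h1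
    exact h1.tsum_eq

end

/-! ### Injectivity, finiteness and conjugacy of solutions -/

noncomputable section

variable {Q q : ℂ[X][Y]} {R : ℝ} {P P' : PuiseuxSeries}

lemma IsModel.convergesAt (h : IsModel Q q R) (hP : P.IsSolution Q) {t : ℂ} (ht : ‖t‖ ^ P.k < R) :
    P.ConvergesAt t := by
  obtain ⟨η, -, hc, -⟩ := h.exists_branch_of_solution hP
  rcases eq_or_ne t 0 with rfl | h0
  exacts [P.convergesAt_zero, hc t h0 ht]

lemma IsModel.mem_zeroSet (h : IsModel Q q R) (hP : P.IsSolution Q) {t : ℂ} (h0 : t ≠ 0)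
    (ht : ‖t‖ ^ P.k < R) : (t ^ P.k, P.value t) ∈ zeroSet Q := by
  obtain ⟨η, hη, -, hv, -⟩ := h.exists_branch_of_solution hP
  have hw := mul_log_mem_expPreimage P.k_pos h0 ht
  have h1 := hv _ hw
  have h2 := hη.2 _ hw
  rwa [← h1, ← exp_div_pow P.k_pos, exp_mul_log_div P.k_pos h0] at h2

lemma IsModel.snd_ne_zero (h : IsModel Q q R) {p : ℂ × ℂ} (hp : p ∈ zeroSet Q) (hR : ‖p.1‖ < R) :
    p.2 ≠ 0 := by
  rintro h0
  have : Q.evalEval p.1 p.2 = 0 := hp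
  rw [h0] at this
  exact h.axis p.1 hR this

lemma IsModel.value_eq (h : IsModel Q q R) (hP : P.IsSolution Q) {t : ℂ} (h0 : t ≠ 0)
    (ht : ‖t‖ ^ P.k < R) : P.value t = t ^ P.coeffs.order * P.unitPart t :=
  (h.convergesAt hP ht).value_eq h0

lemma isOpen_normPowLt (k : ℕ) (R : ℝ) : IsOpen {t : ℂ | ‖t‖ ^ k < R} :=
  isOpen_lt (continuous_norm.pow k) continuous_const

lemma IsModel.differentiableAt_unitPart (h : IsModel Q q R) (hP : P.IsSolution Q) {t : ℂ}
    (ht : ‖t‖ ^ P.k < R) : DifferentiableAt ℂ P.unitPart t := by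
  have h1 := P.differentiableOn_unitPart_of_forall (r := R ^ ((P.k : ℝ)⁻¹)) fun t ht =>
    h.convergesAt hP ((pow_lt_iff_lt_rpow P.k_pos (norm_nonneg t) h.pos.le).2 ht)
  have h2 : t ∈ Metric.ball (0 : ℂ) (R ^ ((P.k : ℝ)⁻¹)) := by
    rwa [mem_ball_zero_iff, ← pow_lt_iff_lt_rpow P.k_pos (norm_nonneg t) h.pos.le]
  exact (h1 t h2).differentiableAt (Metric.isOpen_ball.mem_nhds h2)

lemma IsModel.continuousAt_value (h : IsModel Q q R) (hP : P.IsSolution Q) {t : ℂ} (h0 : t ≠ 0)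
    (ht : ‖t‖ ^ P.k < R) : ContinuousAt P.value t := by
  have h1 : ContinuousAt (fun t => t ^ P.coeffs.order * P.unitPart t) t :=
    (continuousAt_zpow₀ t _ (Or.inl h0)).mul (h.differentiableAt_unitPart hP ht).continuousAt
  refine h1.congr ?_
  filter_upwards [(isOpen_normPowLt P.k R).mem_nhds ht, eventually_ne_nhds h0] with t' h1 h2
  exact (h.value_eq hP h2 h1).symm

lemma IsModel.value_ne_zero (h : IsModel Q q R) (hP : P.IsSolution Q) {t : ℂ} (h0 : t ≠ 0)
    (ht : ‖t‖ ^ P.k < R) : P.value t ≠ 0 :=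
  h.snd_ne_zero (h.mem_zeroSet hP h0 ht) (by simpa using ht)

/-- Two points of the graph of a solution agree only if their parameters do. -/
lemma IsModel.eq_of_value_eq (h : IsModel Q q R) (hP : P.IsSolution Q) {t t' : ℂ} (h0 : t ≠ 0)
    (h0' : t' ≠ 0) (ht : ‖t‖ ^ P.k < R) (ht' : ‖t'‖ ^ P.k < R) (hpow : t ^ P.k = t' ^ P.k)
    (hval : P.value t = P.value t') : t = t' := by
  obtain ⟨η, hη, -, hv, hper⟩ := h.exists_branch_of_solution hP
  have hk := P.k_pos
  have hw := mul_log_mem_expPreimage hk h0 ht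
  have hw' := mul_log_mem_expPreimage hk h0' ht'
  obtain ⟨n, hn⟩ : ∃ n : ℤ, P.k * Complex.log t = P.k * Complex.log t' + n * expPeriod := by
    refine Complex.exp_eq_exp_iff_exists_int.1 ?_
    rw [Complex.exp_nat_mul, Complex.exp_nat_mul, Complex.exp_log h0, Complex.exp_log h0', hpow]
  have h1 := hv _ hw
  have h2 := hv _ hw'
  rw [exp_mul_log_div hk h0] at h1
  rw [exp_mul_log_div hk h0'] at h2
  have h3 : n ∈ periods R η := h.mem_periods hη hw' (by rw [← hn, ← h1, ← h2, hval])
  obtain ⟨m, rfl⟩ := (hper n).1 h3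
  have h4 : Complex.log t = Complex.log t' + m * expPeriod := by
    have hk' : (P.k : ℂ) ≠ 0 := Nat.cast_ne_zero.2 hk.ne'
    apply mul_left_cancel₀ hk'
    rw [hn]; push_cast; ring
  rw [← Complex.exp_log h0, h4, exp_add_int_mul_expPeriod, Complex.exp_log h0']

/-- Over the punctured disk every point of the curve lies on the graph of a solution. -/
lemma IsModel.exists_solution_through (h : IsModel Q q R) {p : ℂ × ℂ} (hp : p ∈ zeroSet Q)
    (h0 : p.1 ≠ 0) (hR : ‖p.1‖ < R) : ∃ P : PuiseuxSeries, P.IsSolution Q ∧ ∃ t : ℂ, t ≠ 0 ∧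
      ‖t‖ ^ P.k < R ∧ (t ^ P.k, P.value t) = p := by
  have hw : Complex.log p.1 ∈ expPreimage R := by
    rwa [mem_expPreimage_iff, Complex.exp_log h0]
  obtain ⟨η, hη, hη0⟩ := h.exists_isBranch (y₀ := p.2) hw (by rw [Complex.exp_log h0]; exact hp)
  obtain ⟨P, hP, hv⟩ := h.exists_solution_of_branch hη
  refine ⟨P, hP, Complex.exp (Complex.log p.1 / P.k), Complex.exp_ne_zero _,
    (mem_expPreimage_iff_pow P.k_pos).1 hw, Prod.ext ?_ ?_⟩
  · simp only
    rw [exp_div_pow P.k_pos, Complex.exp_log h0]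
  · simp only
    rw [hv _ hw, hη0]

lemma PuiseuxSeries.eq_of_value_eq {r : ℝ} (hr : 0 < r) (hk : P.k = P'.k)
    (hP : ∀ t : ℂ, ‖t‖ < r → P.ConvergesAt t) (hP' : ∀ t : ℂ, ‖t‖ < r → P'.ConvergesAt t)
    (hv : ∀ t : ℂ, t ≠ 0 → ‖t‖ < r → P.value t = P'.value t) : P = P' := by
  have h1 : P.coeffs.coeff = P'.coeffs.coeff := by
    refine laurent_coeff_unique (N := min P.coeffs.order P'.coeffs.order) (s := P.value)
      (fun j hj => P.coeff_eq_zero_of_lt (hj.trans_le (min_le_left _ _)))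
      (fun j hj => P'.coeff_eq_zero_of_lt (hj.trans_le (min_le_right _ _))) hr
      (fun t _ ht => (hP t ht).hasSum) (fun t h0 ht => ?_)
    rw [hv t h0 ht]
    exact (hP' t ht).hasSum
  have h2 : P.coeffs = P'.coeffs := HahnSeries.ext h1
  cases P
  cases P'
  simp only at hk h2
  subst hk h2
  rfl

/-- There are only finitely many Puiseux series solutions. -/
lemma IsModel.finite_solutions (h : IsModel Q q R) :
    {P : PuiseuxSeries | P.IsSolution Q}.Finite := by
  obtain ⟨w, hw⟩ := expPreimage_nonempty h.pos
  -- At a fixed `w` a solution is determined by its value there: the value fixes the branch, the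
  -- branch fixes its periods and hence `k`, and then the coefficients.
  refine Set.Finite.of_finite_image (f := fun P : PuiseuxSeries =>
    P.value (Complex.exp (w / P.k))) ((h.finite_fiber _ (Complex.exp_ne_zero w)
      (norm_exp_lt hw)).subset ?_) ?_
  · rintro _ ⟨P, hP, rfl⟩
    have h1 := h.mem_zeroSet hP (Complex.exp_ne_zero _) ((mem_expPreimage_iff_pow P.k_pos).1 hw)
    rw [exp_div_pow P.k_pos] at h1
    exact (h.zero_iff _ (Complex.exp_ne_zero w) (norm_exp_lt hw) _).1 h1
  · intro P hP P' hP' heq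
    obtain ⟨η, hη, -, hv, hper⟩ := h.exists_branch_of_solution hP
    obtain ⟨η', hη', -, hv', hper'⟩ := h.exists_branch_of_solution hP'
    simp only [hv w hw, hv' w hw] at heq
    have h1 := h.eqOn_of_isBranch (isPreconnected_expPreimage R) subset_rfl hη hη' hw heq
    have hpp : ∀ m, m ∈ periods R η ↔ m ∈ periods R η' := fun m => by
      refine forall₂_congr fun v hv => ?_
      rw [h1 hv, h1 (add_mul_expPeriod_mem_iff.2 hv)]
    have hk : P.k = P'.k := by
      apply Nat.dvd_antisymm <;> rw [← Int.natCast_dvd_natCast]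
      · rw [← hper, hpp, hper']
      · rw [← hper', ← hpp, hper]
    refine PuiseuxSeries.eq_of_value_eq (r := R ^ ((P.k : ℝ)⁻¹)) (Real.rpow_pos_of_pos h.pos _) hk
      (fun t ht => h.convergesAt hP ?_) (fun t ht => h.convergesAt hP' ?_) (fun t h0 ht => ?_)
    · rwa [pow_lt_iff_lt_rpow P.k_pos (norm_nonneg t) h.pos.le]
    · rwa [← hk, pow_lt_iff_lt_rpow P.k_pos (norm_nonneg t) h.pos.le]
    · rw [← pow_lt_iff_lt_rpow P.k_pos (norm_nonneg t) h.pos.le] at ht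
      have hm := mul_log_mem_expPreimage P.k_pos h0 ht
      have e1 := hv _ hm
      have e2 := hv' _ hm
      rw [exp_mul_log_div P.k_pos h0] at e1
      rw [← hk, exp_mul_log_div P.k_pos h0] at e2
      rw [e1, e2, h1 hm]

/-- Solutions whose graphs meet differ by a change of the uniformizer. -/
lemma IsModel.exists_conjugate (h : IsModel Q q R) (hP : P.IsSolution Q) (hP' : P'.IsSolution Q)
    {t t' : ℂ} (h0 : t ≠ 0) (h0' : t' ≠ 0) (ht : ‖t‖ ^ P.k < R) (ht' : ‖t'‖ ^ P'.k < R)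
    (hpow : t ^ P.k = t' ^ P'.k) (hval : P.value t = P'.value t') :
    P'.k = P.k ∧ ∃ ζ : ℂ, ζ ^ P.k = 1 ∧ ∀ s : ℂ, s ≠ 0 → ‖s‖ ^ P.k < R →
      P'.value s = P.value (ζ * s) := by
  obtain ⟨η, hη, -, hv, hper⟩ := h.exists_branch_of_solution hP
  obtain ⟨η', hη', -, hv', hper'⟩ := h.exists_branch_of_solution hP'
  have hk := P.k_pos
  have hk' := P'.k_pos
  have hw := mul_log_mem_expPreimage hk h0 ht
  have hw' := mul_log_mem_expPreimage hk' h0' ht'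
  obtain ⟨n, hn⟩ : ∃ n : ℤ, P.k * Complex.log t = P'.k * Complex.log t' + n * expPeriod := by
    refine Complex.exp_eq_exp_iff_exists_int.1 ?_
    rw [Complex.exp_nat_mul, Complex.exp_nat_mul, Complex.exp_log h0, Complex.exp_log h0', hpow]
  have h1 := hv _ hw
  have h2 := hv' _ hw'
  rw [exp_mul_log_div hk h0] at h1
  rw [exp_mul_log_div hk' h0'] at h2
  -- Both branches pass through the common point, after a shift by the number `n` of turns between
  -- the two logarithms of `x`. In the uniformizer this shift is multiplication by `ζ = exp (2πin /
  -- k)`.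
  have h3 : ∀ v ∈ expPreimage R, η' v = η (v + n * expPeriod) :=
    h.eqOn_of_isBranch (isPreconnected_expPreimage R) subset_rfl hη' (hη.translate n) hw'
      (by rw [← hn, ← h1, ← h2, hval])
  have hpp : ∀ m, m ∈ periods R η' ↔ m ∈ periods R η := fun m => by
    constructor
    · intro hm
      have h4 := hm _ hw'
      rw [h3 _ hw', h3 _ (add_mul_expPeriod_mem_iff.2 hw')] at h4
      refine h.mem_periods hη (add_mul_expPeriod_mem_iff (m := n).2 hw') ?_
      rw [← h4]; ring_nf
    · intro hm v hv
      rw [h3 _ hv, h3 _ (add_mul_expPeriod_mem_iff.2 hv)]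
      rw [← hm _ (add_mul_expPeriod_mem_iff (m := n).2 hv)]
      ring_nf
  have hkk : P'.k = P.k := by
    apply Nat.dvd_antisymm <;> rw [← Int.natCast_dvd_natCast]
    · rw [← hper', hpp, hper]
    · rw [← hper, ← hpp, hper']
  refine ⟨hkk, Complex.exp (n * expPeriod / P.k), ?_, fun s hs0 hs => ?_⟩
  · rw [exp_div_pow hk, exp_int_mul_expPeriod]
  · have hm := mul_log_mem_expPreimage hk hs0 hs
    have e1 := hv' _ hm
    rw [hkk, exp_mul_log_div hk hs0, h3 _ hm] at e1
    rw [e1, ← hv _ (add_mul_expPeriod_mem_iff (m := n).2 hm), add_div, Complex.exp_add,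
      exp_mul_log_div hk hs0, mul_comm]

end

/-! ### Compactified graphs and the components over a disk -/

noncomputable section

variable {Q q : ℂ[X][Y]} {R : ℝ} {P P' : PuiseuxSeries}

/-- The inclusion `ℂ × ℂ → ℂ × (ℂ ∪ {∞})`. -/
abbrev toCompact (p : ℂ × ℂ) : ℂ × OnePoint ℂ := (p.1, (p.2 : OnePoint ℂ))

lemma continuous_toCompact : Continuous toCompact :=
  continuous_fst.prodMk (OnePoint.continuous_coe.comp continuous_snd)

lemma isEmbedding_toCompact : Topology.IsEmbedding toCompact :=
  Topology.IsEmbedding.id.prodMap OnePoint.isOpenEmbedding_coe.isEmbedding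

lemma toCompact_injective : Function.Injective toCompact := isEmbedding_toCompact.injective

namespace PuiseuxSeries

variable (P)

/-- The parametrization `t ↦ (t ^ k, g(t))` of the graph. -/
def param (t : ℂ) : ℂ × ℂ := (t ^ P.k, P.value t)

open Classical in
/-- The parametrization of the graph, extended by the endpoint. -/
def compactParam (t : ℂ) : ℂ × OnePoint ℂ := if t = 0 then P.endpoint else toCompact (P.param t)

lemma compactParam_zero : P.compactParam 0 = P.endpoint := if_pos rfl

lemma compactParam_of_ne_zero {t : ℂ} (ht : t ≠ 0) : P.compactParam t = toCompact (P.param t) :=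
  if_neg ht

lemma compactParam_fst (t : ℂ) : (P.compactParam t).1 = t ^ P.k := by
  by_cases h0 : t = 0
  · rw [h0, compactParam_zero, zero_pow P.k_pos.ne']; rfl
  · rw [P.compactParam_of_ne_zero h0]; rfl

/-- The disk of radius `ε` in the `x`-plane, pulled back to the plane of the uniformizer. -/
def disk (ε : ℝ) : Set ℂ := {t : ℂ | ‖t‖ ^ P.k ≤ ε}

lemma disk_eq_closedBall {ε : ℝ} (hε : 0 ≤ ε) :
    P.disk ε = Metric.closedBall 0 (ε ^ ((P.k : ℝ)⁻¹)) := by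
  ext t
  rw [mem_closedBall_zero_iff, Real.le_rpow_inv_iff_of_pos (norm_nonneg t) hε
    (by exact_mod_cast P.k_pos), Real.rpow_natCast]
  rfl

lemma isCompact_disk {ε : ℝ} (hε : 0 ≤ ε) : IsCompact (P.disk ε) := by
  rw [P.disk_eq_closedBall hε]
  exact isCompact_closedBall _ _

lemma zero_mem_disk {ε : ℝ} (hε : 0 ≤ ε) : (0 : ℂ) ∈ P.disk ε := by
  simpa [disk, P.k_pos.ne'] using hε

lemma mem_graph {W : Set ℂ} {p : ℂ × ℂ} :
    p ∈ P.graph W ↔ ∃ t ∈ W, t ≠ 0 ∧ P.param t = p := by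
  constructor
  · rintro ⟨t, ⟨h1, h2⟩, rfl⟩; exact ⟨t, h1, h2, rfl⟩
  · rintro ⟨t, h1, h2, rfl⟩; exact ⟨t, ⟨h1, h2⟩, rfl⟩

lemma mem_diskGraph {ε : ℝ} {p : ℂ × ℂ} :
    p ∈ P.diskGraph ε ↔ ∃ t ∈ P.disk ε, t ≠ 0 ∧ P.param t = p := P.mem_graph

lemma insert_endpoint_eq {W : Set ℂ} (hW : 0 ∈ W) :
    insert P.endpoint (toCompact '' P.graph W) = P.compactParam '' W := by
  ext p
  constructor
  · rintro (rfl | ⟨_, hp, rfl⟩)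
    · exact ⟨0, hW, P.compactParam_zero⟩
    · obtain ⟨t, h1, h2, rfl⟩ := P.mem_graph.1 hp
      exact ⟨t, h1, P.compactParam_of_ne_zero h2⟩
  · rintro ⟨t, ht, rfl⟩
    by_cases h0 : t = 0
    · left; rw [h0, P.compactParam_zero]
    · right
      exact ⟨_, P.mem_graph.2 ⟨t, ht, h0, rfl⟩, (P.compactParam_of_ne_zero h0).symm⟩

lemma preimage_compactParam_image {W : Set ℂ} (hW : 0 ∈ W) :
    toCompact ⁻¹' (P.compactParam '' W) = P.graph W ∪ {p | toCompact p = P.endpoint} := by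
  rw [← P.insert_endpoint_eq hW]
  ext p
  simp only [Set.mem_preimage, Set.mem_insert_iff, Set.mem_union, Set.mem_ofPred_eq,
    toCompact_injective.mem_set_image]
  exact or_comm

end PuiseuxSeries

/-- If `j₀ > 0` the graph would tend to `(0, 0)`, which would then lie on the closed set `𝒱`. -/
lemma IsModel.order_nonpos (h : IsModel Q q R) (hP : P.IsSolution Q) : P.coeffs.order ≤ 0 := by
  by_contra! hN
  have h1 : Filter.Tendsto (fun t => (t ^ P.k, t ^ P.coeffs.order * P.unitPart t)) (𝓝[≠] (0 : ℂ))
      (𝓝 (0, 0)) := by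
    have h2 : ContinuousAt (fun t : ℂ => (t ^ P.k, t ^ P.coeffs.order * P.unitPart t)) 0 := by
      refine (continuous_pow _).continuousAt.prodMk ((continuousAt_zpow₀ _ _ (Or.inr hN.le)).mul
        (h.differentiableAt_unitPart hP ?_).continuousAt)
      simpa [P.k_pos.ne'] using h.pos
    have h3 := h2.tendsto
    simp only [zero_pow P.k_pos.ne', zero_zpow _ hN.ne', zero_mul] at h3
    exact h3.mono_left nhdsWithin_le_nhds
  have h4 : ∀ᶠ t in 𝓝[≠] (0 : ℂ), (t ^ P.k, t ^ P.coeffs.order * P.unitPart t) ∈ zeroSet Q := by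
    filter_upwards [hP, self_mem_nhdsWithin] with t ht h0
    rw [← ht.1.value_eq h0]
    exact ht.2
  have h5 : ((0, 0) : ℂ × ℂ) ∈ zeroSet Q := (isClosed_zeroSet Q).mem_of_tendsto h1 h4
  exact h.axis 0 (by simpa using h.pos) h5

/-- At `t = 0` only two cases occur, since `j₀ ≤ 0`: for `j₀ = 0` the value tends to `u(0) = c₀`,
and for `j₀ < 0` its modulus tends to infinity because `u(0) ≠ 0`. -/
lemma IsModel.continuousAt_compactParam (h : IsModel Q q R) (hP : P.IsSolution Q) {t : ℂ}
    (ht : ‖t‖ ^ P.k < R) : ContinuousAt P.compactParam t := by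
  by_cases h0 : t = 0
  · subst h0
    rw [← continuousWithinAt_compl_self]
    have hu := (h.differentiableAt_unitPart hP ht).continuousAt.mono_left
      (nhdsWithin_le_nhds (s := {0}ᶜ))
    have hpow : Filter.Tendsto (fun t : ℂ => t ^ P.k) (𝓝[≠] 0) (𝓝 0) := by
      have := ((continuous_pow P.k).tendsto (0 : ℂ)).mono_left (nhdsWithin_le_nhds (s := {0}ᶜ))
      rwa [zero_pow P.k_pos.ne'] at this
    have hev : (fun t => (t ^ P.k, ((t ^ P.coeffs.order * P.unitPart t : ℂ) : OnePoint ℂ)))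
        =ᶠ[𝓝[≠] 0] P.compactParam := by
      filter_upwards [hP, self_mem_nhdsWithin] with t ht h0
      rw [P.compactParam_of_ne_zero h0, PuiseuxSeries.param, ht.1.value_eq h0]
    rw [ContinuousWithinAt, P.compactParam_zero, PuiseuxSeries.endpoint]
    refine Filter.Tendsto.congr' hev (hpow.prodMk_nhds ?_)
    rcases (h.order_nonpos hP).eq_or_lt with hN | hN
    · have hc : P.coeffs.coeff 0 = P.unitPart 0 := by rw [P.unitPart_zero, hN]
      simp only [hN, le_refl, if_true, zpow_zero, one_mul, hc]
      exact (OnePoint.continuous_coe.tendsto _).comp hu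
    · rw [if_neg hN.not_ge]
      refine OnePoint.tendsto_coe_infty.comp ?_
      rw [Filter.coclosedCompact_eq_cocompact, ← Metric.cobounded_eq_cocompact,
        ← tendsto_norm_atTop_iff_cobounded]
      simp only [norm_mul]
      exact Filter.Tendsto.atTop_mul_pos (norm_pos_iff.2 P.unitPart_zero_ne_zero)
        (tendsto_norm_atTop_iff_cobounded.2 (tendsto_zpow_nhdsNE_zero_cobounded hN)) hu.norm
  · have h1 : ContinuousAt (fun t => toCompact (P.param t)) t :=
      continuous_toCompact.continuousAt.comp
        ((continuous_pow P.k).continuousAt.prodMk (h.continuousAt_value hP h0 ht))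
    refine h1.congr ?_
    filter_upwards [eventually_ne_nhds h0] with t' ht'
    exact (P.compactParam_of_ne_zero ht').symm

lemma IsModel.injOn_compactParam (h : IsModel Q q R) (hP : P.IsSolution Q) :
    Set.InjOn P.compactParam {t | ‖t‖ ^ P.k < R} := by
  intro t ht t' ht' heq
  have h1 := congrArg Prod.fst heq
  rw [P.compactParam_fst, P.compactParam_fst] at h1
  by_cases h0 : t = 0
  · rw [h0, zero_pow P.k_pos.ne'] at h1
    rw [h0, pow_eq_zero_iff P.k_pos.ne' |>.1 h1.symm]
  · have h0' : t' ≠ 0 := by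
      rintro rfl
      rw [zero_pow P.k_pos.ne'] at h1
      exact h0 (pow_eq_zero_iff P.k_pos.ne' |>.1 h1)
    rw [P.compactParam_of_ne_zero h0, P.compactParam_of_ne_zero h0'] at heq
    exact h.eq_of_value_eq hP h0 h0' ht ht' h1 (congrArg Prod.snd (toCompact_injective heq))

lemma PuiseuxSeries.disk_subset {ε : ℝ} (hεR : ε < R) (P : PuiseuxSeries) :
    P.disk ε ⊆ {t | ‖t‖ ^ P.k < R} := fun _ ht => lt_of_le_of_lt ht hεR

/-- The compactified graph is compact, hence closed; pulling it back to `ℂ × ℂ` adds to the graph at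
most the finite endpoint. -/
lemma IsModel.isClosed_preimage_compactParam (h : IsModel Q q R) (hP : P.IsSolution Q)
    {W : Set ℂ} (hW : IsCompact W) (hWR : W ⊆ {t | ‖t‖ ^ P.k < R}) :
    IsClosed (toCompact ⁻¹' (P.compactParam '' W)) :=
  (hW.image_of_continuousOn fun _ ht =>
    (h.continuousAt_compactParam hP (hWR ht)).continuousWithinAt).isClosed.preimage
      continuous_toCompact

/-- A preconnected set that is cut out of `S` by one half of a closed cover of `S` and does not meet
the other half is a component of `S`. -/
lemma connectedComponentIn_eq_of_closed_cover {α : Type*} [TopologicalSpace α] {S A C C' : Set α}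
    {p : α} (hA : IsPreconnected A) (hAS : A ⊆ S) (hC : IsClosed C) (hC' : IsClosed C')
    (hS : S ⊆ C ∪ C') (hSC : S ∩ C ⊆ A) (hAC' : Disjoint A C') (hp : p ∈ A) :
    connectedComponentIn S p = A := by
  refine Set.Subset.antisymm ?_ (hA.subset_connectedComponentIn hp hAS)
  have hsub := connectedComponentIn_subset S p
  have hK : IsPreconnected (connectedComponentIn S p) := isPreconnected_connectedComponentIn
  have hpK := mem_connectedComponentIn (hAS hp)
  by_contra hne
  obtain ⟨x, hxK, hxA⟩ := Set.not_subset.1 hne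
  have hx' : x ∈ C' := (hS (hsub hxK)).resolve_left fun hxC => hxA (hSC ⟨hsub hxK, hxC⟩)
  have hpC : p ∈ C := (hS (hAS hp)).resolve_right fun hp' => Set.disjoint_left.1 hAC' hp hp'
  obtain ⟨y, hyK, hyC, hyC'⟩ := isPreconnected_closed_iff.1 hK C C' hC hC' (hsub.trans hS)
    ⟨p, hpK, hpC⟩ ⟨x, hxK, hx'⟩
  exact Set.disjoint_left.1 hAC' (hSC ⟨hsub hyK, hyC⟩) hyC'

/-- The punctured disk is the image of a half plane under `exp`. -/
lemma isPreconnected_closedBall_diff_zero {r : ℝ} :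
    IsPreconnected (Metric.closedBall (0 : ℂ) r \ {0}) := by
  rcases le_or_gt r 0 with hr | hr
  · have : Metric.closedBall (0 : ℂ) r \ {0} = ∅ := by
      rw [Set.sdiff_eq_empty]
      refine (Metric.closedBall_subset_closedBall hr).trans ?_
      simp
    rw [this]
    exact isPreconnected_empty
  have : Metric.closedBall (0 : ℂ) r \ {0} = Complex.exp '' {w | w.re ≤ Real.log r} := by
    ext t
    constructor
    · rintro ⟨ht, h0⟩
      rw [mem_closedBall_zero_iff] at ht
      refine ⟨Complex.log t, ?_, Complex.exp_log h0⟩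
      simp only [Set.mem_ofPred_eq, Complex.log_re]
      exact Real.log_le_log (norm_pos_iff.2 h0) ht
    · rintro ⟨w, hw, rfl⟩
      refine ⟨?_, Complex.exp_ne_zero w⟩
      rw [mem_closedBall_zero_iff, Complex.norm_exp, ← Real.le_log_iff_exp_le hr]
      exact hw
  rw [this]
  exact (convex_halfSpace_re_le _).isPreconnected.image _ Complex.continuous_exp.continuousOn

lemma IsModel.continuousOn_param (h : IsModel Q q R) (hP : P.IsSolution Q) :
    ContinuousOn P.param {t | ‖t‖ ^ P.k < R ∧ t ≠ 0} := fun _ ht =>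
  ((continuous_pow P.k).continuousAt.prodMk
    (h.continuousAt_value hP ht.2 ht.1)).continuousWithinAt

lemma IsModel.isPreconnected_diskGraph (h : IsModel Q q R) (hP : P.IsSolution Q) {ε : ℝ}
    (hε : 0 ≤ ε) (hεR : ε < R) : IsPreconnected (P.diskGraph ε) := by
  have h1 : IsPreconnected (P.disk ε \ {0}) := by
    rw [P.disk_eq_closedBall hε]
    exact isPreconnected_closedBall_diff_zero
  exact h1.image _ ((h.continuousOn_param hP).mono fun t ht => ⟨P.disk_subset hεR ht.1, ht.2⟩)

/-- Graphs of solutions that meet have the same pieces over all disks, and the same endpoint. -/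
lemma IsModel.conjugate_of_mem (h : IsModel Q q R) (hP : P.IsSolution Q) (hP' : P'.IsSolution Q)
    {t t' : ℂ} (h0 : t ≠ 0) (h0' : t' ≠ 0) (ht : ‖t‖ ^ P.k < R) (ht' : ‖t'‖ ^ P'.k < R)
    (heq : P.param t = P'.param t') :
    (∀ ε < R, P'.diskGraph ε = P.diskGraph ε) ∧ P'.endpoint = P.endpoint := by
  obtain ⟨hk, ζ, hζ, hv⟩ := h.exists_conjugate hP hP' h0 h0' ht ht' (congrArg Prod.fst heq)
    (congrArg Prod.snd heq)
  have hζ0 : ζ ≠ 0 := by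
    rintro rfl
    rw [zero_pow P.k_pos.ne'] at hζ
    exact zero_ne_one hζ
  have hζn : ‖ζ‖ = 1 := by
    have := congrArg norm hζ
    rw [norm_pow, norm_one] at this
    exact (pow_eq_one_iff_of_nonneg (norm_nonneg ζ) P.k_pos.ne').1 this
  have hparam : ∀ s : ℂ, s ≠ 0 → ‖s‖ ^ P.k < R → P'.param s = P.param (ζ * s) := fun s hs0 hs => by
    rw [PuiseuxSeries.param, PuiseuxSeries.param, hv s hs0 hs, hk, mul_pow, hζ, one_mul]
  refine ⟨fun ε hε => ?_, ?_⟩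
  · ext p
    rw [PuiseuxSeries.mem_diskGraph, PuiseuxSeries.mem_diskGraph]
    constructor
    · rintro ⟨s, hs, hs0, rfl⟩
      have hs' : ‖s‖ ^ P.k ≤ ε := hk ▸ hs
      refine ⟨ζ * s, ?_, mul_ne_zero hζ0 hs0, (hparam s hs0 (hs'.trans_lt hε)).symm⟩
      simpa [PuiseuxSeries.disk, hζn] using hs'
    · rintro ⟨s, hs, hs0, rfl⟩
      have hs' : ‖s‖ ^ P.k ≤ ε := hs
      have hz0 : ζ⁻¹ * s ≠ 0 := mul_ne_zero (inv_ne_zero hζ0) hs0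
      have hz : ‖ζ⁻¹ * s‖ ^ P.k ≤ ε := by simpa [hζn] using hs'
      refine ⟨ζ⁻¹ * s, ?_, hz0, ?_⟩
      · simpa only [PuiseuxSeries.disk, Set.mem_ofPred_eq, hk] using hz
      · rw [hparam _ hz0 (hz.trans_lt hε), mul_inv_cancel_left₀ hζ0]
  -- The endpoints are the limits at `0` of `P'(s)` and `P(ζs)`, which agree for small nonzero `s`.
  · have hz : ‖(0 : ℂ)‖ ^ P.k < R := by simpa [P.k_pos.ne'] using h.pos
    have c1 := (h.continuousAt_compactParam hP' (t := 0) (by rwa [hk])).tendsto.mono_left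
      (nhdsWithin_le_nhds (s := {0}ᶜ))
    have c2 : Filter.Tendsto (fun s => P.compactParam (ζ * s)) (𝓝[≠] 0)
        (𝓝 (P.compactParam 0)) := by
      have : Filter.Tendsto (fun s : ℂ => ζ * s) (𝓝[≠] 0) (𝓝 0) := by
        have := ((continuous_const_mul ζ).tendsto 0).mono_left (nhdsWithin_le_nhds (s := {0}ᶜ))
        rwa [mul_zero] at this
      exact (h.continuousAt_compactParam hP hz).tendsto.comp this
    rw [P.compactParam_zero] at c2
    rw [P'.compactParam_zero] at c1
    refine tendsto_nhds_unique_of_eventuallyEq c1 c2 ?_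
    filter_upwards [self_mem_nhdsWithin, mem_nhdsWithin_of_mem_nhds
      ((isOpen_normPowLt P.k R).mem_nhds hz)] with s hs0 hs
    rw [P'.compactParam_of_ne_zero hs0, P.compactParam_of_ne_zero (mul_ne_zero hζ0 hs0),
      hparam s hs0 hs]

lemma IsModel.param_mem (h : IsModel Q q R) (hP : P.IsSolution Q) {t : ℂ} (h0 : t ≠ 0)
    (ht : ‖t‖ ^ P.k < R) : P.param t ∈ zeroSetOffAxes Q :=
  ⟨h.mem_zeroSet hP h0 ht, pow_ne_zero _ h0, h.value_ne_zero hP h0 ht⟩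

/-- The graphs of the solutions are components of the curve over a punctured disk. -/
theorem IsModel.isComponent_diskGraph (h : IsModel Q q R) (hP : P.IsSolution Q) {ε : ℝ}
    (hε : 0 < ε) (hεR : ε < R) :
    IsComponent (zeroSetOffAxes Q ∩ {p | ‖p.1‖ ≤ ε}) (P.diskGraph ε) := by
  have hsub : P.diskGraph ε ⊆ zeroSetOffAxes Q ∩ {p | ‖p.1‖ ≤ ε} := by
    intro p hp
    obtain ⟨t, ht, h0, rfl⟩ := P.mem_diskGraph.1 hp
    exact ⟨h.param_mem hP h0 (P.disk_subset hεR ht), by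
      simpa [PuiseuxSeries.param] using show ‖t‖ ^ P.k ≤ ε from ht⟩
  obtain ⟨t₀, ht₀, ht₀'⟩ : ∃ t₀ : ℂ, t₀ ≠ 0 ∧ t₀ ∈ P.disk ε := by
    refine ⟨((ε ^ ((P.k : ℝ)⁻¹) : ℝ) : ℂ), ?_, ?_⟩
    · exact_mod_cast (Real.rpow_pos_of_pos hε _).ne'
    · rw [P.disk_eq_closedBall hε.le, mem_closedBall_zero_iff, Complex.norm_of_nonneg
        (Real.rpow_nonneg hε.le _)]
  have hp₀ : P.param t₀ ∈ P.diskGraph ε := P.mem_diskGraph.2 ⟨t₀, ht₀', ht₀, rfl⟩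
  refine ⟨P.param t₀, hsub hp₀, Eq.symm ?_⟩
  -- A solution outside `T` has a graph that meets the graph of `P` and so equals it.
  set T := {P' : PuiseuxSeries | P'.IsSolution Q ∧ Disjoint (P.diskGraph ε) (P'.diskGraph ε)}
  have hT : T.Finite := h.finite_solutions.subset fun P' hP' => hP'.1
  -- The closed sets of the cover differ from the graphs only over `x = 0`, away from `𝒱'`.
  have hmemC : ∀ P' : PuiseuxSeries, ∀ p : ℂ × ℂ, p.1 ≠ 0 →
      (p ∈ toCompact ⁻¹' (P'.compactParam '' P'.disk ε) ↔ p ∈ P'.diskGraph ε) := by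
    intro P' p hp
    rw [P'.preimage_compactParam_image (P'.zero_mem_disk hε.le)]
    refine ⟨fun hp' => hp'.resolve_right fun he => ?_, Or.inl⟩
    exact hp (congrArg Prod.fst he)
  refine connectedComponentIn_eq_of_closed_cover
    (C := toCompact ⁻¹' (P.compactParam '' P.disk ε))
    (C' := ⋃ P' ∈ T, toCompact ⁻¹' (P'.compactParam '' P'.disk ε))
    (h.isPreconnected_diskGraph hP hε.le hεR) hsub
    (h.isClosed_preimage_compactParam hP (P.isCompact_disk hε.le) (P.disk_subset hεR))
    (hT.isClosed_biUnion fun P' hP' => h.isClosed_preimage_compactParam hP'.1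
      (P'.isCompact_disk hε.le) (P'.disk_subset hεR)) ?_ ?_ ?_ hp₀
  · rintro p ⟨⟨hp, hp0, -⟩, hpε⟩
    have hpε : ‖p.1‖ ≤ ε := hpε
    obtain ⟨P', hP', t, h0, ht, rfl⟩ := h.exists_solution_through hp hp0 (hpε.trans_lt hεR)
    have hmem : P'.param t ∈ P'.diskGraph ε :=
      P'.mem_diskGraph.2 ⟨t, by simpa [PuiseuxSeries.disk] using hpε, h0, rfl⟩
    by_cases hd : Disjoint (P.diskGraph ε) (P'.diskGraph ε)
    · right
      exact Set.mem_biUnion (show P' ∈ T from ⟨hP', hd⟩) ((hmemC P' _ hp0).2 hmem)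
    · left
      obtain ⟨x, hx, hx'⟩ := Set.not_disjoint_iff.1 hd
      obtain ⟨s, hs, hs0, rfl⟩ := P.mem_diskGraph.1 hx
      obtain ⟨s', hs', hs0', he⟩ := P'.mem_diskGraph.1 hx'
      have := (h.conjugate_of_mem hP hP' hs0 hs0' (P.disk_subset hεR hs) (P'.disk_subset hεR hs')
        he.symm).1 ε hεR
      exact (hmemC P _ hp0).2 (this ▸ hmem)
  · rintro p ⟨⟨⟨hp, hp0, -⟩, hpε⟩, hpC⟩
    exact (hmemC P _ hp0).1 hpC
  · rw [Set.disjoint_left]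
    intro p hp hp'
    simp only [Set.mem_iUnion] at hp'
    obtain ⟨P', hP', hpC⟩ := hp'
    have hp0 : p.1 ≠ 0 := (hsub hp).1.2.1
    exact Set.disjoint_left.1 hP'.2 hp ((hmemC P' _ hp0).1 hpC)

end

/-! ### The disk and its winding number -/

noncomputable section

variable {Q q : ℂ[X][Y]} {R : ℝ} {P P' : PuiseuxSeries}

/-- The graph of a solution over a punctured disk is a disk punctured at its centre, the endpoint,
and its boundary winds `k` times around the `y`-axis. -/
theorem IsModel.isDiskWindingAroundYAxis (h : IsModel Q q R) (hP : P.IsSolution Q) {ε : ℝ}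
    (hε : 0 < ε) (hεR : ε < R) :
    IsDiskWindingAroundYAxis (P.diskGraph ε) P.endpoint ε P.k := by
  have hk := P.k_pos
  have hS : insert P.endpoint (toCompact '' P.diskGraph ε) = P.compactParam '' P.disk ε :=
    P.insert_endpoint_eq (P.zero_mem_disk hε.le)
  set ρ := ε ^ ((P.k : ℝ)⁻¹) with hρ
  have hρ0 : 0 < ρ := Real.rpow_pos_of_pos hε _
  have hρk : ρ ^ P.k = ε := Real.rpow_inv_natCast_pow hε.le hk.ne'
  have hmem : ∀ z : Metric.closedBall (0 : ℂ) 1, (ρ : ℂ) * z ∈ P.disk ε := fun z => by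
    rw [P.disk_eq_closedBall hε.le, mem_closedBall_zero_iff, norm_mul,
      Complex.norm_of_nonneg hρ0.le]
    exact mul_le_of_le_one_right hρ0.le (mem_closedBall_zero_iff.1 z.2)
  let f : Metric.closedBall (0 : ℂ) 1 →
      (insert P.endpoint (toCompact '' P.diskGraph ε) : Set (ℂ × OnePoint ℂ)) :=
    fun z => ⟨P.compactParam (ρ * z), hS ▸ ⟨_, hmem z, rfl⟩⟩
  have hρC : (ρ : ℂ) ≠ 0 := by exact_mod_cast hρ0.ne'
  have hf : Function.Bijective f := by
    constructor
    · intro z z' hz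
      have := h.injOn_compactParam hP (P.disk_subset hεR (hmem z)) (P.disk_subset hεR (hmem z'))
        (congrArg Subtype.val hz)
      exact Subtype.ext (mul_left_cancel₀ hρC this)
    · rintro ⟨p, hp⟩
      have hp' := hp
      rw [hS] at hp'
      obtain ⟨t, ht, rfl⟩ := hp'
      have ht' := ht
      rw [P.disk_eq_closedBall hε.le, mem_closedBall_zero_iff] at ht'
      refine ⟨⟨t / ρ, ?_⟩, Subtype.ext ?_⟩
      · rw [mem_closedBall_zero_iff, norm_div, Complex.norm_of_nonneg hρ0.le]
        exact div_le_one_of_le₀ ht' hρ0.le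
      · simp only [f, mul_div_cancel₀ _ hρC]
  have hcont : Continuous f := by
    refine Continuous.subtype_mk (continuous_iff_continuousAt.2 fun z => ?_) _
    refine ContinuousAt.comp (f := fun z : Metric.closedBall (0 : ℂ) 1 => (ρ : ℂ) * z)
      (h.continuousAt_compactParam hP (P.disk_subset hεR (hmem z))) ?_
    exact (continuous_const.mul continuous_subtype_val).continuousAt
  have hcoe : ∀ z, (f z : ℂ × OnePoint ℂ) = P.compactParam (ρ * z) := fun z => rfl
  -- A continuous bijection from a compact space to a Hausdorff space is a homeomorphism.
  refine ⟨?_, hcont.homeoOfEquivCompactToT2 (f := Equiv.ofBijective f hf), fun z => ?_,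
    fun z => ?_, ?_⟩
  · rintro ⟨p, hp, he⟩
    obtain ⟨t, -, h0, rfl⟩ := P.mem_diskGraph.1 hp
    exact pow_ne_zero P.k h0 (congrArg Prod.fst he)
  · change _ ↔ (f z : ℂ × OnePoint ℂ) = _
    rw [hcoe, ← P.compactParam_zero]
    constructor
    · intro hz; rw [hz, mul_zero]
    · intro hz
      have := h.injOn_compactParam hP (P.disk_subset hεR (hmem z))
        (P.disk_subset hεR (P.zero_mem_disk hε.le)) hz
      exact (mul_eq_zero.1 this).resolve_left hρC
  · change _ ↔ ‖(f z : ℂ × OnePoint ℂ).1‖ = _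
    rw [hcoe, P.compactParam_fst, norm_pow, norm_mul, Complex.norm_of_nonneg hρ0.le, mul_pow, hρk,
      mul_eq_left₀ hε.ne', pow_eq_one_iff_of_nonneg (norm_nonneg _) hk.ne']
  · have hγ : ∀ u : ℝ, (f (circlePoint u) : ℂ × OnePoint ℂ).1 =
        ε * Complex.exp (P.k * (2 * Real.pi * u * Complex.I)) := fun u => by
      rw [hcoe, P.compactParam_fst, mul_pow, Complex.exp_nat_mul]
      congr 1
      · exact_mod_cast hρk
      · simp [circlePoint, Circle.coe_exp]
    -- The first coordinate on the boundary is `ε exp (2πiku)`, with the evident continuous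
    -- logarithm.
    refine ⟨fun u => Real.log ε + P.k * (2 * Real.pi * u * Complex.I), ?_, fun u _ => ?_, ?_⟩
    · fun_prop
    · refine Eq.trans ?_ (hγ u).symm
      rw [Complex.exp_add, ← Complex.ofReal_exp, Real.exp_log hε]
    · push_cast; ring

end

/-! ### The height along a solution -/

noncomputable section

variable {Q q : ℂ[X][Y]} {R : ℝ} {P P' : PuiseuxSeries} {r s : ℝ}

/-- The rate at which the height grows along the graph as `t → 0`. -/
def PuiseuxSeries.heightRate (P : PuiseuxSeries) (r s : ℝ) : ℝ :=
  r / (r + s) * P.k + s / (r + s) * P.coeffs.order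

lemma PuiseuxSeries.direction_lt_iff (hr : 0 < r) (hs : 0 < s) :
    P.direction < r / s ↔ 0 < P.heightRate r s := by
  have hk : (0 : ℝ) < P.k := by exact_mod_cast P.k_pos
  have hrs : 0 < r + s := add_pos hr hs
  rw [direction, heightRate, div_mul_eq_mul_div, div_mul_eq_mul_div, ← add_div,
    div_lt_div_iff₀ hk hs, lt_div_iff₀ hrs, zero_mul]
  constructor <;> intro h <;> linarith

lemma PuiseuxSeries.direction_eq_iff (hr : 0 < r) (hs : 0 < s) :
    P.direction = r / s ↔ P.heightRate r s = 0 := by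
  have hk : (0 : ℝ) < P.k := by exact_mod_cast P.k_pos
  have hrs : 0 < r + s := add_pos hr hs
  rw [direction, heightRate, div_mul_eq_mul_div, div_mul_eq_mul_div, ← add_div,
    div_eq_div_iff hk.ne' hs.ne', div_eq_zero_iff, or_iff_left hrs.ne']
  constructor <;> intro h <;> linarith

/-- Rate zero means direction `r / s`, which is positive and so would be a bad direction. -/
lemma PuiseuxSeries.heightRate_ne_zero (hr : 0 < r) (hs : 0 < s)
    (hbad : r / s ∉ badDirections Q) (hP : P.IsSolution Q) : P.heightRate r s ≠ 0 := fun h0 =>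
  hbad ⟨div_pos hr hs, P, hP, (direction_eq_iff hr hs).2 h0⟩

lemma IsModel.height_param (h : IsModel Q q R) (hP : P.IsSolution Q) (r s : ℝ) {t : ℂ}
    (h0 : t ≠ 0) (ht : ‖t‖ ^ P.k < R) : height r s (P.param t) =
      ((-P.heightRate r s * Real.log ‖t‖ - s / (r + s) * Real.log ‖P.unitPart t‖ : ℝ) : EReal) := by
  have hv := h.value_ne_zero hP h0 ht
  have hu : P.unitPart t ≠ 0 := by
    intro hu
    rw [h.value_eq hP h0 ht, hu, mul_zero] at hv
    exact hv rfl
  rw [height, if_neg (by simp [PuiseuxSeries.param, h0, hv])]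
  congr 1
  simp only [PuiseuxSeries.param]
  rw [h.value_eq hP h0 ht, norm_pow, norm_mul, norm_zpow, Real.log_pow,
    Real.log_mul (zpow_ne_zero _ (norm_ne_zero_iff.2 h0)) (norm_ne_zero_iff.2 hu), Real.log_zpow,
    PuiseuxSeries.heightRate]
  ring

lemma eventually_mem_disk (P : PuiseuxSeries) {ε : ℝ} (hε : 0 < ε) :
    ∀ᶠ t in 𝓝 (0 : ℂ), ‖t‖ ^ P.k < ε :=
  ((continuous_norm.pow P.k).continuousAt).eventually_lt_const (by simpa [P.k_pos.ne'] using hε)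

lemma exists_disk_subset (P : PuiseuxSeries) {S : Set ℂ} (hS : S ∈ 𝓝 (0 : ℂ)) :
    ∃ δ > 0, P.disk δ ⊆ S := by
  obtain ⟨ρ, hρ, hb⟩ := Metric.nhds_basis_closedBall.mem_iff.1 hS
  refine ⟨ρ ^ P.k, pow_pos hρ _, fun t ht => hb ?_⟩
  rw [mem_closedBall_zero_iff]
  exact le_of_pow_le_pow_left₀ P.k_pos.ne' hρ.le ht

/-- A holomorphic coordinate near `t = 0` whose modulus is determined by the height. -/
lemma IsModel.exists_heightCoordinate (h : IsModel Q q R) (hP : P.IsSolution Q)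
    (hA : P.heightRate r s ≠ 0) : ∃ (φ : OpenPartialHomeomorph ℂ ℂ) (K δ : ℝ), 0 < δ ∧ δ < R ∧
      P.disk δ ⊆ φ.source ∧ φ 0 = 0 ∧ (∀ t ∈ P.disk δ, ‖φ t - t‖ ≤ ‖t‖ / 2) ∧
      ∀ t ∈ P.disk δ, t ≠ 0 →
        height r s (P.param t) = ((-P.heightRate r s * Real.log ‖φ t‖ + K : ℝ) : EReal) := by
  set A := P.heightRate r s
  have hu0 := P.unitPart_zero_ne_zero
  have hcu : ContinuousAt (fun t => P.unitPart t / P.unitPart 0) 0 :=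
    ((h.differentiableAt_unitPart hP (by simpa [P.k_pos.ne'] using h.pos)).continuousAt).div_const _
  have hslit : ∀ᶠ t in 𝓝 (0 : ℂ), P.unitPart t / P.unitPart 0 ∈ Complex.slitPlane :=
    hcu.eventually_mem (Complex.isOpen_slitPlane.mem_nhds (by simp [hu0]))
  -- The exponent `ŝ / A` is chosen so that `-A log |v|` equals `-ŝ log |u / u(0)|`. Near `0` the
  -- quotient is close to `1`, where the principal logarithm is holomorphic.
  set v : ℂ → ℂ := fun t => Complex.exp ((s / (r + s) / A : ℝ) *
    Complex.log (P.unitPart t / P.unitPart 0)) with hv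
  have hvd : ∀ᶠ t in 𝓝 (0 : ℂ), DifferentiableAt ℂ v t := by
    filter_upwards [hslit, eventually_mem_disk P h.pos] with t h1 h2
    exact (((h.differentiableAt_unitPart hP h2).div_const _).clog h1).const_mul _ |>.cexp
  have hv0 : v 0 = 1 := by simp [hv, hu0]
  set f : ℂ → ℂ := fun t => t * v t with hf
  have hfd : ∀ᶠ t in 𝓝 (0 : ℂ), DifferentiableAt ℂ f t := by
    filter_upwards [hvd] with t ht using differentiableAt_id.mul ht
  have han : AnalyticAt ℂ f 0 := by
    rw [Complex.analyticAt_iff_eventually_differentiableAt]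
    exact hfd
  have hder : HasDerivAt f 1 0 := by
    have := (hasDerivAt_id (0 : ℂ)).mul hvd.self_of_nhds.hasDerivAt
    exact HasDerivAt.congr_deriv (f := f) this (by simp [hv0])
  have hstrict : HasStrictDerivAt f 1 0 := by
    have := han.hasStrictDerivAt
    rwa [hder.deriv] at this
  have hf0 : f 0 = 0 := by simp [hf]
  have hF := hstrict.hasStrictFDerivAt_equiv one_ne_zero
  set φ := hF.toOpenPartialHomeomorph f with hφ
  have hφf : ∀ t, φ t = f t := fun t => rfl
  -- The derivative at `0` is `1`. The estimate keeps `φ t` nonzero for `t ≠ 0`, and later keeps the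
  -- homotopy off the origin.
  have hest : ∀ᶠ t in 𝓝 (0 : ℂ), ‖f t - t‖ ≤ ‖t‖ / 2 := by
    have := (hasDerivAt_iff_isLittleO.1 hder).def (c := 1 / 2) (by norm_num)
    filter_upwards [this] with t ht
    simp only [hf0, sub_zero, smul_eq_mul, mul_one] at ht
    linarith
  have hsrc : φ.source ∈ 𝓝 (0 : ℂ) :=
    φ.open_source.mem_nhds hF.mem_toOpenPartialHomeomorph_source
  obtain ⟨δ₀, hδ₀, hb⟩ := exists_disk_subset P (Filter.inter_mem hsrc (hslit.and hest))
  have hmin : 0 < min δ₀ (R / 2) := lt_min hδ₀ (half_pos h.pos)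
  have hminR : min δ₀ (R / 2) < R := (min_le_right _ _).trans_lt (half_lt_self h.pos)
  have hb' : P.disk (min δ₀ (R / 2)) ⊆ P.disk δ₀ := fun t ht =>
    le_trans (b := min δ₀ (R / 2)) ht (min_le_left _ _)
  refine ⟨φ, -(s / (r + s) * Real.log ‖P.unitPart 0‖), min δ₀ (R / 2), hmin, hminR,
    fun t ht => (hb (hb' ht)).1, hf0, fun t ht => (hb (hb' ht)).2.2, fun t ht h0 => ?_⟩
  have h1 := (hb (hb' ht)).2.1
  have hu : P.unitPart t ≠ 0 := by
    intro hu
    rw [hu, zero_div] at h1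
    exact Complex.zero_notMem_slitPlane h1
  rw [h.height_param hP r s h0 (P.disk_subset hminR ht), hφf]
  congr 1
  simp only [hf, hv]
  rw [norm_mul, Complex.norm_exp, Complex.re_ofReal_mul, Complex.log_re,
    Real.log_mul (norm_ne_zero_iff.2 h0) (Real.exp_ne_zero _), Real.log_exp, norm_div,
    Real.log_div (norm_ne_zero_iff.2 hu) (norm_ne_zero_iff.2 hu0)]
  field_simp
  ring

/-- The points of the uniformizer plane over the disk of radius `ε` where the height is
at least `c`. -/
def PuiseuxSeries.highSet (P : PuiseuxSeries) (r s ε c : ℝ) : Set ℂ :=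
  {t | t ∈ P.disk ε ∧ (t = 0 ∨ (c : EReal) ≤ height r s (P.param t))}

/-- `W` is a neighbourhood of `0` that a homeomorphism `φ` close to the identity maps to a round
closed disk; `ψ` is the inverse homeomorphism. -/
structure IsRoundNeighborhood (W : Set ℂ) (ρ : ℝ) (φ ψ : ℂ → ℂ) : Prop where
  pos : 0 < ρ
  mem_nhds : W ∈ 𝓝 0
  map_zero : φ 0 = 0
  continuousOn : ContinuousOn φ W
  continuousOn_inv : ContinuousOn ψ (Metric.closedBall 0 ρ)
  mapsTo : Set.MapsTo φ W (Metric.closedBall 0 ρ)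
  mapsTo_inv : Set.MapsTo ψ (Metric.closedBall 0 ρ) W
  left_inv : ∀ t ∈ W, ψ (φ t) = t
  right_inv : ∀ w ∈ Metric.closedBall 0 ρ, φ (ψ w) = w
  near_id : ∀ t ∈ W, ‖φ t - t‖ ≤ ‖t‖ / 2

/-- Along a solution of direction larger than `r / s` the height is bounded above. -/
lemma IsModel.eventually_height_lt (h : IsModel Q q R) (hP : P.IsSolution Q)
    (hA : P.heightRate r s < 0) : ∃ δ > 0, δ < R ∧ ∀ᶠ c : ℝ in Filter.atTop,
      ∀ t ∈ P.disk δ, t ≠ 0 → height r s (P.param t) < c := by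
  obtain ⟨φ, K, δ, hδ, hδR, -, -, hest, hh⟩ := h.exists_heightCoordinate hP hA.ne
  refine ⟨δ, hδ, hδR, ?_⟩
  -- On the disk `|φ t| ≤ 2|t| ≤ 2δ^(1/k)`, and for a negative rate the height increases with `|φ|`.
  set M := -P.heightRate r s * Real.log (2 * δ ^ ((P.k : ℝ)⁻¹)) + K
  filter_upwards [Filter.eventually_gt_atTop M] with c hc t ht h0
  rw [hh t ht h0, EReal.coe_lt_coe_iff]
  refine lt_of_le_of_lt ?_ hc
  have hlow : ‖t‖ / 2 ≤ ‖φ t‖ := by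
    have h1 := hest t ht
    have h2 := norm_sub_norm_le t (φ t)
    rw [norm_sub_rev] at h2
    linarith
  have hup : ‖φ t‖ ≤ 2 * ‖t‖ := by
    have h1 := hest t ht
    have h2 := norm_sub_norm_le (φ t) t
    have := norm_nonneg t
    linarith
  have ht' := ht
  rw [P.disk_eq_closedBall hδ.le, mem_closedBall_zero_iff] at ht'
  have hpos : 0 < ‖φ t‖ := lt_of_lt_of_le (half_pos (norm_pos_iff.2 h0)) hlow
  have h3 : Real.log ‖φ t‖ ≤ Real.log (2 * δ ^ ((P.k : ℝ)⁻¹)) :=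
    Real.log_le_log hpos (hup.trans (by linarith))
  have := mul_le_mul_of_nonneg_left h3 (neg_pos.2 hA).le
  linarith

/-- Along a solution of direction smaller than `r / s` the points of large height form a round
neighbourhood of `0`. -/
lemma IsModel.eventually_isRoundNeighborhood (h : IsModel Q q R) (hP : P.IsSolution Q)
    (hA : 0 < P.heightRate r s) : ∃ δ > 0, δ < R ∧ ∀ ε : ℝ, 0 < ε → ε ≤ δ →
      ∀ᶠ c : ℝ in Filter.atTop, (∀ t ∈ P.highSet r s ε c, ‖t‖ ^ P.k < ε) ∧
        ∃ ρ φ ψ, IsRoundNeighborhood (P.highSet r s ε c) ρ φ ψ := by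
  obtain ⟨φ, K, δ, hδ, hδR, hsrc, hφ0, hest, hh⟩ := h.exists_heightCoordinate hP hA.ne'
  refine ⟨δ, hδ, hδR, fun ε hε hεδ => ?_⟩
  have hsub : P.disk ε ⊆ P.disk δ := fun t ht => le_trans (b := ε) ht hεδ
  have h0src : (0 : ℂ) ∈ φ.source := hsrc (P.zero_mem_disk hδ.le)
  have himg : φ '' {t | ‖t‖ ^ P.k < ε} ∈ 𝓝 (0 : ℂ) := by
    have := φ.image_mem_nhds h0src (eventually_mem_disk P hε)
    rwa [hφ0] at this
  -- Balls of radius at most `ρ₀` in the `φ`-plane come from points with `|t| ^ k < ε`, strictly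
  -- inside the disk.
  obtain ⟨ρ₀, hρ₀, hb⟩ := Metric.nhds_basis_closedBall.mem_iff.1 himg
  have hlim : Filter.Tendsto (fun c : ℝ => Real.exp ((K - c) / P.heightRate r s)) Filter.atTop
      (𝓝 0) := by
    refine Real.tendsto_exp_atBot.comp (Filter.Tendsto.atBot_div_const hA ?_)
    exact Filter.tendsto_atBot_add_const_left _ K Filter.tendsto_neg_atTop_atBot
  filter_upwards [hlim.eventually_le_const hρ₀] with c hc
  -- Solving `-A log |φ| + K ≥ c` for `|φ|` gives `|φ| ≤ ρ`.
  set ρ := Real.exp ((K - c) / P.heightRate r s) with hρ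
  have hlow : ∀ t ∈ P.disk δ, ‖t‖ / 2 ≤ ‖φ t‖ := fun t ht => by
    have h1 := hest t ht
    have h2 := norm_sub_norm_le t (φ t)
    rw [norm_sub_rev] at h2
    linarith
  have hW : ∀ t, t ∈ P.highSet r s ε c ↔ t ∈ P.disk ε ∧ ‖φ t‖ ≤ ρ := by
    intro t
    refine and_congr_right fun ht => ?_
    by_cases h0 : t = 0
    · simp [h0, hφ0, hρ, Real.exp_nonneg]
    · have hpos : 0 < ‖φ t‖ := (half_pos (norm_pos_iff.2 h0)).trans_le (hlow t (hsub ht))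
      rw [or_iff_right h0, hh t (hsub ht) h0, EReal.coe_le_coe_iff, hρ, ← Real.log_le_iff_le_exp
        hpos, le_div_iff₀ hA]
      constructor <;> intro h <;> linarith
  have hsmall : ∀ w ∈ Metric.closedBall (0 : ℂ) ρ, w ∈ φ.target ∧ ‖φ.symm w‖ ^ P.k < ε := by
    intro w hw
    obtain ⟨t, ht, rfl⟩ := hb (Metric.closedBall_subset_closedBall hc hw)
    have hts : t ∈ φ.source := hsrc (hsub (le_of_lt (show ‖t‖ ^ P.k < ε from ht)))
    exact ⟨φ.map_source hts, by rw [φ.left_inv hts]; exact ht⟩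
  have hWsrc : ∀ t ∈ P.highSet r s ε c, t ∈ φ.source := fun t ht => hsrc (hsub ht.1)
  refine ⟨fun t ht => ?_, ρ, φ, φ.symm, ⟨Real.exp_pos _, ?_, hφ0, ?_, ?_, fun t ht => ?_,
    fun w hw => ?_, fun t ht => φ.left_inv (hWsrc t ht), fun w hw => φ.right_inv (hsmall w hw).1,
    fun t ht => hest t (hsub ht.1)⟩⟩
  · have := (hsmall (φ t) (by simpa using ((hW t).1 ht).2)).2
    rwa [φ.left_inv (hWsrc t ht)] at this
  · have h1 : ∀ᶠ t in 𝓝 (0 : ℂ), ‖φ t‖ < ρ := by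
      refine (φ.continuousAt h0src).norm.eventually_lt_const ?_
      simp only [hφ0, norm_zero]
      exact Real.exp_pos _
    filter_upwards [h1, eventually_mem_disk P hε] with t h1 h2
    exact (hW t).2 ⟨le_of_lt h2, h1.le⟩
  · exact φ.continuousOn.mono hWsrc
  · exact φ.symm.continuousOn.mono fun w hw => (hsmall w hw).1
  · simpa using ((hW t).1 ht).2
  · refine (hW _).2 ⟨(hsmall w hw).2.le, ?_⟩
    rw [φ.right_inv (hsmall w hw).1]
    simpa using hw

end

/-! ### Points over `x = 0` and the use of smoothness -/

noncomputable section

variable {Q q : ℂ[X][Y]} {R : ℝ} {P P' : PuiseuxSeries}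

lemma differentiable_evalEval_right (Q : ℂ[X][Y]) (x : ℂ) :
    Differentiable ℂ fun y => Q.evalEval x y := by
  have h1 := (contDiff_evalEval Q).differentiable one_ne_zero
  exact h1.comp (g := fun p : ℂ × ℂ => Q.evalEval p.1 p.2) (f := fun y : ℂ => (x, y))
    ((differentiable_const x).prodMk differentiable_id)

/-- Zeros over `x = 0` are limits of zeros over nonzero `x`. -/
lemma IsModel.mem_closure_of_fst_eq_zero (h : IsModel Q q R) {y₀ : ℂ}
    (hp : ((0, y₀) : ℂ × ℂ) ∈ zeroSet Q) {δ : ℝ} (hδ : 0 < δ) :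
    ((0, y₀) : ℂ × ℂ) ∈ closure {p | p ∈ zeroSet Q ∧ p.1 ≠ 0 ∧ ‖p.1‖ < δ} := by
  have hp0 : Q.evalEval 0 y₀ = 0 := hp
  rw [mem_closure_iff_nhds]
  intro V hV
  obtain ⟨r₁, hr₁, hb⟩ := Metric.nhds_basis_closedBall.mem_iff.1 hV
  have hne : Q.map (Polynomial.evalRingHom 0) ≠ 0 := by
    intro h0
    refine h.axis 0 (by simpa using h.pos) ?_
    rw [← Polynomial.map_evalRingHom_eval, h0, Polynomial.eval_zero]
  have hiso : ∀ᶠ y in 𝓝[≠] y₀, Q.evalEval 0 y ≠ 0 := by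
    have hfin := (Polynomial.rootSet_finite (Q.map (Polynomial.evalRingHom 0)) ℂ).subset
      (Set.sdiff_subset (t := {y₀}))
    filter_upwards [mem_nhdsWithin_of_mem_nhds (hfin.isClosed.isOpen_compl.mem_nhds
      (x := y₀) (by simp)), self_mem_nhdsWithin] with y hy hyne h0
    refine hy ⟨?_, hyne⟩
    rw [Polynomial.mem_rootSet, Polynomial.coe_aeval_eq_eval, Polynomial.map_evalRingHom_eval]
    exact ⟨hne, h0⟩
  obtain ⟨r₂, hr₂, hb₂⟩ := Metric.eventually_nhds_iff_ball.1 (eventually_nhdsWithin_iff.1 hiso)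
  -- The circle of radius `ρ` about `y₀` carries no zero of `Q(0, ·)`.
  obtain ⟨ρ, hρ, hρ'⟩ := exists_between (lt_min hr₁ hr₂)
  have hcont := continuous_evalEval Q
  have hsph : IsCompact (Metric.sphere y₀ ρ) := isCompact_sphere y₀ ρ
  have hnz : ∀ y ∈ Metric.sphere y₀ ρ, 0 < ‖Q.evalEval 0 y‖ := fun y hy => by
    rw [norm_pos_iff]
    have hy' : dist y y₀ = ρ := hy
    refine hb₂ y (by rw [Metric.mem_ball, hy']; exact hρ'.trans_le (min_le_right _ _)) ?_
    rintro rfl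
    simp [hρ.ne] at hy'
  obtain ⟨m, hm, hm'⟩ : ∃ m : ℝ, 0 < m ∧ ∀ y ∈ Metric.sphere y₀ ρ, m < ‖Q.evalEval 0 y‖ := by
    obtain ⟨y₁, hy₁, hmin⟩ := hsph.exists_isMinOn (NormedSpace.sphere_nonempty.2 hρ.le)
      (f := fun y => ‖Q.evalEval 0 y‖)
      (hcont.comp (Continuous.prodMk continuous_const continuous_id)).norm.continuousOn
    exact ⟨_, half_pos (hnz y₁ hy₁), fun y hy =>
      (half_lt_self (hnz y₁ hy₁)).trans_le (hmin hy)⟩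
  have e1 : ∀ᶠ x in 𝓝 (0 : ℂ), ∀ y ∈ Metric.sphere y₀ ρ, m < ‖Q.evalEval x y‖ := by
    refine hsph.eventually_forall_of_forall_eventually fun y hy => ?_
    exact hcont.norm.continuousAt.eventually_const_lt (hm' y hy)
  have e2 : ∀ᶠ x in 𝓝 (0 : ℂ), ‖Q.evalEval x y₀‖ < m := by
    refine (hcont.comp (Continuous.prodMk continuous_id continuous_const)).norm.continuousAt
      |>.eventually_lt_const ?_
    simpa [hp0] using hm
  have e3 : ∀ᶠ x in 𝓝 (0 : ℂ), ‖x‖ < min δ r₁ :=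
    continuous_norm.continuousAt.eventually_lt_const (by simpa using ⟨hδ, hr₁⟩)
  obtain ⟨x, ⟨h1, h2, h3⟩, hx0⟩ := Filter.nonempty_of_mem (Filter.inter_mem
    (mem_nhdsWithin_of_mem_nhds (e1.and (e2.and e3)))
    (self_mem_nhdsWithin (a := (0 : ℂ)) (s := {0}ᶜ)))
  -- Otherwise `1 / Q(x, ·)` is holomorphic on the disk and at most `1 / m` on its boundary. The
  -- maximum principle then contradicts `|Q(x, y₀)| < m`.
  obtain ⟨y, hy, hy0⟩ : ∃ y ∈ Metric.closedBall y₀ ρ, Q.evalEval x y = 0 := by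
    by_contra! hcon
    have hd : DiffContOnCl ℂ (fun y => (Q.evalEval x y)⁻¹) (Metric.ball y₀ ρ) := by
      refine DiffContOnCl.inv (differentiable_evalEval_right Q x).diffContOnCl fun y hy => ?_
      exact hcon y (Metric.closure_ball_subset_closedBall hy)
    have hle := Complex.norm_le_of_forall_mem_frontier_norm_le Metric.isBounded_ball hd (C := m⁻¹)
      (fun y hy => by
        rw [norm_inv]
        refine inv_anti₀ hm (h1 y ?_).le
        rwa [frontier_ball y₀ hρ.ne'] at hy) (subset_closure (Metric.mem_ball_self hρ))
    rw [norm_inv] at hle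
    have hpos : 0 < ‖Q.evalEval x y₀‖ :=
      norm_pos_iff.2 (hcon y₀ (Metric.mem_closedBall_self hρ.le))
    exact absurd ((inv_le_inv₀ hpos hm).1 hle) (not_le.2 h2)
  refine ⟨(x, y), hb ?_, hy0, hx0, h3.trans_le (min_le_left _ _)⟩
  rw [← closedBall_prod_same]
  refine ⟨?_, ?_⟩
  · rw [mem_closedBall_zero_iff]
    exact h3.le.trans (min_le_right _ _)
  · exact Metric.closedBall_subset_closedBall (hρ'.le.trans (min_le_left _ _)) hy

/-- Every zero over `x = 0` is the endpoint of the graph of a solution. -/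
lemma IsModel.exists_endpoint_eq (h : IsModel Q q R) {p : ℂ × ℂ} (hp : p ∈ zeroSet Q)
    (hp0 : p.1 = 0) : ∃ P : PuiseuxSeries, P.IsSolution Q ∧ toCompact p = P.endpoint := by
  obtain ⟨x₀, y₀⟩ := p
  obtain rfl : x₀ = 0 := hp0
  have hδ := half_pos h.pos
  have hδR := half_lt_self h.pos
  -- The finitely many compactified graphs form a closed set that contains the curve over `0 < |x| <
  -- R / 2`, hence also its limit points over `x = 0`; there only `t = 0` is possible.
  have hT : IsClosed (⋃ P ∈ {P : PuiseuxSeries | P.IsSolution Q},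
      toCompact ⁻¹' (P.compactParam '' P.disk (R / 2))) :=
    h.finite_solutions.isClosed_biUnion fun P hP => h.isClosed_preimage_compactParam hP
      (P.isCompact_disk hδ.le) (P.disk_subset hδR)
  have hsub : {p | p ∈ zeroSet Q ∧ p.1 ≠ 0 ∧ ‖p.1‖ < R / 2} ⊆
      ⋃ P ∈ {P : PuiseuxSeries | P.IsSolution Q},
        toCompact ⁻¹' (P.compactParam '' P.disk (R / 2)) := by
    rintro p ⟨hp, hp0, hpR⟩
    obtain ⟨P, hP, t, h0, -, rfl⟩ := h.exists_solution_through hp hp0 (hpR.trans hδR)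
    refine Set.mem_biUnion (show P ∈ {P : PuiseuxSeries | P.IsSolution Q} from hP)
      ⟨t, ?_, P.compactParam_of_ne_zero h0⟩
    have : ‖t ^ P.k‖ < R / 2 := hpR
    rw [norm_pow] at this
    exact this.le
  have hmem := closure_minimal hsub hT (h.mem_closure_of_fst_eq_zero hp hδ)
  simp only [Set.mem_iUnion] at hmem
  obtain ⟨P, hP, t, -, heq⟩ := hmem
  refine ⟨P, hP, ?_⟩
  have h1 := congrArg Prod.fst heq
  rw [P.compactParam_fst] at h1
  rw [← heq, pow_eq_zero_iff P.k_pos.ne' |>.1 h1, P.compactParam_zero]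

/-- The parametrization of the graph of a solution without negative powers, including `t = 0`. -/
def PuiseuxSeries.finiteParam (P : PuiseuxSeries) (t : ℂ) : ℂ × ℂ := (t ^ P.k, P.unitPart t)

lemma IsModel.param_eq_finiteParam (h : IsModel Q q R) (hP : P.IsSolution Q)
    (hN : P.coeffs.order = 0) {t : ℂ} (h0 : t ≠ 0) (ht : ‖t‖ ^ P.k < R) :
    P.param t = P.finiteParam t := by
  rw [PuiseuxSeries.param, PuiseuxSeries.finiteParam, h.value_eq hP h0 ht, hN, zpow_zero, one_mul]

lemma IsModel.order_eq_zero_of_endpoint (h : IsModel Q q R) (hP : P.IsSolution Q) {p : ℂ × ℂ}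
    (hp : toCompact p = P.endpoint) : P.coeffs.order = 0 ∧ P.finiteParam 0 = p := by
  have h2 := congrArg Prod.snd hp
  rw [PuiseuxSeries.endpoint] at h2
  by_cases hN : 0 ≤ P.coeffs.order
  · have hN' := le_antisymm (h.order_nonpos hP) hN
    refine ⟨hN', Prod.ext ?_ ?_⟩
    · have := congrArg Prod.fst hp
      simpa [PuiseuxSeries.finiteParam, P.k_pos.ne', PuiseuxSeries.endpoint] using this.symm
    · simp only [hN, if_true] at h2
      rw [PuiseuxSeries.finiteParam, P.unitPart_zero, hN']
      exact (OnePoint.coe_injective h2).symm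
  · simp only [hN, if_false] at h2
    exact absurd h2 (OnePoint.coe_ne_infty _)

lemma IsModel.continuousAt_finiteParam (h : IsModel Q q R) (hP : P.IsSolution Q) :
    ContinuousAt P.finiteParam 0 :=
  (continuous_pow _).continuousAt.prodMk
    (h.differentiableAt_unitPart hP (by simpa [P.k_pos.ne'] using h.pos)).continuousAt

lemma IsModel.eventually_mem_zeroSet_finiteParam (h : IsModel Q q R) (hP : P.IsSolution Q)
    (hN : P.coeffs.order = 0) : ∀ᶠ t in 𝓝 (0 : ℂ), P.finiteParam t ∈ zeroSet Q := by
  have h1 : ∀ᶠ t in 𝓝[≠] (0 : ℂ), P.finiteParam t ∈ zeroSet Q := by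
    filter_upwards [mem_nhdsWithin_of_mem_nhds (eventually_mem_disk P h.pos), self_mem_nhdsWithin]
      with t ht h0
    rw [← h.param_eq_finiteParam hP hN h0 ht]
    exact h.mem_zeroSet hP h0 ht
  have h2 : P.finiteParam 0 ∈ zeroSet Q := (isClosed_zeroSet Q).mem_of_tendsto
    ((h.continuousAt_finiteParam hP).tendsto.mono_left (nhdsWithin_le_nhds (s := {0}ᶜ))) h1
  rw [eventually_nhdsWithin_iff] at h1
  filter_upwards [h1] with t ht
  by_cases h0 : t = 0
  · rwa [h0]
  · exact ht h0

/-- Two curves in `{F = 0}` through `p` meet outside `p` if `(π, F)` is a local coordinate system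
at `p` and `π` is open along both curves. -/
lemma exists_meet_of_coordinates {π F : ℂ × ℂ → ℂ} {p : ℂ × ℂ} {e : (ℂ × ℂ) ≃L[ℂ] (ℂ × ℂ)}
    (he : HasStrictFDerivAt (fun p => (π p, F p)) (e : (ℂ × ℂ) →L[ℂ] (ℂ × ℂ)) p)
    {γ γ' : ℂ → ℂ × ℂ} (h0 : γ 0 = p) (h0' : γ' 0 = p) (hc : ContinuousAt γ 0)
    (hc' : ContinuousAt γ' 0) (hF : ∀ᶠ t in 𝓝 0, F (γ t) = 0) (hF' : ∀ᶠ t in 𝓝 0, F (γ' t) = 0)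
    (hopen : 𝓝 (π p) ≤ Filter.map (fun t => π (γ t)) (𝓝 0))
    (hopen' : 𝓝 (π p) ≤ Filter.map (fun t => π (γ' t)) (𝓝 0)) {S S' : Set ℂ}
    (hS : S ∈ 𝓝 (0 : ℂ)) (hS' : S' ∈ 𝓝 (0 : ℂ)) :
    ∃ t ∈ S, ∃ t' ∈ S', t ≠ 0 ∧ t' ≠ 0 ∧ γ t = γ' t' := by
  set Ψ := he.toOpenPartialHomeomorph
  have hsrc : Ψ.source ∈ 𝓝 p := Ψ.open_source.mem_nhds he.mem_toOpenPartialHomeomorph_source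
  have hU : ∀ᶠ t in 𝓝 0, t ∈ S ∧ γ t ∈ Ψ.source ∧ F (γ t) = 0 :=
    (Filter.eventually_mem_set.2 hS).and ((hc.eventually_mem (by rwa [h0])).and hF)
  have hU' : ∀ᶠ t in 𝓝 0, t ∈ S' ∧ γ' t ∈ Ψ.source ∧ F (γ' t) = 0 :=
    (Filter.eventually_mem_set.2 hS').and ((hc'.eventually_mem (by rwa [h0'])).and hF')
  have h1 := hopen (Filter.image_mem_map hU)
  have h2 := hopen' (Filter.image_mem_map hU')
  -- A value `z ≠ π p` taken by `π` along both curves: it forces `t` and `t'` to be nonzero, and `F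
  -- = 0` with equal `π` makes the two points equal.
  obtain ⟨z, ⟨hz1, hz2⟩, hz⟩ := Filter.nonempty_of_mem (Filter.inter_mem
    (mem_nhdsWithin_of_mem_nhds (Filter.inter_mem h1 h2))
    (self_mem_nhdsWithin (a := π p) (s := {π p}ᶜ)))
  obtain ⟨t, ⟨ht, hts, htF⟩, rfl⟩ := hz1
  obtain ⟨t', ⟨ht', hts', htF'⟩, heq⟩ := hz2
  refine ⟨t, ht, t', ht', ?_, ?_, Ψ.injOn hts hts' (Prod.ext heq.symm (htF.trans htF'.symm))⟩
  · rintro rfl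
    exact hz (by simp [h0])
  · rintro rfl
    exact hz (by simp [← heq, h0'])

lemma nhds_le_map_pow {k : ℕ} (hk : 0 < k) :
    𝓝 (0 : ℂ) ≤ Filter.map (fun t : ℂ => t ^ k) (𝓝 0) := by
  have han : AnalyticAt ℂ (fun t : ℂ => t ^ k) 0 := by fun_prop
  rcases han.eventually_constant_or_nhds_le_map_nhds with hc | hc
  · exfalso
    obtain ⟨t, h1, h2⟩ := Filter.nonempty_of_mem (Filter.inter_mem
      (mem_nhdsWithin_of_mem_nhds hc) (self_mem_nhdsWithin (a := (0 : ℂ)) (s := {0}ᶜ)))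
    rw [zero_pow hk.ne'] at h1
    exact pow_ne_zero k h2 h1
  · rwa [zero_pow hk.ne'] at hc

/-- On a smooth curve two solutions with the same finite endpoint have graphs that meet. -/
lemma IsModel.exists_param_eq_of_endpoint_eq (h : IsModel Q q R) (hsmooth : IsSmoothCurve Q)
    (hP : P.IsSolution Q) (hP' : P'.IsSolution Q) {p : ℂ × ℂ} (hp : toCompact p = P.endpoint)
    (hp' : toCompact p = P'.endpoint) : ∃ t t' : ℂ, t ≠ 0 ∧ t' ≠ 0 ∧ ‖t‖ ^ P.k < R ∧
      ‖t'‖ ^ P'.k < R ∧ P.param t = P'.param t' := by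
  obtain ⟨hN, h0⟩ := h.order_eq_zero_of_endpoint hP hp
  obtain ⟨hN', h0'⟩ := h.order_eq_zero_of_endpoint hP' hp'
  have hev := h.eventually_mem_zeroSet_finiteParam hP hN
  have hev' := h.eventually_mem_zeroSet_finiteParam hP' hN'
  have hpz : p ∈ zeroSet Q := h0 ▸ hev.self_of_nhds
  have hp1 : p.1 = 0 := congrArg Prod.fst hp
  obtain ⟨f, hf, hfd⟩ := hsmooth p hpz
  set F : ℂ × ℂ → ℂ := fun q => f.evalEval q.1 q.2 with hFdef
  have hF : ∀ᶠ t in 𝓝 0, F (P.finiteParam t) = 0 := hev.mono fun t ht => hf _ ht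
  have hF' : ∀ᶠ t in 𝓝 0, F (P'.finiteParam t) = 0 := hev'.mono fun t ht => hf _ ht
  have key : ∃ t ∈ {t : ℂ | ‖t‖ ^ P.k < R}, ∃ t' ∈ {t : ℂ | ‖t‖ ^ P'.k < R}, t ≠ 0 ∧ t' ≠ 0 ∧
      P.finiteParam t = P'.finiteParam t' := by
    -- If `∂F/∂y ≠ 0`, then `x = t ^ k` serves as the open coordinate. At a vertical tangent it is
    -- `y`, which requires `u` to be nonconstant.
    by_cases hd : fderiv ℂ F p (0, 1) = 0
    · have hd' : fderiv ℂ F p (1, 0) ≠ 0 := by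
        intro hd'
        refine hfd (ContinuousLinearMap.ext fun v => ?_)
        have : v = v.1 • ((1 : ℂ), (0 : ℂ)) + v.2 • ((0 : ℂ), (1 : ℂ)) := by simp
        rw [this, map_add, map_smul, map_smul, hd, hd']
        simp
      obtain ⟨e, he⟩ := exists_equiv_hasStrictFDerivAt_snd (contDiff_evalEval f) hd'
      have hopen : ∀ P : PuiseuxSeries, P.IsSolution Q → P.finiteParam 0 = p →
          (∀ᶠ t in 𝓝 0, F (P.finiteParam t) = 0) →
          𝓝 p.2 ≤ Filter.map (fun t => (P.finiteParam t).2) (𝓝 0) := by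
        intro P hP h0 hF
        have han : AnalyticAt ℂ P.unitPart 0 := by
          rw [Complex.analyticAt_iff_eventually_differentiableAt]
          filter_upwards [eventually_mem_disk P h.pos] with t ht
          exact h.differentiableAt_unitPart hP ht
        rcases han.eventually_constant_or_nhds_le_map_nhds with hc | hc
        · exfalso
          apply hd'
          -- A constant `u` puts a piece of a horizontal line into `F = 0`, so `∂F/∂x` would vanish
          -- as well.
          have h1 : ∀ᶠ x in 𝓝 (0 : ℂ), F (x, p.2) = 0 := by
            refine nhds_le_map_pow P.k_pos (Filter.mem_map.2 ?_)
            filter_upwards [hc, hF] with t h1 h2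
            have h3 : P.unitPart 0 = p.2 := congrArg Prod.snd h0
            rw [PuiseuxSeries.finiteParam, h1, h3] at h2
            exact h2
          have h2 : HasDerivAt (fun x : ℂ => (x, p.2)) (1, 0) p.1 :=
            (hasDerivAt_id p.1).prodMk (hasDerivAt_const p.1 p.2)
          have h3 := HasFDerivAt.comp_hasDerivAt (f := fun x : ℂ => (x, p.2)) p.1
            (((contDiff_evalEval f).differentiable one_ne_zero) p).hasFDerivAt h2
          rw [hp1] at h3
          have h4 : HasDerivAt (fun _ : ℂ => (0 : ℂ)) 0 (0 : ℂ) := hasDerivAt_const _ _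
          exact h3.unique (h4.congr_of_eventuallyEq h1)
        · have h3 : P.unitPart 0 = p.2 := congrArg Prod.snd h0
          rwa [h3] at hc
      exact exists_meet_of_coordinates he h0 h0' (h.continuousAt_finiteParam hP)
        (h.continuousAt_finiteParam hP') hF hF' (hopen P hP h0 hF) (hopen P' hP' h0' hF')
        (eventually_mem_disk P h.pos) (eventually_mem_disk P' h.pos)
    · obtain ⟨e, he⟩ := exists_equiv_hasStrictFDerivAt_fst (contDiff_evalEval f) hd
      exact exists_meet_of_coordinates he h0 h0' (h.continuousAt_finiteParam hP)
        (h.continuousAt_finiteParam hP') hF hF' (by rw [hp1]; exact nhds_le_map_pow P.k_pos)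
        (by rw [hp1]; exact nhds_le_map_pow P'.k_pos)
        (eventually_mem_disk P h.pos) (eventually_mem_disk P' h.pos)
  obtain ⟨t, ht, t', ht', ht0, ht0', heq⟩ := key
  refine ⟨t, t', ht0, ht0', ht, ht', ?_⟩
  rw [h.param_eq_finiteParam hP hN ht0 ht, h.param_eq_finiteParam hP' hN' ht0' ht', heq]

end

/-! ### The homotopy -/

noncomputable section

variable {Q q : ℂ[X][Y]} {R : ℝ} {P P' : PuiseuxSeries}

/-- The compactified parametrization of a closed disk is a closed embedding by compactness; its
restriction factors through `toCompact`. -/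
lemma IsModel.isEmbedding_param (h : IsModel Q q R) (hP : P.IsSolution Q) {ε : ℝ} (hε : 0 ≤ ε)
    (hεR : ε < R) {W : Set ℂ} (hW : W ⊆ P.disk ε) :
    Topology.IsEmbedding fun t : ↥(W \ {0}) => P.param t := by
  have hcD : Continuous fun t : P.disk ε => P.compactParam t :=
    continuous_iff_continuousAt.2 fun t =>
      ContinuousAt.comp (h.continuousAt_compactParam hP (P.disk_subset hεR t.2))
        continuous_subtype_val.continuousAt
  have := isCompact_iff_compactSpace.1 (P.isCompact_disk hε)
  have hemb := (hcD.isClosedEmbedding fun t t' htt => Subtype.ext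
    (h.injOn_compactParam hP (P.disk_subset hεR t.2) (P.disk_subset hεR t'.2) htt)).isEmbedding
  have hcomp : Topology.IsEmbedding (toCompact ∘ fun t : ↥(W \ {0}) => P.param t) := by
    have h1 := hemb.comp (Topology.IsEmbedding.inclusion (Set.sdiff_subset.trans hW : W \ {0} ⊆ _))
    convert h1 using 1
    ext1 t
    exact (P.compactParam_of_ne_zero t.2.2).symm
  exact .of_comp ((h.continuousOn_param hP).comp_continuous continuous_subtype_val
    fun t => ⟨P.disk_subset hεR (hW t.2.1), t.2.2⟩) continuous_toCompact hcomp

/-- The parametrization of the graph over `W` is a homeomorphism. -/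
def IsModel.paramHomeomorph (h : IsModel Q q R) (hP : P.IsSolution Q) {ε : ℝ} (hε : 0 ≤ ε)
    (hεR : ε < R) {W : Set ℂ} (hW : W ⊆ P.disk ε) : ↥(W \ {0}) ≃ₜ P.graph W :=
  (h.isEmbedding_param hP hε hεR hW).toHomeomorph.trans (Homeomorph.setCongr (by
    ext p
    rw [P.mem_graph]
    constructor
    · rintro ⟨t, rfl⟩; exact ⟨t, t.2.1, t.2.2, rfl⟩
    · rintro ⟨t, h1, h2, rfl⟩; exact ⟨⟨t, h1, h2⟩, rfl⟩))

lemma IsModel.coe_paramHomeomorph (h : IsModel Q q R) (hP : P.IsSolution Q) {ε : ℝ} (hε : 0 ≤ ε)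
    (hεR : ε < R) {W : Set ℂ} (hW : W ⊆ P.disk ε) (t : ↥(W \ {0})) :
    (h.paramHomeomorph hP hε hεR hW t : ℂ × ℂ) = P.param t := rfl

lemma norm_segment_le {u v : ℂ} {τ d : ℝ} (h0 : 0 ≤ τ) (h1 : τ ≤ 1) (hu : ‖u‖ ≤ d)
    (hv : ‖v‖ ≤ d) : ‖(1 - τ : ℂ) * u + τ * v‖ ≤ d := by
  have := (convex_closedBall (0 : ℂ) d) (mem_closedBall_zero_iff.2 hu)
    (mem_closedBall_zero_iff.2 hv) (sub_nonneg.2 h1) h0 (by ring)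
  rw [mem_closedBall_zero_iff] at this
  simpa only [Complex.real_smul, Complex.ofReal_sub, Complex.ofReal_one] using this

/-- A positive multiple of `t` lies within `|w| / 2` of `w`, so `t` and `w` lie in a common open
half plane whose boundary passes through `0`. -/
lemma segment_ne_zero {t w : ℂ} {τ l : ℝ} (h0 : 0 ≤ τ) (h1 : τ ≤ 1) (hl : 0 < l) (hw : w ≠ 0)
    (hest : ‖(l : ℂ) * t - w‖ ≤ ‖w‖ / 2) : (1 - τ : ℂ) * t + τ * w ≠ 0 := by
  intro hz
  have hw' : 0 < ‖w‖ := norm_pos_iff.2 hw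
  have hz' : ((1 - τ + τ * l : ℝ) : ℂ) * w = -((1 - τ : ℝ) : ℂ) * (l * t - w) := by
    push_cast
    linear_combination (l : ℂ) * hz
  have hn := congrArg norm hz'
  rw [norm_mul, norm_mul, norm_neg, Complex.norm_of_nonneg (by nlinarith [mul_nonneg h0 hl.le]),
    Complex.norm_of_nonneg (sub_nonneg.2 h1)] at hn
  have h2 : (1 - τ + τ * l) * ‖w‖ ≤ (1 - τ) * (‖w‖ / 2) :=
    hn.le.trans (mul_le_mul_of_nonneg_left hest (sub_nonneg.2 h1))
  have h3 : (1 - τ) * ‖w‖ / 2 + τ * l * ‖w‖ ≤ 0 := by linarith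
  have h4 : 0 ≤ (1 - τ) * ‖w‖ := mul_nonneg (sub_nonneg.2 h1) hw'.le
  have h5 : 0 ≤ τ * l * ‖w‖ := by positivity
  have h6 : 1 - τ = 0 := (mul_eq_zero.1 (by linarith : (1 - τ) * ‖w‖ = 0)).resolve_right hw'.ne'
  have h7 : τ = 1 := by linarith
  rw [h7] at h3
  nlinarith [mul_pos hl hw']

lemma div_mul_mem_closedBall {a b : ℝ} (ha : 0 ≤ a) (hb : 0 < b) {z : ℂ}
    (hz : z ∈ Metric.closedBall 0 b) : ((a / b : ℝ) : ℂ) * z ∈ Metric.closedBall 0 a := by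
  rw [mem_closedBall_zero_iff] at hz ⊢
  rw [norm_mul, Complex.norm_of_nonneg (div_nonneg ha hb.le)]
  calc a / b * ‖z‖ ≤ a / b * b := by gcongr
    _ = a := div_mul_cancel₀ _ hb.ne'

/-- Rescaling a round disk onto a round neighbourhood, away from the centre. -/
def IsRoundNeighborhood.diskHomeomorph {W : Set ℂ} {ρ d : ℝ} {φ ψ : ℂ → ℂ}
    (hW : IsRoundNeighborhood W ρ φ ψ) (hd : 0 < d) :
    ↥(Metric.closedBall (0 : ℂ) d \ {0}) ≃ₜ ↥(W \ {0}) where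
  toFun t := ⟨ψ ((ρ / d : ℝ) * t), by
    have hmem : ((ρ / d : ℝ) : ℂ) * t ∈ Metric.closedBall (0 : ℂ) ρ :=
      div_mul_mem_closedBall hW.pos.le hd t.2.1
    refine ⟨hW.mapsTo_inv hmem, fun h0 => ?_⟩
    have h1 := hW.right_inv _ hmem
    rw [Set.mem_singleton_iff.1 h0, hW.map_zero, eq_comm, mul_eq_zero] at h1
    rcases h1 with h1 | h1
    · exact (div_pos hW.pos hd).ne' (by exact_mod_cast h1)
    · exact t.2.2 h1⟩
  invFun w := ⟨((d / ρ : ℝ) : ℂ) * φ w, by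
    refine ⟨div_mul_mem_closedBall hd.le hW.pos (hW.mapsTo w.2.1), fun h0 => ?_⟩
    · rcases mul_eq_zero.1 (Set.mem_singleton_iff.1 h0) with h1 | h1
      · exact (div_pos hd hW.pos).ne' (by exact_mod_cast h1)
      · have h2 := hW.left_inv _ w.2.1
        have h3 := hW.left_inv 0 (mem_of_mem_nhds hW.mem_nhds)
        rw [hW.map_zero] at h3
        rw [h1, h3] at h2
        exact w.2.2 h2.symm⟩
  left_inv t := by
    have hmem : ((ρ / d : ℝ) : ℂ) * t ∈ Metric.closedBall (0 : ℂ) ρ :=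
      div_mul_mem_closedBall hW.pos.le hd t.2.1
    refine Subtype.ext ?_
    simp only [hW.right_inv _ hmem, ← mul_assoc, ← Complex.ofReal_mul]
    rw [div_mul_div_cancel₀ hW.pos.ne', div_self hd.ne', Complex.ofReal_one, one_mul]
  right_inv w := by
    refine Subtype.ext ?_
    simp only [← mul_assoc, ← Complex.ofReal_mul]
    rw [div_mul_div_cancel₀ hd.ne', div_self hW.pos.ne', Complex.ofReal_one, one_mul,
      hW.left_inv _ w.2.1]
  continuous_toFun := by
    refine Continuous.subtype_mk (hW.continuousOn_inv.comp_continuous (by fun_prop) fun t =>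
      div_mul_mem_closedBall hW.pos.le hd t.2.1) _
  continuous_invFun := Continuous.subtype_mk (continuous_const.mul
    (hW.continuousOn.comp_continuous continuous_subtype_val fun w => w.2.1)) _

/-- The graph of a solution over a disk and over a round neighbourhood are homotopic. -/
theorem IsModel.homotopicIn_graph (h : IsModel Q q R) (hP : P.IsSolution Q) {W : Set ℂ} {ρ : ℝ}
    {φ ψ : ℂ → ℂ} (hW : IsRoundNeighborhood W ρ φ ψ) {ε ε₀ : ℝ} (hε : 0 < ε) (hεε : ε ≤ ε₀)
    (hεR : ε₀ < R) (hWε : W ⊆ P.disk ε₀) :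
    HomotopicIn (zeroSetOffAxes Q) (P.diskGraph ε) (P.graph W) := by
  have hε₀ : 0 < ε₀ := hε.trans_le hεε
  have hdisk : P.disk ε ⊆ P.disk ε₀ := fun t ht => le_trans (b := ε) ht hεε
  set d := ε ^ ((P.k : ℝ)⁻¹)
  have hd : 0 < d := Real.rpow_pos_of_pos hε _
  have hD : P.disk ε = Metric.closedBall 0 d := P.disk_eq_closedBall hε.le
  let A := h.paramHomeomorph hP hε₀.le hεR hdisk
  let B := h.paramHomeomorph hP hε₀.le hεR hWε
  let m : ↥(P.disk ε \ {0}) ≃ₜ ↥(W \ {0}) :=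
    (Homeomorph.setCongr (by rw [hD])).trans (hW.diskHomeomorph hd)
  have hm : ∀ t, φ (m t) = ((ρ / d : ℝ) : ℂ) * t := fun t => hW.right_inv _
    (div_mul_mem_closedBall hW.pos.le hd (hD.subset t.2.1))
  -- The segment from `t` to `m t = ψ (ρt / d)` in the uniformizer plane. It stays in the convex
  -- disk of `ε₀`, and it misses `0` because `(ρ / d) t = φ (m t)` is close to `m t`.
  let g : unitInterval × P.diskGraph ε → ℂ := fun x =>
    (1 - (x.1 : ℝ) : ℂ) * (A.symm x.2 : ℂ) + (x.1 : ℝ) * (m (A.symm x.2) : ℂ)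
  have hg : ∀ x, ‖g x‖ ^ P.k < R ∧ g x ≠ 0 := fun x => by
    have h1 : (A.symm x.2 : ℂ) ∈ P.disk ε₀ := hdisk (A.symm x.2).2.1
    have h2 : (m (A.symm x.2) : ℂ) ∈ P.disk ε₀ := hWε (m (A.symm x.2)).2.1
    rw [P.disk_eq_closedBall hε₀.le, mem_closedBall_zero_iff] at h1 h2
    refine ⟨P.disk_subset hεR ?_, ?_⟩
    · rw [P.disk_eq_closedBall hε₀.le, mem_closedBall_zero_iff]
      exact norm_segment_le x.1.2.1 x.1.2.2 h1 h2
    · refine segment_ne_zero x.1.2.1 x.1.2.2 (div_pos hW.pos hd) (m (A.symm x.2)).2.2 ?_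
      rw [← hm]
      exact hW.near_id _ (m (A.symm x.2)).2.1
  have hgc : Continuous g := by
    have h1 : Continuous fun x : unitInterval × P.diskGraph ε => (A.symm x.2 : ℂ) :=
      continuous_subtype_val.comp (A.symm.continuous.comp continuous_snd)
    have h2 : Continuous fun x : unitInterval × P.diskGraph ε => (m (A.symm x.2) : ℂ) :=
      continuous_subtype_val.comp (m.continuous.comp (A.symm.continuous.comp continuous_snd))
    have h3 : Continuous fun x : unitInterval × P.diskGraph ε => ((x.1 : ℝ) : ℂ) := by fun_prop
    exact ((continuous_const.sub h3).mul h1).add (h3.mul h2)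
  refine ⟨A.symm.trans (m.trans B), ⟨fun x => ⟨P.param (g x), h.param_mem hP (hg x).2 (hg x).1⟩,
    ((h.continuousOn_param hP).comp_continuous hgc hg).subtype_mk _⟩, fun a => ?_, fun a => ?_⟩
  · change P.param (g (0, a)) = a
    have : g (0, a) = A.symm a := by simp [g]
    rw [this, ← h.coe_paramHomeomorph hP hε₀.le hεR hdisk]
    exact congrArg Subtype.val (A.apply_symm_apply a)
  · change P.param (g (1, a)) = P.param (m (A.symm a))
    congr 1
    simp [g]

end

/-! ### Components of `X^{≥ c}` -/

noncomputable section

variable {Q q : ℂ[X][Y]} {R : ℝ} {P P' : PuiseuxSeries} {r s ε c : ℝ}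

/-- Over `|x| ≤ ε` the part of height at least `c` of the graph of each solution is a round punctured
disk inside `|x| < ε` or empty, depending on its direction. -/
structure IsGoodLevel (Q : ℂ[X][Y]) (R r s ε c : ℝ) : Prop where
  pos : 0 < ε
  lt : ε < R
  rate_ne_zero : ∀ P : PuiseuxSeries, P.IsSolution Q → P.heightRate r s ≠ 0
  high : ∀ P : PuiseuxSeries, P.IsSolution Q → P.heightRate r s < 0 →
    ∀ t ∈ P.disk ε, t ≠ 0 → height r s (P.param t) < c
  low : ∀ P : PuiseuxSeries, P.IsSolution Q → 0 < P.heightRate r s →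
    (∀ t ∈ P.highSet r s ε c, ‖t‖ ^ P.k < ε) ∧
      ∃ ρ φ ψ, IsRoundNeighborhood (P.highSet r s ε c) ρ φ ψ

/-- There are finitely many solutions, so a common `ε` works for all of them, and then a common
bound on `c`. The order matters: how large `c` must be depends on `ε`. -/
lemma IsModel.exists_isGoodLevel (h : IsModel Q q R)
    (hrate : ∀ P : PuiseuxSeries, P.IsSolution Q → P.heightRate r s ≠ 0) :
    ∃ ε > 0, ∃ c₀ : ℝ, ∀ c, c₀ ≤ c → IsGoodLevel Q R r s ε c := by
  have key : ∀ P ∈ {P : PuiseuxSeries | P.IsSolution Q}, ∀ᶠ ε in 𝓝[>] (0 : ℝ),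
      ∀ᶠ c in Filter.atTop, (P.heightRate r s < 0 →
        ∀ t ∈ P.disk ε, t ≠ 0 → height r s (P.param t) < (c : ℝ)) ∧
      (0 < P.heightRate r s → (∀ t ∈ P.highSet r s ε c, ‖t‖ ^ P.k < ε) ∧
        ∃ ρ φ ψ, IsRoundNeighborhood (P.highSet r s ε c) ρ φ ψ) := by
    intro P hP
    rcases (hrate P hP).lt_or_gt with hA | hA
    · obtain ⟨δ, hδ, -, hc⟩ := h.eventually_height_lt hP hA
      filter_upwards [Ioc_mem_nhdsGT hδ] with ε hε
      filter_upwards [hc] with c hc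
      exact ⟨fun _ t ht => hc t (le_trans (b := ε) ht hε.2), fun hA' => absurd hA hA'.not_gt⟩
    · obtain ⟨δ, hδ, -, hc⟩ := h.eventually_isRoundNeighborhood hP hA
      filter_upwards [Ioc_mem_nhdsGT hδ] with ε hε
      filter_upwards [hc ε hε.1 hε.2] with c hc
      exact ⟨fun hA' => absurd hA hA'.not_gt, fun _ => hc⟩
  obtain ⟨ε, hε, hεR⟩ := Filter.nonempty_of_mem (Filter.inter_mem
    ((Filter.eventually_all_finite h.finite_solutions).2 key) (Ioo_mem_nhdsGT h.pos))
  obtain ⟨c₀, hc₀⟩ := Filter.eventually_atTop.1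
    ((Filter.eventually_all_finite h.finite_solutions).2 hε)
  exact ⟨ε, hεR.1, c₀, fun c hc => ⟨hεR.1, hεR.2, hrate, fun P hP => (hc₀ c hc P hP).1,
    fun P hP => (hc₀ c hc P hP).2⟩⟩

/-- The part of height at least `c` of the graph over `|x| ≤ ε`, with the endpoint if it is
finite. -/
def PuiseuxSeries.highGraph (P : PuiseuxSeries) (r s ε c : ℝ) : Set (ℂ × ℂ) :=
  P.graph (P.highSet r s ε c) ∪ {p | toCompact p = P.endpoint}

lemma PuiseuxSeries.mem_graph_highSet {p : ℂ × ℂ} :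
    p ∈ P.graph (P.highSet r s ε c) ↔ p ∈ P.diskGraph ε ∧ (c : EReal) ≤ height r s p := by
  rw [P.mem_graph, P.mem_diskGraph]
  constructor
  · rintro ⟨t, ⟨ht, hc⟩, h0, rfl⟩
    exact ⟨⟨t, ht, h0, rfl⟩, hc.resolve_left h0⟩
  · rintro ⟨⟨t, ht, h0, rfl⟩, hc⟩
    exact ⟨t, ⟨ht, Or.inr hc⟩, h0, rfl⟩

/-- Height depends only on the point, not on the parameter, so the rotation between conjugate
solutions does not matter. -/
lemma PuiseuxSeries.highGraph_congr (h1 : P'.diskGraph ε = P.diskGraph ε)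
    (h2 : P'.endpoint = P.endpoint) : P'.highGraph r s ε c = P.highGraph r s ε c := by
  ext p
  simp only [highGraph, Set.mem_union, mem_graph_highSet, h1, h2]

lemma PuiseuxSeries.preimage_compactParam_highSet (hε : 0 ≤ ε) :
    toCompact ⁻¹' (P.compactParam '' P.highSet r s ε c) = P.highGraph r s ε c :=
  P.preimage_compactParam_image ⟨P.zero_mem_disk hε, Or.inl rfl⟩

lemma IsRoundNeighborhood.image_eq {W : Set ℂ} {ρ : ℝ} {φ ψ : ℂ → ℂ}
    (hW : IsRoundNeighborhood W ρ φ ψ) : ψ '' Metric.closedBall 0 ρ = W :=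
  Set.Subset.antisymm (Set.image_subset_iff.2 hW.mapsTo_inv) fun t ht =>
    ⟨φ t, hW.mapsTo ht, hW.left_inv t ht⟩

lemma IsRoundNeighborhood.isPreconnected_diff {W : Set ℂ} {ρ : ℝ} {φ ψ : ℂ → ℂ}
    (hW : IsRoundNeighborhood W ρ φ ψ) : IsPreconnected (W \ {0}) := by
  have h0 : ψ 0 = 0 := by
    simpa only [hW.map_zero] using hW.left_inv 0 (mem_of_mem_nhds hW.mem_nhds)
  have : W \ {0} = ψ '' (Metric.closedBall 0 ρ \ {0}) := by
    ext t
    constructor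
    · rintro ⟨ht, ht0⟩
      refine ⟨φ t, ⟨hW.mapsTo ht, fun hφ => ht0 ?_⟩, hW.left_inv t ht⟩
      rw [← hW.left_inv t ht, Set.mem_singleton_iff.1 hφ, h0]
      rfl
    · rintro ⟨w, ⟨hw, hw0⟩, rfl⟩
      refine ⟨hW.mapsTo_inv hw, fun hψ => hw0 ?_⟩
      rw [← hW.right_inv w hw, Set.mem_singleton_iff.1 hψ, hW.map_zero]
      rfl
  rw [this]
  exact isPreconnected_closedBall_diff_zero.image ψ (hW.continuousOn_inv.mono Set.sdiff_subset)

namespace IsGoodLevel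

lemma highSet_mem_nhds (hg : IsGoodLevel Q R r s ε c) (hP : P.IsSolution Q)
    (hA : 0 < P.heightRate r s) : P.highSet r s ε c ∈ 𝓝 0 := by
  obtain ⟨-, ρ, φ, ψ, hW⟩ := hg.low P hP hA
  exact hW.mem_nhds

lemma exists_mem_highSet (hg : IsGoodLevel Q R r s ε c) (hP : P.IsSolution Q)
    (hA : 0 < P.heightRate r s) {S : Set ℂ} (hS : S ∈ 𝓝 (0 : ℂ)) :
    ∃ t ∈ P.highSet r s ε c, t ∈ S ∧ t ≠ 0 := by
  obtain ⟨t, ⟨h1, h2⟩, h3⟩ := Filter.nonempty_of_mem (Filter.inter_mem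
    (mem_nhdsWithin_of_mem_nhds (Filter.inter_mem (hg.highSet_mem_nhds hP hA) hS))
    (self_mem_nhdsWithin (a := (0 : ℂ)) (s := {0}ᶜ)))
  exact ⟨t, h1, h2, h3⟩

lemma highSet_subset (hg : IsGoodLevel Q R r s ε c) :
    P.highSet r s ε c ⊆ {t | ‖t‖ ^ P.k < R} := fun _ ht => P.disk_subset hg.lt ht.1

lemma highGraph_subset (hg : IsGoodLevel Q R r s ε c) (h : IsModel Q q R) (hP : P.IsSolution Q)
    (hA : 0 < P.heightRate r s) :
    P.highGraph r s ε c ⊆ {p | p ∈ superlevel Q r s c ∧ ‖p.1‖ < ε} := by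
  rintro p (hp | hp)
  · obtain ⟨t, ht, h0, rfl⟩ := P.mem_graph.1 hp
    refine ⟨⟨h.mem_zeroSet hP h0 (hg.highSet_subset ht), ht.2.resolve_left h0⟩, ?_⟩
    have := (hg.low P hP hA).1 t ht
    rw [← norm_pow] at this
    exact this
  · obtain ⟨hN, h0⟩ := h.order_eq_zero_of_endpoint hP hp
    have hp1 : p.1 = 0 := congrArg Prod.fst hp
    refine ⟨⟨h0 ▸ (h.eventually_mem_zeroSet_finiteParam hP hN).self_of_nhds, ?_⟩, ?_⟩
    · rw [height, if_pos (Or.inl hp1)]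
      exact le_top
    · simpa [hp1] using hg.pos

/-- Off `x = 0` a solution of negative rate stays below height `c`. A point over `x = 0` is a finite
endpoint, so `j₀ = 0` and the rate is `r̂k > 0`. -/
lemma exists_mem_highGraph (hg : IsGoodLevel Q R r s ε c) (h : IsModel Q q R) (hr : 0 < r)
    (hs : 0 < s) {p : ℂ × ℂ} (hp : p ∈ superlevel Q r s c) (hpε : ‖p.1‖ ≤ ε) :
    ∃ P : PuiseuxSeries, P.IsSolution Q ∧ 0 < P.heightRate r s ∧ p ∈ P.highGraph r s ε c := by
  by_cases h0 : p.1 = 0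
  · obtain ⟨P, hP, heq⟩ := h.exists_endpoint_eq hp.1 h0
    refine ⟨P, hP, ?_, Or.inr heq⟩
    rw [PuiseuxSeries.heightRate, (h.order_eq_zero_of_endpoint hP heq).1]
    have hk : (0 : ℝ) < P.k := by exact_mod_cast P.k_pos
    have := mul_pos (div_pos hr (add_pos hr hs)) hk
    simpa using this
  · obtain ⟨P, hP, t, ht0, -, rfl⟩ := h.exists_solution_through hp.1 h0 (hpε.trans_lt hg.lt)
    have htε : t ∈ P.disk ε := by
      have : ‖t ^ P.k‖ ≤ ε := hpε
      rwa [norm_pow] at this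
    refine ⟨P, hP, (hg.rate_ne_zero P hP).lt_or_gt.resolve_left fun hA => ?_,
      Or.inl (P.mem_graph.2 ⟨t, ⟨htε, Or.inr hp.2⟩, ht0, rfl⟩)⟩
    exact absurd hp.2 (not_le.2 (hg.high P hP hA t htε ht0))

lemma isClosed_highGraph (hg : IsGoodLevel Q R r s ε c) (h : IsModel Q q R) (hP : P.IsSolution Q)
    (hA : 0 < P.heightRate r s) : IsClosed (P.highGraph r s ε c) := by
  rw [← P.preimage_compactParam_highSet hg.pos.le]
  obtain ⟨-, ρ, φ, ψ, hW⟩ := hg.low P hP hA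
  refine h.isClosed_preimage_compactParam hP ?_ hg.highSet_subset
  rw [← hW.image_eq]
  exact (isCompact_closedBall 0 ρ).image_of_continuousOn hW.continuousOn_inv

/-- The punctured neighbourhood has connected image, and a finite endpoint lies in the closure of
that image. -/
lemma isPreconnected_highGraph (hg : IsGoodLevel Q R r s ε c) (h : IsModel Q q R)
    (hP : P.IsSolution Q) (hA : 0 < P.heightRate r s) : IsPreconnected (P.highGraph r s ε c) := by
  obtain ⟨-, ρ, φ, ψ, hW⟩ := hg.low P hP hA
  have hgr : IsPreconnected (P.graph (P.highSet r s ε c)) :=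
    hW.isPreconnected_diff.image _
      ((h.continuousOn_param hP).mono fun t ht => ⟨hg.highSet_subset ht.1, ht.2⟩)
  refine hgr.subset_closure Set.subset_union_left (Set.union_subset subset_closure fun p hp => ?_)
  obtain ⟨hN, h0⟩ := h.order_eq_zero_of_endpoint hP hp
  refine mem_closure_of_tendsto (f := P.finiteParam) (b := 𝓝[≠] (0 : ℂ)) ?_ ?_
  · have := (h.continuousAt_finiteParam hP).tendsto
    rw [h0] at this
    exact this.mono_left nhdsWithin_le_nhds
  · filter_upwards [mem_nhdsWithin_of_mem_nhds hW.mem_nhds, self_mem_nhdsWithin] with t ht ht0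
    rw [← h.param_eq_finiteParam hP hN ht0 (hg.highSet_subset ht)]
    exact P.mem_graph.2 ⟨t, ht, ht0, rfl⟩

/-- A common point lies on both punctured graphs or is the endpoint of both. In the second case
smoothness provides a common point off `x = 0`, and the solutions are conjugate. -/
lemma highGraph_eq_of_mem (hg : IsGoodLevel Q R r s ε c) (h : IsModel Q q R)
    (hsmooth : IsSmoothCurve Q) (hP : P.IsSolution Q) (hP' : P'.IsSolution Q) {p : ℂ × ℂ}
    (hp : p ∈ P.highGraph r s ε c) (hp' : p ∈ P'.highGraph r s ε c) :
    P'.highGraph r s ε c = P.highGraph r s ε c := by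
  have key : ∃ t t' : ℂ, t ≠ 0 ∧ t' ≠ 0 ∧ ‖t‖ ^ P.k < R ∧ ‖t'‖ ^ P'.k < R ∧
      P.param t = P'.param t' := by
    have hne : ∀ P P' : PuiseuxSeries, p ∈ P.graph (P.highSet r s ε c) →
        toCompact p ≠ P'.endpoint := by
      intro P P' hp hp'
      obtain ⟨t, -, h0, rfl⟩ := P.mem_graph.1 hp
      exact pow_ne_zero P.k h0 (congrArg Prod.fst hp')
    rcases hp with hp | hp <;> rcases hp' with hp' | hp'
    · obtain ⟨t, ht, h0, rfl⟩ := P.mem_graph.1 hp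
      obtain ⟨t', ht', h0', heq⟩ := P'.mem_graph.1 hp'
      exact ⟨t, t', h0, h0', hg.highSet_subset ht, hg.highSet_subset ht', heq.symm⟩
    · exact absurd hp' (hne P P' hp)
    · exact absurd hp (hne P' P hp')
    · exact h.exists_param_eq_of_endpoint_eq hsmooth hP hP' hp hp'
  obtain ⟨t, t', h0, h0', ht, ht', heq⟩ := key
  obtain ⟨h1, h2⟩ := h.conjugate_of_mem hP hP' h0 h0' ht ht' heq
  exact PuiseuxSeries.highGraph_congr (h1 ε hg.lt) h2

/-- The rest of the superlevel set lies in the closed union of `|x| ≥ ε` and the disjoint graphs of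
the other solutions; the strict bound `|x| < ε` on this graph keeps it away from the former. -/
lemma connectedComponentIn_superlevel (hg : IsGoodLevel Q R r s ε c) (h : IsModel Q q R)
    (hsmooth : IsSmoothCurve Q) (hr : 0 < r) (hs : 0 < s) (hP : P.IsSolution Q)
    (hA : 0 < P.heightRate r s) {p : ℂ × ℂ} (hp : p ∈ P.highGraph r s ε c) :
    connectedComponentIn (superlevel Q r s c) p = P.highGraph r s ε c := by
  set T : Set PuiseuxSeries := {P' | P'.IsSolution Q ∧ 0 < P'.heightRate r s ∧
    Disjoint (P.highGraph r s ε c) (P'.highGraph r s ε c)}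
  have hT : T.Finite := h.finite_solutions.subset fun P' hP' => hP'.1
  have hfar : IsClosed {p : ℂ × ℂ | ε ≤ ‖p.1‖} :=
    isClosed_le continuous_const continuous_fst.norm
  refine connectedComponentIn_eq_of_closed_cover (C := P.highGraph r s ε c)
    (C' := (⋃ P' ∈ T, P'.highGraph r s ε c) ∪ {p | ε ≤ ‖p.1‖})
    (hg.isPreconnected_highGraph h hP hA) (fun p hp => (hg.highGraph_subset h hP hA hp).1)
    (hg.isClosed_highGraph h hP hA)
    ((hT.isClosed_biUnion fun P' hP' => hg.isClosed_highGraph h hP'.1 hP'.2.1).union hfar)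
    (fun p hp => ?_) Set.inter_subset_right ?_ hp
  · rcases le_total ε ‖p.1‖ with hle | hle
    · exact Or.inr (Or.inr hle)
    obtain ⟨P', hP', hA', hp'⟩ := hg.exists_mem_highGraph h hr hs hp hle
    by_cases hd : Disjoint (P.highGraph r s ε c) (P'.highGraph r s ε c)
    · exact Or.inr (Or.inl (Set.mem_biUnion (show P' ∈ T from ⟨hP', hA', hd⟩) hp'))
    · obtain ⟨z, hz, hz'⟩ := Set.not_disjoint_iff.1 hd
      exact Or.inl (hg.highGraph_eq_of_mem h hsmooth hP hP' hz hz' ▸ hp')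
  · rw [Set.disjoint_union_right, Set.disjoint_iUnion₂_right]
    refine ⟨fun P' hP' => hP'.2.2, Set.disjoint_left.2 fun p hp hp' => ?_⟩
    exact (hg.highGraph_subset h hP hA hp).2.not_ge hp'

lemma exists_mem_highGraph_norm_lt (hg : IsGoodLevel Q R r s ε c) (hP : P.IsSolution Q)
    (hA : 0 < P.heightRate r s) {δ : ℝ} (hδ : 0 < δ) :
    ∃ p ∈ P.highGraph r s ε c, ‖p.1‖ < δ := by
  obtain ⟨t, ht, htδ, h0⟩ := hg.exists_mem_highSet hP hA (eventually_mem_disk P hδ)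
  refine ⟨P.param t, Or.inl (P.mem_graph.2 ⟨t, ht, h0, rfl⟩), ?_⟩
  rw [PuiseuxSeries.param, norm_pow]
  exact htδ

/-- A component that contains a point with `|x| < ε` meets one of the graphs, and that graph is
itself a component of the superlevel set. -/
lemma mem_xSuperlevel_iff (hg : IsGoodLevel Q R r s ε c) (h : IsModel Q q R)
    (hsmooth : IsSmoothCurve Q) (hr : 0 < r) (hs : 0 < s) {p : ℂ × ℂ} :
    p ∈ xSuperlevel Q r s c ↔
      ∃ P : PuiseuxSeries, P.IsSolution Q ∧ 0 < P.heightRate r s ∧ p ∈ P.highGraph r s ε c := by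
  constructor
  · rintro ⟨C, ⟨⟨z, hz, rfl⟩, hC⟩, hp⟩
    obtain ⟨z', hz', hlt⟩ := hC ε hg.pos
    obtain ⟨P, hP, hA, hmem⟩ := hg.exists_mem_highGraph h hr hs
      (connectedComponentIn_subset _ _ hz') hlt.le
    refine ⟨P, hP, hA, ?_⟩
    rwa [← hg.connectedComponentIn_superlevel h hsmooth hr hs hP hA hmem,
      ← connectedComponentIn_eq hz']
  · rintro ⟨P, hP, hA, hp⟩
    refine ⟨P.highGraph r s ε c, ⟨⟨p, (hg.highGraph_subset h hP hA hp).1,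
      (hg.connectedComponentIn_superlevel h hsmooth hr hs hP hA hp).symm⟩, fun δ hδ =>
      hg.exists_mem_highGraph_norm_lt hP hA hδ⟩, hp⟩

lemma xSuperlevel_subset : xSuperlevel Q r s c ⊆ superlevel Q r s c := by
  rintro p ⟨C, ⟨⟨z, -, rfl⟩, -⟩, hp⟩
  exact connectedComponentIn_subset _ _ hp

lemma connectedComponentIn_xSuperlevel (hg : IsGoodLevel Q R r s ε c) (h : IsModel Q q R)
    (hsmooth : IsSmoothCurve Q) (hr : 0 < r) (hs : 0 < s) (hP : P.IsSolution Q)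
    (hA : 0 < P.heightRate r s) {p : ℂ × ℂ} (hp : p ∈ P.highGraph r s ε c) :
    connectedComponentIn (xSuperlevel Q r s c) p = P.highGraph r s ε c := by
  refine Set.Subset.antisymm ?_ ((hg.isPreconnected_highGraph h hP hA).subset_connectedComponentIn
    hp fun z hz => (hg.mem_xSuperlevel_iff h hsmooth hr hs).2 ⟨P, hP, hA, hz⟩)
  rw [← hg.connectedComponentIn_superlevel h hsmooth hr hs hP hA hp]
  exact connectedComponentIn_mono _ xSuperlevel_subset

theorem isComponent_xSuperlevel_iff (hg : IsGoodLevel Q R r s ε c) (h : IsModel Q q R)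
    (hsmooth : IsSmoothCurve Q) (hr : 0 < r) (hs : 0 < s) {B : Set (ℂ × ℂ)} :
    IsComponent (xSuperlevel Q r s c) B ↔
      ∃ P : PuiseuxSeries, P.IsSolution Q ∧ 0 < P.heightRate r s ∧ B = P.highGraph r s ε c := by
  constructor
  · rintro ⟨p, hp, rfl⟩
    obtain ⟨P, hP, hA, hmem⟩ := (hg.mem_xSuperlevel_iff h hsmooth hr hs).1 hp
    exact ⟨P, hP, hA, hg.connectedComponentIn_xSuperlevel h hsmooth hr hs hP hA hmem⟩
  · rintro ⟨P, hP, hA, rfl⟩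
    obtain ⟨p, hp, -⟩ := hg.exists_mem_highGraph_norm_lt hP hA one_pos
    exact ⟨p, (hg.mem_xSuperlevel_iff h hsmooth hr hs).2 ⟨P, hP, hA, hp⟩,
      (hg.connectedComponentIn_xSuperlevel h hsmooth hr hs hP hA hp).symm⟩

lemma isGraphNearZero_highGraph (hg : IsGoodLevel Q R r s ε c) (h : IsModel Q q R)
    (hP : P.IsSolution Q) (hA : 0 < P.heightRate r s) :
    P.IsGraphNearZero (P.highGraph r s ε c) :=
  ⟨P.highSet r s ε c, hg.highSet_mem_nhds hP hA,
    fun _ ht => h.convergesAt hP (hg.highSet_subset ht), rfl⟩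

lemma highGraph_inter (hg : IsGoodLevel Q R r s ε c) (h : IsModel Q q R) (hP : P.IsSolution Q) :
    P.highGraph r s ε c ∩ zeroSetOffAxes Q = P.graph (P.highSet r s ε c) := by
  ext p
  constructor
  · rintro ⟨hp | hp, -, h1, -⟩
    · exact hp
    · exact absurd (congrArg Prod.fst hp) h1
  · intro hp
    refine ⟨Or.inl hp, ?_⟩
    obtain ⟨t, ht, h0, rfl⟩ := P.mem_graph.1 hp
    exact h.param_mem hP h0 (hg.highSet_subset ht)

/-- A component that is the graph of `P` near zero is homotopic to the disk of `P`. -/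
theorem homotopicIn (hg : IsGoodLevel Q R r s ε c) (h : IsModel Q q R)
    (hsmooth : IsSmoothCurve Q) (hr : 0 < r) (hs : 0 < s) (hP : P.IsSolution Q)
    {B : Set (ℂ × ℂ)} (hB : IsComponent (xSuperlevel Q r s c) B) (hPB : P.IsGraphNearZero B)
    {η : ℝ} (hη : 0 < η) (hηε : η ≤ ε) :
    HomotopicIn (zeroSetOffAxes Q) (P.diskGraph η) (B ∩ zeroSetOffAxes Q) := by
  obtain ⟨P', hP', hA', rfl⟩ := (hg.isComponent_xSuperlevel_iff h hsmooth hr hs).1 hB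
  obtain ⟨W, hW, -, hWB⟩ := hPB
  -- `B` is a graph of both `P` and `P'`; a shared point with `x ≠ 0` makes them conjugate, so their
  -- disks coincide.
  obtain ⟨t, ⟨htW, htR⟩, h0⟩ := Filter.nonempty_of_mem (Filter.inter_mem
    (mem_nhdsWithin_of_mem_nhds (Filter.inter_mem hW (eventually_mem_disk P h.pos)))
    (self_mem_nhdsWithin (a := (0 : ℂ)) (s := {0}ᶜ)))
  have hmem : P.param t ∈ P'.highGraph r s ε c := by
    rw [hWB]
    exact Or.inl (P.mem_graph.2 ⟨t, htW, h0, rfl⟩)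
  rcases hmem with hmem | hmem
  · obtain ⟨t', ht', h0', heq⟩ := P'.mem_graph.1 hmem
    have hconj := h.conjugate_of_mem hP' hP h0' h0 (hg.highSet_subset ht') htR heq
    obtain ⟨-, ρ, φ, ψ, hround⟩ := hg.low P' hP' hA'
    rw [hconj.1 η (hηε.trans_lt hg.lt), hg.highGraph_inter h hP']
    exact h.homotopicIn_graph hP' hround hη hηε hg.lt fun t ht => ht.1
  · exact absurd (congrArg Prod.fst hmem) (pow_ne_zero P.k h0)

end IsGoodLevel

end

theorem theorem3p2 (Q : Polynomial (Polynomial ℂ)) (hQ0 : Q.evalEval 0 0 ≠ 0)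
    (hsmooth : IsSmoothCurve Q) (r s : ℝ) (hr : 0 < r) (hs : 0 < s)
    (hbad : r / s ∉ badDirections Q) :
    ∃ ε₀ > (0 : ℝ), ∃ c₀ : ℝ, ∀ ε : ℝ, 0 < ε → ε ≤ ε₀ → ∀ c : ℝ, c₀ ≤ c →
      -- (i) the graph of each Puiseux expansion over the punctured disk is a component
      (∀ P : PuiseuxSeries, P.IsSolution Q →
        (∀ t : ℂ, ‖t‖ ^ P.k ≤ ε → P.ConvergesAt t) ∧
        IsComponent (zeroSetOffAxes Q ∩ {p | ‖p.1‖ ≤ ε}) (P.diskGraph ε)) ∧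
      -- (ii) it is a (punctured) disk whose boundary winds `k` times around the `y`-axis
      (∀ P : PuiseuxSeries, P.IsSolution Q →
        IsDiskWindingAroundYAxis (P.diskGraph ε) P.endpoint ε P.k) ∧
      -- (iii) the components of `X^{≥ c}` are exactly the graphs with direction `< r / s`
      ((∀ B : Set (ℂ × ℂ), IsComponent (xSuperlevel Q r s c) B →
          ∃ P : PuiseuxSeries, P.IsSolution Q ∧ P.direction < r / s ∧ P.IsGraphNearZero B) ∧
        (∀ P : PuiseuxSeries, P.IsSolution Q → P.direction < r / s →
          ∃ B : Set (ℂ × ℂ), IsComponent (xSuperlevel Q r s c) B ∧ P.IsGraphNearZero B)) ∧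
      -- (iv) components with the same Puiseux series are homotopic in `𝒱'`
      (∀ P : PuiseuxSeries, P.IsSolution Q → ∀ B : Set (ℂ × ℂ),
        IsComponent (xSuperlevel Q r s c) B → P.IsGraphNearZero B →
          HomotopicIn (zeroSetOffAxes Q) (P.diskGraph ε) (B ∩ zeroSetOffAxes Q)) := by
  obtain ⟨q, R, h⟩ := exists_isModel Q hQ0
  obtain ⟨ε₀, hε₀, c₀, hgood⟩ := h.exists_isGoodLevel (r := r) (s := s) fun P hP =>
    PuiseuxSeries.heightRate_ne_zero hr hs hbad hP
  refine ⟨ε₀, hε₀, c₀, fun ε hε hεε c hc => ?_⟩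
  -- The superlevel components are analysed at the fixed radius `ε₀`; only the disks depend on `ε`,
  -- so `c₀` is independent of `ε`.
  have hg := hgood c hc
  have hεR := hεε.trans_lt hg.lt
  refine ⟨fun P hP => ⟨fun t ht => h.convergesAt hP (lt_of_le_of_lt ht hεR),
    h.isComponent_diskGraph hP hε hεR⟩, fun P hP => h.isDiskWindingAroundYAxis hP hε hεR,
    ⟨fun B hB => ?_, fun P hP hd => ?_⟩,
    fun P hP B hB hPB => hg.homotopicIn h hsmooth hr hs hP hB hPB hε hεε⟩
  · obtain ⟨P, hP, hA, rfl⟩ := (hg.isComponent_xSuperlevel_iff h hsmooth hr hs).1 hB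
    exact ⟨P, hP, (P.direction_lt_iff hr hs).2 hA, hg.isGraphNearZero_highGraph h hP hA⟩
  · have hA := (P.direction_lt_iff hr hs).1 hd
    exact ⟨P.highGraph r s ε₀ c, (hg.isComponent_xSuperlevel_iff h hsmooth hr hs).2
      ⟨P, hP, hA, rfl⟩, hg.isGraphNearZero_highGraph h hP hA⟩
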